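/- **Setting.** All alphabets are finite. An $N$-node acyclic discrete memoryless network (ADMN) consists of alphabets $\mathcal X_k,\mathcal Y_k$ and conditional pmfs $p(y_k\mid y^{k-1},x^{k-1})$, $k\in[1:N]$, where $x^{k-1}=(x_1,\dots,x_{k-1})$. For block length $n$ the node processing functions are maps $\mathcal Y_k^n\to\mathcal X_k^n$; sequentially for $k=1,\dots,N$, $Y_k^n$ is generated according to $\prod_{i=1}^n p(y_{k,i}\mid y^{k-1}_i,x^{k-1}_i)$ and node $k$ maps it to $X_k^n$. A target pmf $p^*(x_{[1:N]},y_{[1:N]})$ is *achievable* if there is a sequence (in $n$) of node processing functions such that for every $\epsilon>0$, $P\big((X^n_{[1:N]},Y^n_{[1:N]})\notin\mathcal T^{(n)}_\epsilon\big)\to0$ as $n\to\infty$, where $\mathcal T^{(n)}_\epsilon$ is the set of sequences $z^n$ with $|\pi_{z^n}(a)/n-p^*(a)|\le\epsilon\,p^*(a)$ for all symbols $a$, $\pi_{z^n}(a)$ being the number of occurrences of $a$ in $z^n$. For set-valued families write $T_S=\bigcup_{j\in S}T_j$ and $W^{k-1}=\bigcup_{i<k}W_i$, and let $S[j]=\{i\in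 S:i<j\}$. Let $\Omega'$ be the set of all coding parameters consisting of 1. a positive integer $\mu$, finite alphabets $\mathcal U_j$ and rates $r_j\ge0$ for $j\in[1:\mu]$; 2. sets $A_j\subseteq[1:\mu]$ and, with $\Gamma_j=\{j\}\cup A_j$, sets $D_k\subseteq W^{k-1}$, $B_k\subseteq W^{k-1}\setminus D_k$, $W_k\subseteq[1:\mu]\setminus W^{k-1}$ for $j\in[1:\mu]$, $k\in[1:N]$, such that the sets $\Gamma_{W_k}\setminus\Gamma_{D_k}$, $k\in[1:N]$, are pairwise disjoint; $\Gamma_{A_j}\subseteq\Gamma_j$, and $j'<j$ whenever $j'\in A_j$; $A_{W_k}\subseteq W_k\cup D_k$, $A_{B_k}\subseteq D_k\cup B_k$, and $A_{D_k}\subseteq D_k$; 3. conditional pmfs $p(u_{W_k}\mid u_{D_k},y_k)$ and functions $x_k(u_{D_k},u_{W_k},y_k)$, $k\in[1:N]$, such that the joint pmf $$\prod_{k=1}^N p(y_k\mid y^{k-1},x^{k-1})\,p(u_{W_k}\mid u_{D_k},y_k)\,\mathbb 1_{x_k=x_k(u_{D_k},u_{W_k},y_k)}$$ has $(x_{[1:N]},y_{[1:N]})$-marginal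 $p^*$. **Corollary 1.** For an $N$-node ADMN, $p^*$ is achievable if there exists $\omega'\in\Omega'$ such that for every $1\le k\le N$ $$\sum_{j\in S_k}r_j<\sum_{j\in S_k}I(U_j;U_{S_k[j]\cup S_k^c},Y_k\mid U_{A_j})$$ for all $S_k\subseteq D_k\cup B_k$ such that $S_k\cap D_k\ne\emptyset$ and $A_j\subseteq S_k^c$ for every $j\in S_k^c$, where $S_k^c=(D_k\cup B_k)\setminus S_k$, and $$\sum_{j\in T_k}r_j>\sum_{j\in T_k}I(U_j;U_{T_k[j]\cup D_k},Y_k\mid U_{A_j})$$ for all $T_k\subseteq W_k$ such that $T_k\ne\emptyset$ and $A_j\cap W_k\subseteq T_k$ for every $j\in T_k$. The mutual informations (in bits) are taken under the joint pmf in item 3. -/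

import Mathlib

open Filter Topology

/-- `p` is a probability mass function on the finite set `α`. -/
def IsPmf {α : Type*} [Fintype α] (p : α → ℝ) : Prop :=
  (∀ a, 0 ≤ p a) ∧ ∑ a, p a = 1

/-! ### Information measures (in bits) of random variables on a finite probability space -/

section Information

variable {Ω α β γ : Type*} [Fintype Ω]

open scoped Classical in
/-- The pmf of the random variable `V` when the sample space `Ω` carries the pmf `p`. -/
noncomputable def lawOf (p : Ω → ℝ) (V : Ω → α) (a : α) : ℝ :=
  ∑ w, if V w = a then p w else 0

/-- The Shannon entropy `H(V)` in bits (with `0 log 0 = 0`). -/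
noncomputable def entropy [Fintype α] (p : Ω → ℝ) (V : Ω → α) : ℝ :=
  -∑ a, lawOf p V a * Real.logb 2 (lawOf p V a)

/-- The conditional entropy `H(V | Z) = H(V, Z) - H(Z)`. -/
noncomputable def condEntropy [Fintype α] [Fintype γ] (p : Ω → ℝ) (V : Ω → α) (Z : Ω → γ) : ℝ :=
  entropy p (fun w => (V w, Z w)) - entropy p Z

/-- The conditional mutual information `I(V; V' | Z) = H(V | Z) - H(V | V', Z)`. -/
noncomputable def condMutualInfo [Fintype α] [Fintype β] [Fintype γ]
    (p : Ω → ℝ) (V : Ω → α) (V' : Ω → β) (Z : Ω → γ) : ℝ :=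
  condEntropy p V Z - condEntropy p V (fun w => (V' w, Z w))

end Information

/-! ### Acyclic discrete memoryless networks and achievability -/

/-- An `N`-node acyclic discrete memoryless network with finite alphabets `X k`, `Y k`:
a collection of conditional pmfs `p(y_k | x^{k-1}, y^{k-1})`. -/
structure ADMN (N : ℕ) (X Y : Fin N → Type*) [∀ k, Fintype (Y k)] where
  chan : ∀ k : Fin N,
    ((i : {i : Fin N // i < k}) → X i) → ((i : {i : Fin N // i < k}) → Y i) → Y k → ℝ
  chan_isPmf : ∀ k x y, IsPmf (chan k x y)

section Achievability

variable {N : ℕ} {X Y : Fin N → Type*}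

open scoped Classical in
/-- The sequence `z` of length `n` is `ε`-typical with respect to the pmf `p`:
`|π_z(a) / n - p(a)| ≤ ε p(a)` for every symbol `a`, where `π_z(a)` is the number of occurrences
of `a` in `z`. -/
def IsTypical {α : Type*} (p : α → ℝ) (ε : ℝ) {n : ℕ} (z : Fin n → α) : Prop :=
  ∀ a, |((Finset.univ.filter fun t => z t = a).card : ℝ) / n - p a| ≤ ε * p a

/-- Processing functions of the nodes for block length `n`: node `k` maps `Y_k^n` to `X_k^n`. -/
def NodeProcessing (X Y : Fin N → Type*) (n : ℕ) : Type _ :=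
  ∀ k : Fin N, (Fin n → Y k) → (Fin n → X k)

/-- The sequence of symbol tuples `(x_[1:N], y_[1:N])` over time that results when the nodes
receive the sequences `y k` and apply the processing functions `f`. -/
def resultingSequence {n : ℕ} (f : NodeProcessing X Y n) (y : ∀ k, Fin n → Y k) :
    Fin n → (∀ k, X k) × (∀ k, Y k) :=
  fun t => (fun k => f k (y k) t, fun k => y k t)

variable [∀ k, Fintype (Y k)]

/-- The probability that the nodes receive the sequences `y k` when they operate sequentially with
the processing functions `f`: given the past nodes, `Y_k^n` has the law
`∏_t p(y_{k,t} | x^{k-1}_t, y^{k-1}_t)`. -/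
def receiveProb (net : ADMN N X Y) {n : ℕ} (f : NodeProcessing X Y n)
    (y : ∀ k, Fin n → Y k) : ℝ :=
  ∏ k, ∏ t, net.chan k (fun i => f i (y i) t) (fun i => y i t) (y k t)

open scoped Classical in
/-- The error probability `P((X_[1:N]^n, Y_[1:N]^n) ∉ T_ε^{(n)})`, typicality being with respect to
the target distribution `pstar`. -/
noncomputable def errorProb (net : ADMN N X Y) (pstar : (∀ k, X k) × (∀ k, Y k) → ℝ) (ε : ℝ)
    {n : ℕ} (f : NodeProcessing X Y n) : ℝ :=
  ∑ y : ∀ k, Fin n → Y k,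
    if IsTypical pstar ε (resultingSequence f y) then 0 else receiveProb net f y

/-- The target distribution `pstar` is achievable: one sequence of node processing functions makes
the error probability vanish for every `ε > 0`. -/
def Achievable (net : ADMN N X Y) (pstar : (∀ k, X k) × (∀ k, Y k) → ℝ) : Prop :=
  ∃ f : ∀ n : ℕ, NodeProcessing X Y n,
    ∀ ε : ℝ, 0 < ε → Tendsto (fun n => errorProb net pstar ε (f n)) atTop (𝓝 0)

end Achievability

/-! ### Coding parameters -/

/-- Coding parameters with `μ` index sets and `ν` covering codebooks, without the requirement on
the induced distribution. -/
structure CodingParameters (N : ℕ) (X Y : Fin N → Type*) (μ ν : ℕ) where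
  mu_pos : 0 < μ
  nu_pos : 0 < ν
  /-- the codeword alphabets -/
  U : Fin ν → Type*
  fintypeU : ∀ j, Fintype (U j)
  /-- the rates of the index sets -/
  r : Fin μ → ℝ
  r_nonneg : ∀ i, 0 ≤ r i
  /-- the index sets associated with each codebook -/
  Γ : Fin ν → Finset (Fin μ)
  /-- the codebooks on which each codebook is superposed -/
  A : Fin ν → Finset (Fin ν)
  /-- codebooks decoded uniquely at each node -/
  D : Fin N → Finset (Fin ν)
  /-- codebooks decoded nonuniquely at each node -/
  B : Fin N → Finset (Fin ν)
  /-- codebooks used for compression at each node -/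
  W : Fin N → Finset (Fin ν)
  D_subset : ∀ k, D k ⊆ (Finset.Iio k).biUnion W
  B_subset : ∀ k, B k ⊆ (Finset.Iio k).biUnion W \ D k
  W_subset : ∀ k, W k ⊆ Finset.univ \ (Finset.Iio k).biUnion W
  index_disjoint : ∀ k k', k ≠ k' →
    Disjoint ((W k).biUnion Γ \ (D k).biUnion Γ) ((W k').biUnion Γ \ (D k').biUnion Γ)
  index_superposition : ∀ j, (A j).biUnion Γ ⊆ Γ j
  superposition_lt : ∀ j, ∀ j' ∈ A j, j' < j
  superposition_W : ∀ k, (W k).biUnion A ⊆ W k ∪ D k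
  superposition_B : ∀ k, (B k).biUnion A ⊆ D k ∪ B k
  superposition_D : ∀ k, (D k).biUnion A ⊆ D k
  /-- the conditional pmf `p(u_{W_k} | u_{D_k}, y_k)` -/
  compress : ∀ k, ((j : D k) → U j) → Y k → ((j : W k) → U j) → ℝ
  compress_isPmf : ∀ k uD y, IsPmf (compress k uD y)
  /-- the function `x_k(u_{D_k}, u_{W_k}, y_k)` of the symbol-by-symbol mapping -/
  symbolMap : ∀ k, ((j : D k) → U j) → ((j : W k) → U j) → Y k → X k

attribute [instance] CodingParameters.fintypeU

namespace CodingParameters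

variable {N : ℕ} {X Y : Fin N → Type*} {μ ν : ℕ}

/-- The codebooks that some node uses, `W_1 ∪ ⋯ ∪ W_N`. The variable `U_j` exists for these `j`. -/
def used (ω : CodingParameters N X Y μ ν) : Finset (Fin ν) := Finset.univ.biUnion ω.W

theorem W_subset_used (ω : CodingParameters N X Y μ ν) (k : Fin N) : ω.W k ⊆ ω.used :=
  Finset.subset_biUnion_of_mem ω.W (Finset.mem_univ k)

theorem D_subset_used (ω : CodingParameters N X Y μ ν) (k : Fin N) : ω.D k ⊆ ω.used :=
  (ω.D_subset k).trans (Finset.biUnion_subset_biUnion_of_subset_left _ (Finset.subset_univ _))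

/-- The single-letter sample space: tuples `(u_{W^N}, x_[1:N], y_[1:N])`. -/
abbrev Sample (ω : CodingParameters N X Y μ ν) : Type _ :=
  ((j : ω.used) → ω.U j) × (∀ k, X k) × (∀ k, Y k)

/-- The components `u_S`. (Only sets `S` of used codebooks matter.) -/
def uVar (ω : CodingParameters N X Y μ ν) (S : Finset (Fin ν)) (s : ω.Sample) :
    (j : ↥(S ∩ ω.used)) → ω.U j :=
  fun j => s.1 ⟨j, (Finset.mem_inter.mp j.2).2⟩

/-- The component `y_k`. -/
def yVar (ω : CodingParameters N X Y μ ν) (k : Fin N) (s : ω.Sample) : Y k := s.2.2 k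

variable [∀ k, Fintype (Y k)]

open scoped Classical in
/-- The joint pmf
`∏_k p(y_k | y^{k-1}, x^{k-1}) p(u_{W_k} | u_{D_k}, y_k) 1{x_k = x_k(u_{D_k}, u_{W_k}, y_k)}`. -/
noncomputable def jointPmf (ω : CodingParameters N X Y μ ν) (net : ADMN N X Y)
    (s : ω.Sample) : ℝ :=
  ∏ k, (net.chan k (fun i => s.2.1 i) (fun i => s.2.2 i) (s.2.2 k) *
    ω.compress k (fun j => s.1 ⟨j, ω.D_subset_used k j.2⟩) (s.2.2 k)
      (fun j => s.1 ⟨j, ω.W_subset_used k j.2⟩) *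
    if s.2.1 k = ω.symbolMap k (fun j => s.1 ⟨j, ω.D_subset_used k j.2⟩)
      (fun j => s.1 ⟨j, ω.W_subset_used k j.2⟩) (s.2.2 k) then 1 else 0)

variable [∀ k, Fintype (X k)]

/-- `I(U_j; U_S, Y_k | U_A)` under the joint pmf. -/
noncomputable def mutualInfo (ω : CodingParameters N X Y μ ν) (net : ADMN N X Y)
    (j : Fin ν) (S : Finset (Fin ν)) (k : Fin N) (A : Finset (Fin ν)) : ℝ :=
  condMutualInfo (ω.jointPmf net) (ω.uVar {j}) (fun s => (ω.uVar S s, ω.yVar k s)) (ω.uVar A)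

end CodingParameters

/-- The set `Ω` (for given `μ`, `ν`) of coding parameters whose induced distribution of
`(X_[1:N], Y_[1:N])` is the target distribution. -/
def Omega {N : ℕ} {X Y : Fin N → Type*} [∀ k, Fintype (X k)] [∀ k, Fintype (Y k)]
    (net : ADMN N X Y) (pstar : (∀ k, X k) × (∀ k, Y k) → ℝ) (μ ν : ℕ) :
    Set (CodingParameters N X Y μ ν) :=
  {ω | ∀ xy, lawOf (ω.jointPmf net) (fun s => s.2) xy = pstar xy}

/-- The set `Ω'` (for given `μ`): the `ω ∈ Ω` with `ν = μ` and `Γ_j = {j} ∪ A_j`. -/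
def OmegaPrime {N : ℕ} {X Y : Fin N → Type*} [∀ k, Fintype (X k)] [∀ k, Fintype (Y k)]
    (net : ADMN N X Y) (pstar : (∀ k, X k) × (∀ k, Y k) → ℝ) (μ : ℕ) :
    Set (CodingParameters N X Y μ μ) :=
  {ω | ω ∈ Omega net pstar μ μ ∧ ∀ j, ω.Γ j = {j} ∪ ω.A j}

namespace CodingParameters

variable {N : ℕ} {X Y : Fin N → Type*} [∀ k, Fintype (X k)] [∀ k, Fintype (Y k)] {μ : ℕ}

/-- The decoding inequalities at node `k`. Here `S[j] = {i ∈ S : i < j}`, and the complement `Sᶜ`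
is taken in `D_k ∪ B_k`. -/
def DecodingCondition (ω : CodingParameters N X Y μ μ) (net : ADMN N X Y) (k : Fin N) : Prop :=
  ∀ S ⊆ ω.D k ∪ ω.B k, (S ∩ ω.D k).Nonempty →
    (∀ j ∈ (ω.D k ∪ ω.B k) \ S, ω.A j ⊆ (ω.D k ∪ ω.B k) \ S) →
    ∑ j ∈ S, ω.r j <
      ∑ j ∈ S, ω.mutualInfo net j ((S.filter (· < j)) ∪ ((ω.D k ∪ ω.B k) \ S)) k (ω.A j)

/-- The compression (covering) inequalities at node `k`. -/
def CompressionCondition (ω : CodingParameters N X Y μ μ) (net : ADMN N X Y) (k : Fin N) : Prop :=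
  ∀ T ⊆ ω.W k, T.Nonempty →
    (∀ j ∈ T, ω.A j ∩ ω.W k ⊆ T) →
    ∑ j ∈ T, ω.mutualInfo net j ((T.filter (· < j)) ∪ ω.D k) k (ω.A j) < ∑ j ∈ T, ω.r j

end CodingParameters

/-! The argument is random coding, done in one shot and then applied to blocks. Codewords are drawn
by superposition: an entry of codebook `j` depends on the indices of `{j} ∪ A j` and is drawn from
the conditional law of `u_j` given `u_{A_j}`. Node `k` searches for an index tuple whose codewords
pass a likelihood-ratio threshold for every set `T` of codebooks that could be wrong, keeps the part
in `D k`, and then draws the indices of `W k` with probability proportional to the compression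
kernel divided by the codeword law, truncated to `Good` codewords.

The core is a change of measure (`success_le`). Fix the tuple `l` of selected indices. In the ideal
experiment the codewords at `l` and the channel outputs follow the target joint pmf, and all other
codewords are superposed at random without regard to the outputs. If no decoder errs and all weights
are untruncated, the true probability is the ideal one times a uniform factor times `∏ k, Z_k⁻¹`,
where `Z_k` is the average weight seen by encoder `k`. Since `∏ k, Z_k⁻¹ ≥ 1 + ∑ k, (1 - Z_k)`, only
first moments of the `Z_k` are needed, and no independence between nodes.

Two estimates remain. Packing (`idealExp_wrong_le`): a union bound over the sets of wrong codewords.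
Covering (`idealExp_avgWeight_le`): the mean of the truncated `Z_k` is at most a sum over the sets
`T` of shared codewords, in which `T = ∅` contributes its threshold `1` and the other terms vanish
when the compression rates are large enough. The success probability is then at least about `(1 + N)
- N = 1` (`exists_nodes`). Averaging fixes a codebook, and `exists_choice_functions` removes the
randomness of the encoders.

For blocks, the threshold exponents lie midway between rate and information, and Chebyshev's
inequality controls the log-likelihood ratios (`exists_nodes_tendsto`). A pointwise chain rule
identifies the expected ratios with the sums of mutual informations (`sum_mutualInfo_eq`); for
compression an inequality from Gibbs suffices. Typicality with a parameter tending slowly to zero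
makes one sequence of codes serve every `ε`. -/

set_option linter.unusedSectionVars false

/-! ### Summation over cylinder sets and Bayesian networks -/

section Fiber

variable {ι : Type*} [Fintype ι] [DecidableEq ι] {α : ι → Type*} [∀ i, Fintype (α i)]

/-- The tuples that agree with `s` outside `E`. -/
def fiber (E : Finset ι) (s : ∀ i, α i) : Finset (∀ i, α i) :=
  Fintype.piFinset fun i => if i ∈ E then Finset.univ else {s i}

theorem mem_fiber {E : Finset ι} {s t : ∀ i, α i} : t ∈ fiber E s ↔ ∀ i, i ∉ E → t i = s i := by
  simp only [fiber, Fintype.mem_piFinset]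
  refine forall_congr' fun i => ?_
  by_cases h : i ∈ E <;> simp [h]

theorem card_fiber (E : Finset ι) (s : ∀ i, α i) :
    (fiber E s).card = ∏ i ∈ E, Fintype.card (α i) := by
  rw [fiber, Fintype.card_piFinset, ← Finset.prod_subset (Finset.subset_univ E)]
  · exact Finset.prod_congr rfl fun i hi => by simp [hi]
  · intro i _ hi
    simp [hi]

theorem fiber_empty (s : ∀ i, α i) : fiber ∅ s = {s} := by
  ext t
  simp [mem_fiber, funext_iff]

theorem sum_fiber_insert (E : Finset ι) {v : ι} (hv : v ∉ E) (s : ∀ i, α i)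
    (F : (∀ i, α i) → ℝ) :
    ∑ t ∈ fiber (insert v E) s, F t = ∑ t ∈ fiber E s, ∑ a, F (Function.update t v a) := by
  rw [Finset.sum_sigma']
  refine Finset.sum_bij' (fun t _ => ⟨Function.update t v (s v), t v⟩)
    (fun p _ => Function.update p.1 v p.2) ?_ ?_ ?_ ?_ ?_
  · intro t ht
    simp only [Finset.mem_sigma, Finset.mem_univ, and_true, mem_fiber] at ht ⊢
    intro i hi
    by_cases h : i = v
    · subst h; simp
    · simp only [Function.update_of_ne h]
      exact ht i (by simp [h, hi])
  · rintro ⟨t, a⟩ ht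
    simp only [Finset.mem_sigma, Finset.mem_univ, and_true, mem_fiber] at ht ⊢
    intro i hi
    simp only [Finset.mem_insert, not_or] at hi
    rw [Function.update_of_ne hi.1]
    exact ht i hi.2
  · intro t _
    simp
  · rintro ⟨t, a⟩ ht
    simp only [Finset.mem_sigma, Finset.mem_univ, and_true, mem_fiber] at ht
    simp [← ht v hv]
  · intro t _
    simp

theorem sum_fiber_congr (E R : Finset ι) {s t : ∀ i, α i} (hst : ∀ i ∈ R, i ∉ E → s i = t i)
    (F : (∀ i, α i) → ℝ) (hF : ∀ s t, (∀ i ∈ R, s i = t i) → F s = F t) :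
    ∑ s' ∈ fiber E s, F s' = ∑ t' ∈ fiber E t, F t' := by
  refine Finset.sum_bij' (fun s' _ => E.piecewise s' t) (fun t' _ => E.piecewise t' s)
    ?_ ?_ ?_ ?_ ?_
  · intro s' _
    exact mem_fiber.mpr fun i hi => by simp [hi]
  · intro s' _
    exact mem_fiber.mpr fun i hi => by simp [hi]
  · intro s' hs'
    funext i
    by_cases hi : i ∈ E
    · simp [hi]
    · simp [hi, mem_fiber.mp hs' i hi]
  · intro s' hs'
    funext i
    by_cases hi : i ∈ E
    · simp [hi]
    · simp [hi, mem_fiber.mp hs' i hi]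
  · intro s' hs'
    refine hF _ _ fun i hi => ?_
    by_cases hiE : i ∈ E
    · simp [hiE]
    · simp [hiE, mem_fiber.mp hs' i hiE, hst i hi hiE]

/-- Marginalization of a Bayesian network to a set `S` of nodes that contains its parents. -/
theorem sum_fiber_prod_eq {β : Type*} [LinearOrder β] (rank : ι → β) (pa : ι → Finset ι)
    (f : ι → (∀ i, α i) → ℝ) (hpa : ∀ v, ∀ w ∈ pa v, rank w < rank v)
    (hf : ∀ v s t, (∀ w ∈ insert v (pa v), s w = t w) → f v s = f v t)
    (hsum : ∀ v s, ∑ a, f v (Function.update s v a) = 1)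
    (S : Finset ι) (hS : ∀ v ∈ S, pa v ⊆ S) (s : ∀ i, α i) :
    ∑ t ∈ fiber Sᶜ s, ∏ v, f v t = ∏ v ∈ S, f v s := by
  -- The summed-out coordinates are eliminated one at a time, by induction on their number.
  suffices H : ∀ (m : ℕ) (E : Finset ι), E.card = m → Disjoint E S →
      ∑ t ∈ fiber E s, ∏ v ∈ E ∪ S, f v t = ∏ v ∈ S, f v s by
    have := H _ Sᶜ rfl disjoint_compl_left
    rwa [Finset.union_comm, Finset.union_compl] at this
  intro m
  induction m with
  | zero =>
    intro E hE _
    rw [Finset.card_eq_zero] at hE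
    subst hE
    simp [fiber_empty]
  | succ m ih =>
    intro E hE hd
    -- A coordinate of maximal rank in `E` is a parent of no remaining node: the rest of `E` has no
    -- larger rank, and `S` contains its own parents. Hence only the factor of `v` depends on it,
    -- and that factor sums to one.
    obtain ⟨v, hvE, hmax⟩ := E.exists_max_image rank (Finset.card_pos.mp (by omega))
    rw [← ih (E.erase v) (by rw [Finset.card_erase_of_mem hvE]; omega)
      (hd.mono_left (Finset.erase_subset _ _))]
    have hvS : v ∉ S := Finset.disjoint_left.mp hd hvE
    conv_lhs => rw [← Finset.insert_erase hvE]
    rw [sum_fiber_insert _ (Finset.notMem_erase v E)]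
    refine Finset.sum_congr rfl fun t _ => ?_
    rw [Finset.insert_union]
    have hnot : v ∉ E.erase v ∪ S := by simp [hvS]
    have key : ∀ a, ∏ w ∈ insert v (E.erase v ∪ S), f w (Function.update t v a) =
        f v (Function.update t v a) * ∏ w ∈ E.erase v ∪ S, f w t := by
      intro a
      rw [Finset.prod_insert hnot]
      congr 1
      refine Finset.prod_congr rfl fun w hw => hf w _ _ fun x hx => ?_
      refine Function.update_of_ne ?_ _ _
      rintro rfl
      rcases Finset.mem_insert.mp hx with h | h
      · exact hnot (h ▸ hw)
      · rcases Finset.mem_union.mp hw with hw' | hw'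
        · exact absurd (hpa w x h) (not_lt.mpr (hmax w (Finset.mem_of_mem_erase hw')))
        · exact hvS (hS w hw' h)
    simp only [key]
    rw [← Finset.sum_mul, hsum, one_mul]

theorem sum_prod_eq_one {β : Type*} [LinearOrder β] (rank : ι → β) (pa : ι → Finset ι)
    (f : ι → (∀ i, α i) → ℝ) (hpa : ∀ v, ∀ w ∈ pa v, rank w < rank v)
    (hf : ∀ v s t, (∀ w ∈ insert v (pa v), s w = t w) → f v s = f v t)
    (hsum : ∀ v s, ∑ a, f v (Function.update s v a) = 1) (s : ∀ i, α i) :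
    ∑ t, ∏ v, f v t = 1 := by
  have := sum_fiber_prod_eq rank pa f hpa hf hsum ∅ (by simp) s
  rw [Finset.prod_empty] at this
  rw [← this]
  refine Finset.sum_congr ?_ fun _ _ => rfl
  ext t
  simp [mem_fiber]

theorem sum_fiber_fiber {E E' : Finset ι} (h : Disjoint E E') (s : ∀ i, α i)
    (F : (∀ i, α i) → ℝ) :
    ∑ t ∈ fiber E s, ∑ t' ∈ fiber E' t, F t' = ∑ t' ∈ fiber (E ∪ E') s, F t' := by
  rw [Finset.sum_sigma']
  refine Finset.sum_bij' (fun p _ => p.2) (fun t' _ => ⟨E.piecewise t' s, t'⟩) ?_ ?_ ?_ ?_ ?_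
  · rintro ⟨t, t'⟩ hp
    obtain ⟨ht, ht'⟩ := Finset.mem_sigma.mp hp
    refine mem_fiber.mpr fun i hi => ?_
    rw [Finset.mem_union, not_or] at hi
    exact (mem_fiber.mp ht' i hi.2).trans (mem_fiber.mp ht i hi.1)
  · intro t' ht'
    refine Finset.mem_sigma.mpr ⟨mem_fiber.mpr fun i hi => by simp [hi],
      mem_fiber.mpr fun i hi => ?_⟩
    by_cases hiE : i ∈ E
    · simp [hiE]
    · simpa [hiE] using mem_fiber.mp ht' i (by simp [hi, hiE])
  · rintro ⟨t, t'⟩ hp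
    obtain ⟨ht, ht'⟩ := Finset.mem_sigma.mp hp
    have : E.piecewise t' s = t := by
      funext i
      by_cases hiE : i ∈ E
      · simpa [hiE] using mem_fiber.mp ht' i (Finset.disjoint_left.mp h hiE)
      · simpa [hiE] using (mem_fiber.mp ht i hiE).symm
    simp [this]
  · intros
    rfl
  · intros
    rfl

end Fiber

/-! ### Indicators, averaging and derandomization -/

/-- The indicator of a proposition. -/
noncomputable def ind (P : Prop) : ℝ := open Classical in if P then 1 else 0

theorem ind_of {P : Prop} (h : P) : ind P = 1 := if_pos h

theorem ind_of_not {P : Prop} (h : ¬P) : ind P = 0 := if_neg h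

theorem ind_nonneg (P : Prop) : 0 ≤ ind P := by
  by_cases h : P
  · rw [ind_of h]; exact zero_le_one
  · rw [ind_of_not h]

theorem ind_le_one (P : Prop) : ind P ≤ 1 := by
  by_cases h : P
  · rw [ind_of h]
  · rw [ind_of_not h]; exact zero_le_one

theorem ind_mono {P Q : Prop} (h : P → Q) : ind P ≤ ind Q := by
  by_cases hP : P
  · rw [ind_of hP, ind_of (h hP)]
  · rw [ind_of_not hP]; exact ind_nonneg Q

theorem ind_exists_le_sum {β : Type*} (s : Finset β) (P : β → Prop) :
    ind (∃ b ∈ s, P b) ≤ ∑ b ∈ s, ind (P b) := by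
  by_cases h : ∃ b ∈ s, P b
  · obtain ⟨b, hb, hP⟩ := h
    rw [ind_of ⟨b, hb, hP⟩, ← ind_of hP]
    exact Finset.single_le_sum (f := fun b => ind (P b)) (fun _ _ => ind_nonneg _) hb
  · rw [ind_of_not h]
    exact Finset.sum_nonneg fun _ _ => ind_nonneg _

/-- An average of a function with respect to a pmf is attained or exceeded. -/
theorem IsPmf.exists_sum_mul_le {α : Type*} [Fintype α] {p : α → ℝ} (hp : IsPmf p) (F : α → ℝ) :
    ∃ a, ∑ b, p b * F b ≤ F a := by
  by_contra! h
  obtain ⟨a0, _, ha0⟩ : ∃ a ∈ Finset.univ, p a ≠ 0 :=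
    Finset.exists_ne_zero_of_sum_ne_zero (by rw [hp.2]; exact one_ne_zero)
  have : ∑ a, p a * F a < ∑ a, p a * ∑ b, p b * F b := by
    refine Finset.sum_lt_sum (fun a _ => mul_le_mul_of_nonneg_left (h a).le (hp.1 a))
      ⟨a0, Finset.mem_univ _, mul_lt_mul_of_pos_left (h a0) (lt_of_le_of_ne (hp.1 a0) ha0.symm)⟩
  rw [← Finset.sum_mul, hp.2, one_mul] at this
  exact lt_irrefl _ this

/-- Independent random choices made by the nodes as functions of their observations can be
replaced by deterministic choice functions. -/
theorem exists_choice_functions {κ : Type*} [Fintype κ] [LinearOrder κ] {Y : κ → Type*}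
    {E : Type*} [∀ k, Fintype (Y k)] [Fintype E]
    (e : ∀ k, Y k → E → ℝ) (he : ∀ k b, IsPmf (e k b)) (H : (∀ k, Y k) → (κ → E) → ℝ) :
    ∃ g : ∀ k, Y k → E, ∑ y, ∑ ε : κ → E, (∏ k, e k (y k) (ε k)) * H y ε ≤
      ∑ y, H y (fun k => g k (y k)) := by
  classical
  -- All choices are drawn in advance: a random table with an independent entry for each node and
  -- each possible observation.
  let p : ((v : Σ k, Y k) → E) → ℝ := fun g => ∏ v, e v.1 v.2 (g v)
  have hbn := fun S (s : (v : Σ k, Y k) → E) =>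
    sum_fiber_prod_eq (ι := Σ k, Y k) (α := fun _ => E) (fun _ => (0 : ℕ)) (fun _ => ∅)
      (fun v g => e v.1 v.2 (g v)) (by simp)
      (by intro v s t h; rw [h v (by simp)]) (by intro v s; simpa using (he v.1 v.2).2) S
      (by simp) s
  have hp : IsPmf p := by
    refine ⟨fun g => Finset.prod_nonneg fun v _ => (he _ _).1 _, ?_⟩
    by_cases hE : Nonempty ((v : Σ k, Y k) → E)
    · exact sum_prod_eq_one (ι := Σ k, Y k) (α := fun _ => E) (fun _ => (0 : ℕ)) (fun _ => ∅)
        (fun v g => e v.1 v.2 (g v)) (by simp)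
        (by intro v s t h; rw [h v (by simp)]) (by intro v s; simpa using (he v.1 v.2).2)
        hE.some
    · exfalso
      refine hE ⟨fun v => ?_⟩
      have : ∃ a ∈ (Finset.univ : Finset E), e v.1 v.2 a ≠ 0 :=
        Finset.exists_ne_zero_of_sum_ne_zero (ne_of_eq_of_ne (he v.1 v.2).2 one_ne_zero)
      exact this.choose
  obtain ⟨g, hg⟩ := hp.exists_sum_mul_le fun g => ∑ y, H y (fun k => g ⟨k, y k⟩)
  refine ⟨fun k b => g ⟨k, b⟩, le_of_eq_of_le ?_ hg⟩
  simp only [Finset.mul_sum]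
  conv_rhs => rw [Finset.sum_comm]
  refine Finset.sum_congr rfl fun y _ => ?_
  have h1 : ∀ g : (v : Σ k, Y k) → E, p g * H y (fun k => g ⟨k, y k⟩) =
      ∑ ε : κ → E, if (fun k => g ⟨k, y k⟩) = ε then p g * H y ε else 0 := by
    intro g; simp
  simp only [h1]
  rw [Finset.sum_comm]
  refine Finset.sum_congr rfl fun ε _ => ?_
  rw [← Finset.sum_filter, ← Finset.sum_mul]
  congr 1
  -- For a fixed `y` only the entries `(k, y k)` are read. They are distinct for distinct nodes, so
  -- their joint law is the product of the kernels.
  let S : Finset (Σ k, Y k) := Finset.univ.image fun k => ⟨k, y k⟩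
  have h2 := hbn S (fun v => ε v.1)
  rw [Finset.prod_image (by intro a _ b _ h; exact (Sigma.mk.inj_iff.mp h).1)] at h2
  simp only at h2
  rw [← h2]
  refine Finset.sum_congr ?_ fun _ _ => rfl
  ext g
  simp only [mem_fiber, Finset.mem_filter, Finset.mem_univ, true_and, Finset.mem_compl, not_not, S,
    Finset.mem_image, funext_iff]
  constructor
  · intro h k
    exact h _ ⟨k, rfl⟩
  · rintro h _ ⟨k, rfl⟩
    exact h k

/-! ### Product distributions -/

section Product

variable {Ω : Type*} [Fintype Ω] {p : Ω → ℝ}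

theorem sum_prod_pow (n : ℕ) (hp : IsPmf p) : ∑ z : Fin n → Ω, ∏ t, p (z t) = 1 := by
  classical
  rw [← Fintype.prod_sum, Finset.prod_eq_one fun _ _ => hp.2]

-- Expanding the square, the terms with `s ≠ t` factorize and vanish because `g` is centered; the
-- `n` diagonal terms give the variance.
open scoped Classical in
theorem sum_prod_mul_sq (n : ℕ) (hp : IsPmf p) (g : Ω → ℝ) (hg : ∑ a, p a * g a = 0) :
    ∑ z : Fin n → Ω, (∏ t, p (z t)) * (∑ t, g (z t)) ^ 2 = n * ∑ a, p a * g a ^ 2 := by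
  have h1 : ∀ s t : Fin n, ∑ z : Fin n → Ω, (∏ i, p (z i)) * (g (z s) * g (z t)) =
      if s = t then ∑ a, p a * g a ^ 2 else 0 := by
    intro s t
    have h2 : ∀ z : Fin n → Ω, (∏ i, p (z i)) * (g (z s) * g (z t)) =
        ∏ i, (p (z i) * ((if i = s then g (z i) else 1) * (if i = t then g (z i) else 1))) := by
      intro z
      simp only [Finset.prod_mul_distrib, Finset.prod_ite_eq', Finset.mem_univ, if_true]
    simp only [h2]
    rw [← Fintype.prod_sum
      (fun i a => p a * ((if i = s then g a else 1) * (if i = t then g a else 1)))]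
    split_ifs with h
    · subst h
      rw [Finset.prod_eq_single s]
      · simp [sq]
      · intro i _ hi
        simp [hi, hp.2]
      · simp
    · refine Finset.prod_eq_zero (Finset.mem_univ s) ?_
      simp [h, hg]
  have h3 : ∀ z : Fin n → Ω, (∏ t, p (z t)) * (∑ t, g (z t)) ^ 2 =
      ∑ s, ∑ t, (∏ i, p (z i)) * (g (z s) * g (z t)) := by
    intro z
    rw [sq, Finset.sum_mul_sum, Finset.mul_sum]
    exact Finset.sum_congr rfl fun s _ => Finset.mul_sum _ _ _
  rw [Finset.sum_congr rfl fun z _ => h3 z, Finset.sum_comm]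
  have h4 : ∀ s : Fin n, ∑ z : Fin n → Ω, ∑ t, (∏ i, p (z i)) * (g (z s) * g (z t)) =
      ∑ a, p a * g a ^ 2 := by
    intro s
    rw [Finset.sum_comm, Finset.sum_congr rfl fun t _ => h1 s t]
    simp
  rw [Finset.sum_congr rfl fun s _ => h4 s]
  simp

open scoped Classical in
/-- Chebyshev's inequality for sums of independent identically distributed variables. -/
theorem sum_prod_ite_le (n : ℕ) (hn : 0 < n) (hp : IsPmf p) (g : Ω → ℝ) {η : ℝ} (hη : 0 < η) :
    (∑ z : Fin n → Ω, if η * n ≤ |∑ t, (g (z t) - ∑ a, p a * g a)| then ∏ t, p (z t) else 0) ≤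
      (∑ a, p a * (g a - ∑ a, p a * g a) ^ 2) / (n * η ^ 2) := by
  set m := ∑ a, p a * g a with hm
  have h0 : ∑ a, p a * (g a - m) = 0 := by
    simp only [mul_sub, Finset.sum_sub_distrib, ← Finset.sum_mul, hp.2, hm]; ring
  have hn' : (0 : ℝ) < n := Nat.cast_pos.mpr hn
  rw [le_div_iff₀ (by positivity)]
  have h1 := sum_prod_mul_sq n hp (fun a => g a - m) h0
  have h2 : (∑ z : Fin n → Ω, if η * n ≤ |∑ t, (g (z t) - m)| then ∏ t, p (z t) else 0) *
      (η * n) ^ 2 ≤ ∑ z : Fin n → Ω, (∏ t, p (z t)) * (∑ t, (g (z t) - m)) ^ 2 := by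
    rw [Finset.sum_mul]
    refine Finset.sum_le_sum fun z _ => ?_
    have hz : 0 ≤ ∏ t, p (z t) := Finset.prod_nonneg fun t _ => hp.1 _
    split_ifs with h
    · refine mul_le_mul_of_nonneg_left ?_ hz
      rw [← sq_abs (∑ t, (g (z t) - m))]
      exact pow_le_pow_left₀ (by positivity) h 2
    · rw [zero_mul]; positivity
  rw [h1] at h2
  have h3 : (n : ℝ) * ((∑ z : Fin n → Ω,
      if η * n ≤ |∑ t, (g (z t) - m)| then ∏ t, p (z t) else 0) * (n * η ^ 2)) ≤
      n * ∑ a, p a * (g a - m) ^ 2 := by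
    refine le_of_eq_of_le ?_ h2
    ring
  exact le_of_mul_le_mul_left h3 hn'

end Product

/-- A sum over a cylinder set of tuples of sequences of a product over time factorizes. -/
theorem sum_fiber_prod_time {ι : Type*} [Fintype ι] [DecidableEq ι] {α : ι → Type*}
    [∀ i, Fintype (α i)] {n : ℕ} (E : Finset ι) (s : ∀ i, Fin n → α i)
    (F : Fin n → (∀ i, α i) → ℝ) :
    ∑ t ∈ fiber E s, ∏ τ, F τ (fun i => t i τ) =
      ∏ τ, ∑ v ∈ fiber E (fun i => s i τ), F τ v := by
  rw [Finset.prod_univ_sum]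
  refine Finset.sum_bij' (fun t _ => fun τ i => t i τ) (fun t _ => fun i τ => t τ i) ?_ ?_ ?_ ?_ ?_
  · intro t ht
    simp only [Fintype.mem_piFinset, mem_fiber] at ht ⊢
    intro τ i hi
    rw [ht i hi]
  · intro t ht
    simp only [Fintype.mem_piFinset, mem_fiber] at ht ⊢
    intro i hi
    funext τ
    exact ht τ i hi
  · intros; rfl
  · intros; rfl
  · intros; rfl

/-! ### Random superposition codebooks -/

/-- Data of a one-shot coding scheme on a network: codebooks indexed by `J`, with the superposition
structure `A`, the sets `D k ⊆ V k` of codebooks that node `k` decodes uniquely, respectively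
decodes at all, the sets `W k` that it uses for compression, the codeword pmfs `q`, the compression
kernels `c`, the symbol maps `map` and the channel `chan`. -/
structure Scheme (N : ℕ) (X Y : Fin N → Type*) (J : Type*) [LinearOrder J]
    (U : J → Type*) [∀ k, Fintype (Y k)] [∀ j, Fintype (U j)] where
  A : J → Finset J
  A_lt : ∀ j, ∀ i ∈ A j, i < j
  A_trans : ∀ j, ∀ i ∈ A j, A i ⊆ A j
  D : Fin N → Finset J
  V : Fin N → Finset J
  W : Fin N → Finset J
  D_subset : ∀ k, D k ⊆ V k
  A_V : ∀ k, ∀ j ∈ V k, A j ⊆ V k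
  A_D : ∀ k, ∀ j ∈ D k, A j ⊆ D k
  A_W : ∀ k, ∀ j ∈ W k, A j ⊆ D k ∪ W k
  D_W : ∀ k, Disjoint (D k) (W k)
  W_existsUnique : ∀ j, ∃! k, j ∈ W k
  q : J → (∀ i, U i) → ℝ
  q_nonneg : ∀ j u, 0 ≤ q j u
  q_congr : ∀ j u v, (∀ i ∈ insert j (A j), u i = v i) → q j u = q j v
  q_sum : ∀ j u, ∑ a, q j (Function.update u j a) = 1
  c : ∀ k, (∀ i, U i) → Y k → ℝ
  c_nonneg : ∀ k u b, 0 ≤ c k u b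
  c_congr : ∀ k u v b, (∀ i ∈ D k ∪ W k, u i = v i) → c k u b = c k v b
  map : ∀ k, (∀ i, U i) → Y k → X k
  map_congr : ∀ k u v b, (∀ i ∈ D k ∪ W k, u i = v i) → map k u b = map k v b
  chan : Fin N → (∀ i, X i) → (∀ i, Y i) → ℝ
  chan_nonneg : ∀ k x y, 0 ≤ chan k x y
  chan_congr : ∀ k x x' y y', (∀ i < k, x i = x' i) → (∀ i ≤ k, y i = y' i) →
    chan k x y = chan k x' y'
  chan_sum : ∀ k x y, ∑ b, chan k x (Function.update y k b) = 1

namespace Scheme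

variable {N : ℕ} {X Y : Fin N → Type*} {J : Type*} [LinearOrder J]
  {U : J → Type*} [∀ k, Fintype (Y k)] [∀ j, Fintype (U j)] (S : Scheme N X Y J U)
  {I : J → Type*} (l₀ : ∀ j, I j)

/-- The indices on which the codeword `j` depends. -/
def mask (j : J) (l : ∀ j, I j) : ∀ j, I j := (insert j (S.A j)).piecewise l l₀

theorem mask_eq_iff {j : J} {l l' : ∀ j, I j} :
    S.mask l₀ j l = S.mask l₀ j l' ↔ ∀ i ∈ insert j (S.A j), l i = l' i := by
  constructor
  · intro h i hi
    have := congrFun h i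
    simpa only [mask, Finset.piecewise_eq_of_mem _ _ _ hi] using this
  · intro h
    funext i
    by_cases hi : i ∈ insert j (S.A j)
    · simpa only [mask, Finset.piecewise_eq_of_mem _ _ _ hi] using h i hi
    · simp only [mask, Finset.piecewise_eq_of_notMem _ _ _ hi]

/-- Transitivity of the superposition: the indices relevant to a parent `i` of `j` are among those
relevant to `j`. Hence the parents of an entry seen by the tuple `l` are again entries seen by `l`.
-/
theorem mask_mask {i j : J} (h : i ∈ insert j (S.A j)) (l : ∀ j, I j) :
    S.mask l₀ i (S.mask l₀ j l) = S.mask l₀ i l := by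
  rw [mask_eq_iff]
  intro m hm
  refine Finset.piecewise_eq_of_mem _ _ _ ?_
  rcases Finset.mem_insert.mp h with rfl | h
  · exact hm
  · rcases Finset.mem_insert.mp hm with rfl | hm
    · exact Finset.mem_insert_of_mem h
    · exact Finset.mem_insert_of_mem (S.A_trans j i h hm)

/-- The codewords with the index tuple `l` in the codebook `C`. -/
def word (C : ∀ v : J × (∀ j, I j), U v.1) (l : ∀ j, I j) : ∀ j, U j :=
  fun j => C (j, S.mask l₀ j l)

theorem word_congr (C : ∀ v : J × (∀ j, I j), U v.1) {l l' : ∀ j, I j} {j : J}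
    (h : ∀ i ∈ insert j (S.A j), l i = l' i) : S.word l₀ C l j = S.word l₀ C l' j := by
  rw [word, word, (S.mask_eq_iff l₀).mpr h]

/-- The conditional pmf of an entry of the random codebook. -/
def codeFactor (v : J × (∀ j, I j)) (C : ∀ v : J × (∀ j, I j), U v.1) : ℝ :=
  S.q v.1 (Function.update (fun i => C (i, S.mask l₀ i v.2)) v.1 (C v))

variable [Fintype J] [∀ j, DecidableEq (I j)]

/-- The entries of the codebook on which an entry is superposed. -/
def codeParents (v : J × (∀ j, I j)) : Finset (J × (∀ j, I j)) :=
  (S.A v.1).image fun i => (i, S.mask l₀ i v.2)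

/-- The codebook array also has entries `(j, l)` with an unmasked tuple `l`. The update in
`codeFactor` gives such an entry its own conditional law; parents are always masked, so no other
entry depends on it. -/
theorem codeFactor_congr (v : J × (∀ j, I j)) (C C' : ∀ v : J × (∀ j, I j), U v.1)
    (h : ∀ w ∈ insert v (S.codeParents l₀ v), C w = C' w) :
    S.codeFactor l₀ v C = S.codeFactor l₀ v C' := by
  refine S.q_congr _ _ _ fun i hi => ?_
  by_cases hij : i = v.1
  · subst hij
    simpa using h v (Finset.mem_insert_self _ _)
  · rw [Function.update_of_ne hij, Function.update_of_ne hij]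
    exact h (i, _) (Finset.mem_insert_of_mem
      (Finset.mem_image_of_mem _ (Finset.mem_of_mem_insert_of_ne hi hij)))

theorem sum_codeFactor (v : J × (∀ j, I j)) (C : ∀ v : J × (∀ j, I j), U v.1) :
    ∑ a, S.codeFactor l₀ v (Function.update C v a) = 1 := by
  rw [← S.q_sum v.1 (fun i => C (i, S.mask l₀ i v.2))]
  refine Finset.sum_congr rfl fun a _ => S.q_congr _ _ _ fun i hi => ?_
  by_cases hij : i = v.1
  · subst hij
    simp
  · rw [Function.update_of_ne hij, Function.update_of_ne hij, Function.update_of_ne]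
    exact fun h => hij (congrArg Prod.fst h)

theorem codeParents_lt (v w : J × (∀ j, I j)) (hw : w ∈ S.codeParents l₀ v) : w.1 < v.1 := by
  obtain ⟨i, hi, rfl⟩ := Finset.mem_image.mp hw
  exact S.A_lt _ _ hi

variable [∀ j, Fintype (I j)]

/-- The pmf of the random codebook. -/
def codeProb (C : ∀ v : J × (∀ j, I j), U v.1) : ℝ := ∏ v, S.codeFactor l₀ v C

theorem isPmf_codeProb [Nonempty (∀ j, U j)] :
    IsPmf (S.codeProb l₀ : (∀ v : J × (∀ j, I j), U v.1) → ℝ) := by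
  refine ⟨fun C => Finset.prod_nonneg fun v _ => S.q_nonneg _ _, ?_⟩
  exact sum_prod_eq_one Prod.fst (S.codeParents l₀) (S.codeFactor l₀) (S.codeParents_lt l₀)
    (S.codeFactor_congr l₀) (S.sum_codeFactor l₀) fun v => (Classical.arbitrary (∀ j, U j)) v.1

open scoped Classical in
/-- The joint law of the codewords of two index tuples `l`, `l'` with fresh codewords in `E`. -/
theorem sum_codeProb_ite (l l' : ∀ j, I j) (E : Finset J)
    (h1 : ∀ j ∈ E, S.mask l₀ j l' ≠ S.mask l₀ j l)
    (h2 : ∀ j ∈ E, ∀ i ∈ S.A j, i ∉ E → S.mask l₀ i l' = S.mask l₀ i l)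
    (u u' : ∀ j, U j) (hu : u' ∈ fiber E u) :
    (∑ C, if S.word l₀ C l = u ∧ ∀ j ∈ E, S.word l₀ C l' j = u' j then S.codeProb l₀ C else 0) =
      (∏ j, S.q j u) * ∏ j ∈ E, S.q j u' := by
  rw [mem_fiber] at hu
  -- `T₁` holds the entries seen by `l`, and `T₂` the fresh entries seen by `l'`. By `h1` they are
  -- disjoint; by `h2` their union contains all its parents, so the law of these entries is the
  -- product of their factors.
  let T₁ : Finset (J × (∀ j, I j)) := Finset.univ.image fun j => (j, S.mask l₀ j l)
  let T₂ : Finset (J × (∀ j, I j)) := E.image fun j => (j, S.mask l₀ j l')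
  -- A codebook realizing `u` on `T₁` and `u'` on `T₂`; its values elsewhere do not matter.
  let C₀ : ∀ v : J × (∀ j, I j), U v.1 := fun v =>
    if v.2 = S.mask l₀ v.1 l then u v.1 else u' v.1
  have hC1 : ∀ j, C₀ (j, S.mask l₀ j l) = u j := fun j => by simp [C₀]
  have hC2 : ∀ j ∈ E, C₀ (j, S.mask l₀ j l') = u' j := fun j hj => by simp [C₀, h1 j hj]
  have hclosed : ∀ v ∈ T₁ ∪ T₂, S.codeParents l₀ v ⊆ T₁ ∪ T₂ := by
    intro v hv w hw
    obtain ⟨i, hi, rfl⟩ := Finset.mem_image.mp hw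
    rcases Finset.mem_union.mp hv with hv | hv
    · obtain ⟨j, -, rfl⟩ := Finset.mem_image.mp hv
      refine Finset.mem_union_left _ (Finset.mem_image.mpr ⟨i, Finset.mem_univ _, ?_⟩)
      simp only
      rw [S.mask_mask l₀ (Finset.mem_insert_of_mem hi)]
    · obtain ⟨j, hj, rfl⟩ := Finset.mem_image.mp hv
      simp only
      rw [S.mask_mask l₀ (Finset.mem_insert_of_mem hi)]
      by_cases hiE : i ∈ E
      · exact Finset.mem_union_right _ (Finset.mem_image.mpr ⟨i, hiE, rfl⟩)
      · rw [h2 j hj i hi hiE]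
        exact Finset.mem_union_left _ (Finset.mem_image.mpr ⟨i, Finset.mem_univ _, rfl⟩)
  have hbn := sum_fiber_prod_eq Prod.fst (S.codeParents l₀) (S.codeFactor l₀) (S.codeParents_lt l₀)
    (S.codeFactor_congr l₀) (S.sum_codeFactor l₀) (T₁ ∪ T₂) hclosed C₀
  have hdisj : Disjoint T₁ T₂ := by
    rw [Finset.disjoint_left]
    intro v hv hv'
    obtain ⟨j, -, rfl⟩ := Finset.mem_image.mp hv
    obtain ⟨j', hj', h⟩ := Finset.mem_image.mp hv'
    rw [Prod.mk.injEq] at h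
    obtain ⟨rfl, h⟩ := h
    exact h1 _ hj' h
  rw [Finset.prod_union hdisj, Finset.prod_image (fun a _ b _ h => congrArg Prod.fst h),
    Finset.prod_image (fun a _ b _ h => congrArg Prod.fst h)] at hbn
  have hp1 : ∀ j, S.codeFactor l₀ (j, S.mask l₀ j l) C₀ = S.q j u := by
    intro j
    refine S.q_congr _ _ _ fun i (hi : i ∈ insert j (S.A j)) => ?_
    by_cases hij : i = j
    · subst hij
      simp [hC1]
    · rw [Function.update_of_ne hij]
      change C₀ (i, S.mask l₀ i (S.mask l₀ j l)) = u i
      rw [S.mask_mask l₀ hi, hC1]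
  have hp2 : ∀ j ∈ E, S.codeFactor l₀ (j, S.mask l₀ j l') C₀ = S.q j u' := by
    intro j hj
    refine S.q_congr _ _ _ fun i (hi : i ∈ insert j (S.A j)) => ?_
    by_cases hij : i = j
    · subst hij
      simp [hC2 i hj]
    · rw [Function.update_of_ne hij]
      change C₀ (i, S.mask l₀ i (S.mask l₀ j l')) = u' i
      rw [S.mask_mask l₀ hi]
      by_cases hiE : i ∈ E
      · exact hC2 i hiE
      · rw [h2 j hj i (Finset.mem_of_mem_insert_of_ne hi hij) hiE, hC1, hu i hiE]
  rw [Finset.prod_congr rfl fun j _ => hp1 j, Finset.prod_congr rfl hp2] at hbn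
  rw [← hbn, ← Finset.sum_filter]
  refine Finset.sum_congr ?_ fun _ _ => rfl
  ext C
  simp only [Finset.mem_filter, Finset.mem_univ, true_and, mem_fiber, Finset.mem_compl, not_not,
    Finset.mem_union, T₁, T₂, Finset.mem_image]
  constructor
  · rintro ⟨ha, hb⟩ v (⟨j, rfl⟩ | ⟨j, hj, rfl⟩)
    · rw [hC1, ← ha]; rfl
    · rw [hC2 j hj, ← hb j hj]; rfl
  · intro h
    refine ⟨funext fun j => ?_, fun j hj => ?_⟩
    · rw [← hC1 j, ← h _ (Or.inl ⟨j, rfl⟩)]; rfl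
    · rw [← hC2 j hj, ← h _ (Or.inr ⟨j, hj, rfl⟩)]; rfl

open scoped Classical in
theorem sum_codeProb_mul (l l' : ∀ j, I j) (E : Finset J)
    (h1 : ∀ j ∈ E, S.mask l₀ j l' ≠ S.mask l₀ j l)
    (h2 : ∀ j ∈ E, ∀ i ∈ S.A j, i ∉ E → S.mask l₀ i l' = S.mask l₀ i l)
    (H : (∀ j, U j) → (∀ j, U j) → ℝ) :
    ∑ C, S.codeProb l₀ C * H (S.word l₀ C l) (E.piecewise (S.word l₀ C l') (S.word l₀ C l)) =
      ∑ u, ∑ u' ∈ fiber E u, (∏ j, S.q j u) * (∏ j ∈ E, S.q j u') * H u u' := by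
  have h3 : ∀ C, S.codeProb l₀ C *
      H (S.word l₀ C l) (E.piecewise (S.word l₀ C l') (S.word l₀ C l)) =
      ∑ u, ∑ u' ∈ fiber E u, (if S.word l₀ C l = u ∧ ∀ j ∈ E, S.word l₀ C l' j = u' j
        then S.codeProb l₀ C else 0) * H u u' := by
    intro C
    rw [Finset.sum_eq_single (S.word l₀ C l),
      Finset.sum_eq_single (E.piecewise (S.word l₀ C l') (S.word l₀ C l)), if_pos]
    · exact ⟨rfl, fun j hj => by simp [hj]⟩
    · intro u' hu' hne
      rw [if_neg, zero_mul]
      rintro ⟨-, h⟩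
      refine hne (funext fun j => ?_)
      by_cases hj : j ∈ E
      · simp [hj, h j hj]
      · simp [hj, mem_fiber.mp hu' j hj]
    · intro h
      refine absurd (mem_fiber.mpr fun j hj => ?_) h
      simp [hj]
    · intro u _ hne
      refine Finset.sum_eq_zero fun u' _ => ?_
      rw [if_neg (fun h => hne h.1.symm), zero_mul]
    · simp
  rw [Finset.sum_congr rfl fun C _ => h3 C, Finset.sum_comm]
  refine Finset.sum_congr rfl fun u _ => ?_
  rw [Finset.sum_comm]
  refine Finset.sum_congr rfl fun u' hu' => ?_
  rw [← Finset.sum_mul, S.sum_codeProb_ite l₀ l l' E h1 h2 u u' hu']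

end Scheme

/-! ### The ideal experiment as a change of measure -/

namespace Scheme

variable {N : ℕ} {X Y : Fin N → Type*} {J : Type*} [Fintype J] [LinearOrder J]
  {U : J → Type*} [∀ k, Fintype (Y k)] [∀ j, Fintype (U j)] (S : Scheme N X Y J U)

/-- The channel inputs as functions of the codewords and the channel outputs. -/
def inputs (u : ∀ j, U j) (y : ∀ k, Y k) : ∀ k, X k := fun k => S.map k u (y k)

/-- The joint distribution of codewords and channel outputs that the scheme aims at. -/
def joint (u : ∀ j, U j) (y : ∀ k, Y k) : ℝ :=
  ∏ k, S.chan k (S.inputs u y) y * S.c k u (y k)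

theorem joint_nonneg (u : ∀ j, U j) (y : ∀ k, Y k) : 0 ≤ S.joint u y :=
  Finset.prod_nonneg fun _ _ => mul_nonneg (S.chan_nonneg _ _ _) (S.c_nonneg _ _ _)

/-- The probability of an event under the joint distribution. -/
noncomputable def prob (E : (∀ j, U j) → (∀ k, Y k) → Prop) : ℝ :=
  ∑ y, ∑ u, S.joint u y * ind (E u y)

/-- The sets of codebooks in which the indices can be decoded wrongly at node `k`. -/
def decodeFamily (k : Fin N) : Finset (Finset J) :=
  (S.V k).powerset.filter fun T => (T ∩ S.D k).Nonempty ∧ ∀ j ∈ S.V k \ T, S.A j ⊆ S.V k \ T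

/-- The sets of codewords that two index tuples can share at the encoder of node `k`. -/
def coverFamily (k : Fin N) : Finset (Finset J) :=
  (S.W k).powerset.filter fun T => ∀ j ∈ T, S.A j ∩ S.W k ⊆ T

/-- The compression kernel of node `k`, marginalized to the codewords in `T`. -/
def coverMarginal (k : Fin N) (T : Finset J) (u : ∀ j, U j) (b : Y k) : ℝ :=
  ∑ u' ∈ fiber (S.W k \ T) u, S.c k u' b

/-- The threshold test of the decoder of node `k` for the likelihood ratios `κ / q`. -/
def Passes (κ : ∀ k : Fin N, Finset J → (∀ j, U j) → Y k → ℝ) (θ : Fin N → Finset J → ℝ)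
    (k : Fin N) (u : ∀ j, U j) (b : Y k) : Prop :=
  ∀ T ∈ S.decodeFamily k, θ k T * ∏ j ∈ T, S.q j u < κ k T u b

/-- The truncation of the compression weights of node `k`. -/
def Good (lam : Fin N → Finset J → ℝ) (k : Fin N) (u : ∀ j, U j) (b : Y k) : Prop :=
  ∀ T ∈ S.coverFamily k, S.coverMarginal k T u b ≤ lam k T * ∏ j ∈ T, S.q j u

/-- The weights with which the encoder of node `k` selects indices. -/
noncomputable def weight (lam : Fin N → Finset J → ℝ) (k : Fin N) (u : ∀ j, U j) (b : Y k) : ℝ :=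
  ind (S.Good lam k u b) * (S.c k u b / ∏ j ∈ S.W k, S.q j u)

variable (lam : Fin N → Finset J → ℝ)

theorem weight_nonneg (k : Fin N) (u : ∀ j, U j) (b : Y k) : 0 ≤ S.weight lam k u b :=
  mul_nonneg (ind_nonneg _) (div_nonneg (S.c_nonneg _ _ _)
    (Finset.prod_nonneg fun _ _ => S.q_nonneg _ _))

theorem insert_subset_DW {k : Fin N} {j : J} (hj : j ∈ S.D k ∪ S.W k) :
    insert j (S.A j) ⊆ S.D k ∪ S.W k := by
  refine Finset.insert_subset hj ?_
  rcases Finset.mem_union.mp hj with h | h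
  · exact (S.A_D k j h).trans Finset.subset_union_left
  · exact S.A_W k j h

theorem coverMarginal_congr (k : Fin N) (T : Finset J) {u v : ∀ j, U j} (b : Y k)
    (h : ∀ i ∈ S.D k ∪ S.W k, u i = v i) : S.coverMarginal k T u b = S.coverMarginal k T v b :=
  sum_fiber_congr _ _ (fun i hi _ => h i hi) _ fun s t hst => S.c_congr k s t b hst

theorem prod_q_congr {k : Fin N} {T : Finset J} (hT : T ⊆ S.W k) {u v : ∀ j, U j}
    (h : ∀ i ∈ S.D k ∪ S.W k, u i = v i) : ∏ j ∈ T, S.q j u = ∏ j ∈ T, S.q j v :=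
  Finset.prod_congr rfl fun _ hj => S.q_congr _ _ _ fun i hi =>
    h i (S.insert_subset_DW (Finset.mem_union_right _ (hT hj)) hi)

theorem weight_congr (k : Fin N) {u v : ∀ j, U j} (b : Y k)
    (h : ∀ i ∈ S.D k ∪ S.W k, u i = v i) : S.weight lam k u b = S.weight lam k v b := by
  have hg : S.Good lam k u b ↔ S.Good lam k v b := by
    refine forall₂_congr fun T hT => ?_
    rw [S.coverMarginal_congr k T b h,
      S.prod_q_congr (Finset.mem_powerset.mp (Finset.mem_filter.mp hT).1) h]
  rw [weight, weight, hg, S.c_congr k u v b h, S.prod_q_congr subset_rfl h]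

/-- The likelihood ratio of the joint distribution to the random coding distribution. -/
noncomputable def ratio (u : ∀ j, U j) (y : ∀ k, Y k) : ℝ := S.joint u y / ∏ j, S.q j u

theorem ratio_nonneg (u : ∀ j, U j) (y : ∀ k, Y k) : 0 ≤ S.ratio u y :=
  div_nonneg (S.joint_nonneg u y) (Finset.prod_nonneg fun _ _ => S.q_nonneg _ _)

variable {I : J → Type*} (l₀ : ∀ j, I j) [∀ j, DecidableEq (I j)] [∀ j, Fintype (I j)]

theorem word_congr_DW (C : ∀ v : J × (∀ j, I j), U v.1) {l l' : ∀ j, I j} {k : Fin N}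
    (h : ∀ i ∈ S.D k ∪ S.W k, l i = l' i) :
    ∀ j ∈ S.D k ∪ S.W k, S.word l₀ C l j = S.word l₀ C l' j := fun _ hj =>
  S.word_congr l₀ C fun i hi => h i (S.insert_subset_DW hj hi)

/-- The expectation when the indices are `l` and the codewords and channel outputs have the joint
distribution, the other codewords being superposed independently. -/
noncomputable def idealExp (l : ∀ j, I j)
    (F : (∀ v : J × (∀ j, I j), U v.1) → (∀ k, Y k) → ℝ) : ℝ :=
  ∑ y, ∑ C, S.codeProb l₀ C * S.ratio (S.word l₀ C l) y * F C y

theorem codeProb_nonneg (C : ∀ v : J × (∀ j, I j), U v.1) : 0 ≤ S.codeProb l₀ C :=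
  Finset.prod_nonneg fun _ _ => S.q_nonneg _ _

theorem idealExp_mono (l : ∀ j, I j) {F G : (∀ v : J × (∀ j, I j), U v.1) → (∀ k, Y k) → ℝ}
    (h : ∀ C y, F C y ≤ G C y) : S.idealExp l₀ l F ≤ S.idealExp l₀ l G :=
  Finset.sum_le_sum fun _ _ => Finset.sum_le_sum fun _ _ => mul_le_mul_of_nonneg_left (h _ _)
    (mul_nonneg (S.codeProb_nonneg l₀ _) (S.ratio_nonneg _ _))

theorem idealExp_sum {β : Type*} (s : Finset β) (l : ∀ j, I j)
    (F : β → (∀ v : J × (∀ j, I j), U v.1) → (∀ k, Y k) → ℝ) :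
    S.idealExp l₀ l (fun C y => ∑ b ∈ s, F b C y) = ∑ b ∈ s, S.idealExp l₀ l (F b) := by
  simp only [idealExp, Finset.mul_sum]
  conv_rhs => rw [Finset.sum_comm]
  exact Finset.sum_congr rfl fun y _ => Finset.sum_comm

theorem idealExp_add (l : ∀ j, I j) (F G : (∀ v : J × (∀ j, I j), U v.1) → (∀ k, Y k) → ℝ) :
    S.idealExp l₀ l (fun C y => F C y + G C y) = S.idealExp l₀ l F + S.idealExp l₀ l G := by
  simp only [idealExp, mul_add, Finset.sum_add_distrib]

theorem idealExp_sub (l : ∀ j, I j) (F G : (∀ v : J × (∀ j, I j), U v.1) → (∀ k, Y k) → ℝ) :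
    S.idealExp l₀ l (fun C y => F C y - G C y) = S.idealExp l₀ l F - S.idealExp l₀ l G := by
  simp only [idealExp, mul_sub, Finset.sum_sub_distrib]

theorem idealExp_const_mul (l : ∀ j, I j) (a : ℝ)
    (F : (∀ v : J × (∀ j, I j), U v.1) → (∀ k, Y k) → ℝ) :
    S.idealExp l₀ l (fun C y => a * F C y) = a * S.idealExp l₀ l F := by
  simp only [idealExp, Finset.mul_sum]
  refine Finset.sum_congr rfl fun y _ => Finset.sum_congr rfl fun C _ => ?_
  ring

variable (hac : ∀ u y j, S.joint u y ≠ 0 → S.q j u ≠ 0)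
include hac

/-- Absolute continuity `hac` is what makes this hold where some `q j u` vanishes: the joint
probability is then zero as well. -/
theorem prod_q_mul_ratio (u : ∀ j, U j) (y : ∀ k, Y k) :
    (∏ j, S.q j u) * S.ratio u y = S.joint u y := by
  by_cases h : S.joint u y = 0
  · simp [ratio, h]
  · rw [ratio, mul_div_cancel₀]
    exact Finset.prod_ne_zero_iff.mpr fun j _ => hac u y j h

/-- The basis of both packing and covering: in the ideal experiment the codewords at `l` and the
outputs follow the joint law, while the fresh codewords `E` at `l'` are drawn from `q` given the
shared ones, ignoring the outputs. -/
theorem idealExp_pair (l l' : ∀ j, I j) (E : Finset J)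
    (h1 : ∀ j ∈ E, S.mask l₀ j l' ≠ S.mask l₀ j l)
    (h2 : ∀ j ∈ E, ∀ i ∈ S.A j, i ∉ E → S.mask l₀ i l' = S.mask l₀ i l)
    (H : (∀ j, U j) → (∀ j, U j) → (∀ k, Y k) → ℝ) :
    S.idealExp l₀ l (fun C y =>
      H (S.word l₀ C l) (E.piecewise (S.word l₀ C l') (S.word l₀ C l)) y) =
      ∑ y, ∑ u, S.joint u y * ∑ u' ∈ fiber E u, (∏ j ∈ E, S.q j u') * H u u' y := by
  refine Finset.sum_congr rfl fun y _ => ?_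
  have := S.sum_codeProb_mul l₀ l l' E h1 h2 fun u u' => S.ratio u y * H u u' y
  simp only [mul_assoc] at this ⊢
  rw [this]
  refine Finset.sum_congr rfl fun u _ => ?_
  rw [Finset.mul_sum]
  refine Finset.sum_congr rfl fun u' _ => ?_
  rw [← S.prod_q_mul_ratio hac u y]
  ring

theorem idealExp_word (l : ∀ j, I j) (H : (∀ j, U j) → (∀ k, Y k) → ℝ) :
    S.idealExp l₀ l (fun C y => H (S.word l₀ C l) y) = ∑ y, ∑ u, S.joint u y * H u y := by
  have := S.idealExp_pair l₀ hac l l ∅ (by simp) (by simp) fun u _ y => H u y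
  simpa [fiber_empty] using this

end Scheme

namespace Scheme

variable {N : ℕ} {X Y : Fin N → Type*} {J : Type*} [Fintype J] [LinearOrder J]
  {U : J → Type*} [∀ k, Fintype (Y k)] [∀ j, Fintype (U j)] (S : Scheme N X Y J U)
  {I : J → Type*} (l₀ : ∀ j, I j) [∀ j, DecidableEq (I j)] [∀ j, Fintype (I j)]

/-! ### Packing: wrong index tuples at a decoder -/

section Packing

variable (κ : ∀ k : Fin N, Finset J → (∀ j, U j) → Y k → ℝ) (θ : Fin N → Finset J → ℝ)

/-- Two index tuples `l`, `l'` that differ only in `T` and for which the codewords in `T` and no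
others differ. -/
def IsFresh (T : Finset J) (l l' : ∀ j, I j) : Prop :=
  (∀ j ∈ T, S.mask l₀ j l' ≠ S.mask l₀ j l) ∧
    ∀ j ∈ T, ∀ i ∈ S.A j, i ∉ T → S.mask l₀ i l' = S.mask l₀ i l

/-- A wrong index tuple that passes the decoding test differs from the true one in one of the sets
of the decoding family. -/
theorem exists_of_wrong_passes
    (hκ_congr : ∀ k T, T ∈ S.decodeFamily k → ∀ u v b, (∀ j ∈ S.V k, u j = v j) →
      κ k T u b = κ k T v b)
    (C : ∀ v : J × (∀ j, I j), U v.1) (l l' : ∀ j, I j) (k : Fin N) (b : Y k)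
    (hl' : S.Passes κ θ k (S.word l₀ C l') b) (hne : ∃ j ∈ S.D k, l' j ≠ l j) :
    ∃ T ∈ S.decodeFamily k, ∃ m ∈ fiber T l, S.IsFresh l₀ T l m ∧
      θ k T * ∏ j ∈ T, S.q j (T.piecewise (S.word l₀ C m) (S.word l₀ C l)) <
        κ k T (T.piecewise (S.word l₀ C m) (S.word l₀ C l)) b := by
  -- `T` consists of the codewords, not merely the indices, that differ. A codeword shared by both
  -- tuples has shared parents, so the complement in `V k` is closed under `A`.
  let T := (S.V k).filter fun j => S.mask l₀ j l' ≠ S.mask l₀ j l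
  have hTV : T ⊆ S.V k := Finset.filter_subset _ _
  have hK : ∀ j ∈ S.V k, j ∉ T → S.mask l₀ j l' = S.mask l₀ j l := by
    intro j hj hjT
    by_contra h
    exact hjT (Finset.mem_filter.mpr ⟨hj, h⟩)
  have hTfam : T ∈ S.decodeFamily k := by
    refine Finset.mem_filter.mpr ⟨Finset.mem_powerset.mpr hTV, ?_, ?_⟩
    · obtain ⟨j, hjD, hj⟩ := hne
      refine ⟨j, Finset.mem_inter.mpr ⟨Finset.mem_filter.mpr ⟨S.D_subset k hjD, ?_⟩, hjD⟩⟩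
      exact fun h => hj ((S.mask_eq_iff l₀).mp h j (Finset.mem_insert_self _ _))
    · intro j hj i hi
      obtain ⟨hjV, hjT⟩ := Finset.mem_sdiff.mp hj
      refine Finset.mem_sdiff.mpr ⟨S.A_V k j hjV hi, fun hiT => (Finset.mem_filter.mp hiT).2 ?_⟩
      have hj := hK j hjV hjT
      rw [← S.mask_mask l₀ (Finset.mem_insert_of_mem hi), hj,
        S.mask_mask l₀ (Finset.mem_insert_of_mem hi)]
  -- Resetting the indices outside `T` to those of `l` changes no codeword in `V k`. The union bound
  -- thus runs over `fiber T l` only.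
  let m := T.piecewise l' l
  have hm : ∀ j ∈ S.V k, S.mask l₀ j m = S.mask l₀ j l' := by
    intro j hj
    rw [S.mask_eq_iff]
    intro i hi
    by_cases hiT : i ∈ T
    · simp [m, hiT]
    · have hiV : i ∈ S.V k := Finset.insert_subset hj (S.A_V k j hj) hi
      have := (S.mask_eq_iff l₀).mp (hK i hiV hiT) i (Finset.mem_insert_self _ _)
      simp [m, hiT, this]
  have hw : ∀ j ∈ S.V k, S.word l₀ C l' j = T.piecewise (S.word l₀ C m) (S.word l₀ C l) j := by
    intro j hj
    by_cases hjT : j ∈ T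
    · rw [Finset.piecewise_eq_of_mem _ _ _ hjT, word, word, hm j hj]
    · rw [Finset.piecewise_eq_of_notMem _ _ _ hjT, word, word, hK j hj hjT]
  refine ⟨T, hTfam, m, mem_fiber.mpr fun i hi => by simp [m, hi], ⟨?_, ?_⟩, ?_⟩
  · intro j hj
    rw [hm j (hTV hj)]
    exact (Finset.mem_filter.mp hj).2
  · intro j hj i hi hiT
    have hiV := S.A_V k j (hTV hj) hi
    rw [hm i hiV, hK i hiV hiT]
  · rw [← hκ_congr k T hTfam _ _ b hw]
    refine lt_of_eq_of_lt ?_ (hl' T hTfam)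
    congr 1
    refine Finset.prod_congr rfl fun j hj => S.q_congr _ _ _ fun i hi => (hw i ?_).symm
    exact Finset.insert_subset (hTV hj) (S.A_V k j (hTV hj)) hi

variable (hac : ∀ u y j, S.joint u y ≠ 0 → S.q j u ≠ 0) (hone : ∑ y, ∑ u, S.joint u y = 1)
include hac hone

/-- The fresh codewords in `T` have law `∏ q`, which is at most `κ / θ` on the event that the test
is passed; summing the sub-pmf `κ` over them leaves `1 / θ`. -/
theorem idealExp_passes_le (l l' : ∀ j, I j) (k : Fin N) (T : Finset J)
    (hκ_nonneg : ∀ u b, 0 ≤ κ k T u b) (hκ_sum : ∀ u b, ∑ u' ∈ fiber T u, κ k T u' b ≤ 1)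
    (hθ : 0 < θ k T) (hl : S.IsFresh l₀ T l l') :
    S.idealExp l₀ l (fun C y =>
      ind (θ k T * ∏ j ∈ T, S.q j (T.piecewise (S.word l₀ C l') (S.word l₀ C l)) <
        κ k T (T.piecewise (S.word l₀ C l') (S.word l₀ C l)) (y k))) ≤ (θ k T)⁻¹ := by
  rw [S.idealExp_pair l₀ hac l l' T hl.1 hl.2
    (fun _ u' y => ind (θ k T * ∏ j ∈ T, S.q j u' < κ k T u' (y k)))]
  rw [← one_mul (θ k T)⁻¹, ← hone, Finset.sum_mul]
  refine Finset.sum_le_sum fun y _ => ?_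
  rw [Finset.sum_mul]
  refine Finset.sum_le_sum fun u _ => mul_le_mul_of_nonneg_left ?_ (S.joint_nonneg u y)
  calc ∑ u' ∈ fiber T u, (∏ j ∈ T, S.q j u') * ind (θ k T * ∏ j ∈ T, S.q j u' < κ k T u' (y k))
      ≤ ∑ u' ∈ fiber T u, (θ k T)⁻¹ * κ k T u' (y k) := by
        refine Finset.sum_le_sum fun u' _ => ?_
        by_cases h : θ k T * ∏ j ∈ T, S.q j u' < κ k T u' (y k)
        · rw [ind_of h, mul_one, le_inv_mul_iff₀ hθ]
          exact h.le
        · rw [ind_of_not h, mul_zero]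
          exact mul_nonneg (inv_nonneg.mpr hθ.le) (hκ_nonneg _ _)
    _ ≤ (θ k T)⁻¹ := by
        rw [← Finset.mul_sum]
        exact mul_le_of_le_one_right (inv_nonneg.mpr hθ.le) (hκ_sum _ _)

/-- The probability that some wrong index tuple passes the decoding test of node `k`. -/
theorem idealExp_wrong_le (l : ∀ j, I j) (k : Fin N)
    (hκ_nonneg : ∀ T ∈ S.decodeFamily k, ∀ u b, 0 ≤ κ k T u b)
    (hκ_congr : ∀ k T, T ∈ S.decodeFamily k → ∀ u v b, (∀ j ∈ S.V k, u j = v j) →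
      κ k T u b = κ k T v b)
    (hκ_sum : ∀ T ∈ S.decodeFamily k, ∀ u b, ∑ u' ∈ fiber T u, κ k T u' b ≤ 1)
    (hθ : ∀ T ∈ S.decodeFamily k, 0 < θ k T) :
    S.idealExp l₀ l (fun C y => ind (∃ l', S.Passes κ θ k (S.word l₀ C l') (y k) ∧
      ∃ j ∈ S.D k, l' j ≠ l j)) ≤
      ∑ T ∈ S.decodeFamily k, (∏ j ∈ T, (Fintype.card (I j) : ℝ)) * (θ k T)⁻¹ := by
  classical
  refine (S.idealExp_mono l₀ l (G := fun C y => ∑ T ∈ S.decodeFamily k,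
    ∑ m ∈ (fiber T l).filter (S.IsFresh l₀ T l),
      ind (θ k T * ∏ j ∈ T, S.q j (T.piecewise (S.word l₀ C m) (S.word l₀ C l)) <
        κ k T (T.piecewise (S.word l₀ C m) (S.word l₀ C l)) (y k))) fun C y => ?_).trans ?_
  · refine le_trans (ind_mono (Q := ∃ T ∈ S.decodeFamily k,
      ∃ m ∈ (fiber T l).filter (S.IsFresh l₀ T l),
      θ k T * ∏ j ∈ T, S.q j (T.piecewise (S.word l₀ C m) (S.word l₀ C l)) <
        κ k T (T.piecewise (S.word l₀ C m) (S.word l₀ C l)) (y k)) ?_)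
      ((ind_exists_le_sum _ _).trans (Finset.sum_le_sum fun T _ => ind_exists_le_sum _ _))
    rintro ⟨l', hp, hne⟩
    obtain ⟨T, hT, m, hm, hf, h⟩ :=
      S.exists_of_wrong_passes l₀ κ θ hκ_congr C l l' k (y k) hp hne
    exact ⟨T, hT, m, Finset.mem_filter.mpr ⟨hm, hf⟩, h⟩
  · rw [idealExp_sum]
    refine Finset.sum_le_sum fun T hT => ?_
    rw [idealExp_sum]
    refine (Finset.sum_le_card_nsmul _ _ (θ k T)⁻¹ fun m hm => S.idealExp_passes_le l₀ κ θ hac hone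
      l m k T (hκ_nonneg T hT) (hκ_sum T hT) (hθ T hT) (Finset.mem_filter.mp hm).2).trans ?_
    rw [nsmul_eq_mul]
    refine mul_le_mul_of_nonneg_right ?_ (inv_nonneg.mpr (hθ T hT).le)
    rw [← Nat.cast_prod, ← card_fiber T l]
    exact_mod_cast Finset.card_filter_le _ _

end Packing

/-! ### Covering: the mean of the encoder weights -/

section Covering

variable (lam : Fin N → Finset J → ℝ)

/-- The average weight of the indices that the encoder of node `k` can select. -/
noncomputable def avgWeight (k : Fin N) (C : ∀ v : J × (∀ j, I j), U v.1) (l : ∀ j, I j)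
    (b : Y k) : ℝ :=
  (Fintype.card (∀ j, I j) : ℝ)⁻¹ *
    ∑ l', S.weight lam k (S.word l₀ C ((S.W k).piecewise l' l)) b

variable (hac : ∀ u y j, S.joint u y ≠ 0 → S.q j u ≠ 0) (hone : ∑ y, ∑ u, S.joint u y = 1)
include hac hone

/-- The proof takes `T` to be the codewords of `W k` shared by both tuples. Averaging over the fresh
ones cancels their `q` in the denominator of the weight, leaving the marginal kernel divided by `∏ j
∈ T, q j`. Truncation at the true codewords bounds this by `lam k T`. -/
theorem idealExp_weight_le (l l' : ∀ j, I j) (k : Fin N)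
    (hlam : ∀ T ∈ S.coverFamily k, 0 ≤ lam k T) :
    ∃ T ∈ S.coverFamily k, (∀ j ∈ T, l' j = l j) ∧
      S.idealExp l₀ l (fun C y => ind (S.Good lam k (S.word l₀ C l) (y k)) *
        S.weight lam k (S.word l₀ C ((S.W k).piecewise l' l)) (y k)) ≤ lam k T := by
  let m := (S.W k).piecewise l' l
  let T := (S.W k).filter fun j => S.mask l₀ j m = S.mask l₀ j l
  let E := S.W k \ T
  have hTW : T ⊆ S.W k := Finset.filter_subset _ _
  -- The codewords in `D k` never change, because `D k` is disjoint from `W k` and contains its own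
  -- parents.
  have hmD : ∀ j ∈ S.D k, m j = l j := fun j hj =>
    Finset.piecewise_eq_of_notMem _ _ _ (Finset.disjoint_left.mp (S.D_W k) hj)
  have hmaskD : ∀ j ∈ S.D k, S.mask l₀ j m = S.mask l₀ j l := fun j hj =>
    (S.mask_eq_iff l₀).mpr fun i hi => hmD i (Finset.insert_subset hj (S.A_D k j hj) hi)
  have hT : T ∈ S.coverFamily k := by
    refine Finset.mem_filter.mpr ⟨Finset.mem_powerset.mpr hTW, fun j hj i hi => ?_⟩
    obtain ⟨hiA, hiW⟩ := Finset.mem_inter.mp hi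
    refine Finset.mem_filter.mpr ⟨hiW, ?_⟩
    rw [← S.mask_mask l₀ (Finset.mem_insert_of_mem hiA), (Finset.mem_filter.mp hj).2,
      S.mask_mask l₀ (Finset.mem_insert_of_mem hiA)]
  have h1 : ∀ j ∈ E, S.mask l₀ j m ≠ S.mask l₀ j l := fun j hj h =>
    (Finset.mem_sdiff.mp hj).2 (Finset.mem_filter.mpr ⟨(Finset.mem_sdiff.mp hj).1, h⟩)
  have hoff : ∀ i ∈ S.D k ∪ S.W k, i ∉ E → S.mask l₀ i m = S.mask l₀ i l := by
    intro i hi hiE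
    rcases Finset.mem_union.mp hi with h | h
    · exact hmaskD i h
    · have : i ∈ T := by
        by_contra hiT
        exact hiE (Finset.mem_sdiff.mpr ⟨h, hiT⟩)
      exact (Finset.mem_filter.mp this).2
  have h2 : ∀ j ∈ E, ∀ i ∈ S.A j, i ∉ E → S.mask l₀ i m = S.mask l₀ i l := fun j hj i hi =>
    hoff i (S.A_W k j (Finset.mem_sdiff.mp hj).1 hi)
  refine ⟨T, hT, fun j hj => ?_, ?_⟩
  · have := (S.mask_eq_iff l₀).mp (Finset.mem_filter.mp hj).2 j (Finset.mem_insert_self _ _)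
    rwa [show m j = l' j from Finset.piecewise_eq_of_mem _ _ _ (hTW hj)] at this
  have hw : ∀ C b, S.weight lam k (S.word l₀ C m) b =
      S.weight lam k (E.piecewise (S.word l₀ C m) (S.word l₀ C l)) b := by
    intro C b
    refine S.weight_congr lam k b fun j hj => ?_
    by_cases hjE : j ∈ E
    · simp [hjE]
    · rw [Finset.piecewise_eq_of_notMem _ _ _ hjE, word, word, hoff j hj hjE]
  change S.idealExp l₀ l (fun C y => ind (S.Good lam k (S.word l₀ C l) (y k)) *
        S.weight lam k (S.word l₀ C m) (y k)) ≤ lam k T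
  simp only [hw]
  rw [S.idealExp_pair l₀ hac l m E h1 h2
    (fun u u' y => ind (S.Good lam k u (y k)) * S.weight lam k u' (y k))]
  rw [← one_mul (lam k T), ← hone, Finset.sum_mul]
  refine Finset.sum_le_sum fun y _ => ?_
  rw [Finset.sum_mul]
  refine Finset.sum_le_sum fun u _ => ?_
  by_cases hj : S.joint u y = 0
  · simp [hj]
  refine mul_le_mul_of_nonneg_left ?_ (S.joint_nonneg u y)
  by_cases hg : S.Good lam k u (y k)
  swap
  · simp only [ind_of_not hg, zero_mul, mul_zero, Finset.sum_const_zero]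
    exact hlam T hT
  have hq : 0 < ∏ j ∈ T, S.q j u :=
    Finset.prod_pos fun j _ => lt_of_le_of_ne (S.q_nonneg j u) (hac u y j hj).symm
  calc ∑ u' ∈ fiber E u, (∏ j ∈ E, S.q j u') *
        (ind (S.Good lam k u (y k)) * S.weight lam k u' (y k))
      ≤ ∑ u' ∈ fiber E u, S.c k u' (y k) / ∏ j ∈ T, S.q j u := by
        refine Finset.sum_le_sum fun u' hu' => ?_
        have hqT : ∏ j ∈ T, S.q j u' = ∏ j ∈ T, S.q j u := by
          refine Finset.prod_congr rfl fun j hj => S.q_congr _ _ _ fun i hi => ?_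
          refine mem_fiber.mp hu' i fun hiE => ?_
          rcases Finset.mem_insert.mp hi with rfl | hi
          · exact (Finset.mem_sdiff.mp hiE).2 hj
          · exact (Finset.mem_sdiff.mp hiE).2 ((Finset.mem_filter.mp hT).2 j hj
              (Finset.mem_inter.mpr ⟨hi, (Finset.mem_sdiff.mp hiE).1⟩))
        rw [ind_of hg, one_mul, weight, ← Finset.prod_sdiff hTW, hqT]
        have hE0 : 0 ≤ ∏ j ∈ E, S.q j u' := Finset.prod_nonneg fun _ _ => S.q_nonneg _ _
        have hR0 : 0 ≤ S.c k u' (y k) / ∏ j ∈ T, S.q j u := div_nonneg (S.c_nonneg _ _ _) hq.le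
        change (∏ j ∈ E, S.q j u') * (ind (S.Good lam k u' (y k)) *
          (S.c k u' (y k) / ((∏ j ∈ E, S.q j u') * ∏ j ∈ T, S.q j u))) ≤ _
        by_cases hE : ∏ j ∈ E, S.q j u' = 0
        · rw [hE, zero_mul]
          exact hR0
        · have : (∏ j ∈ E, S.q j u') * (ind (S.Good lam k u' (y k)) *
            (S.c k u' (y k) / ((∏ j ∈ E, S.q j u') * ∏ j ∈ T, S.q j u))) =
            ind (S.Good lam k u' (y k)) * (S.c k u' (y k) / ∏ j ∈ T, S.q j u) := by
            field_simp
          rw [this]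
          exact mul_le_of_le_one_left hR0 (ind_le_one _)
    _ = S.coverMarginal k T u (y k) / ∏ j ∈ T, S.q j u := by
        rw [coverMarginal, Finset.sum_div]
    _ ≤ lam k T := by
        rw [div_le_iff₀ hq]
        exact hg T hT

/-- A uniformly chosen `l'` agrees with `l` on `T` with probability `1 / ∏ j ∈ T, |I j|`. The term
`T = ∅` is the typical one, with entirely fresh codewords. -/
theorem idealExp_avgWeight_le (l : ∀ j, I j) (k : Fin N)
    (hlam : ∀ T ∈ S.coverFamily k, 0 ≤ lam k T) :
    S.idealExp l₀ l (fun C y => ind (S.Good lam k (S.word l₀ C l) (y k)) *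
        S.avgWeight l₀ lam k C l (y k)) ≤
      ∑ T ∈ S.coverFamily k, lam k T / ∏ j ∈ T, (Fintype.card (I j) : ℝ) := by
  have hcard : ∀ T : Finset J, (0 : ℝ) < ∏ j ∈ T, (Fintype.card (I j) : ℝ) := fun T =>
    Finset.prod_pos fun j _ => Nat.cast_pos.mpr (Fintype.card_pos_iff.mpr ⟨l₀ j⟩)
  have hL : (Fintype.card (∀ j, I j) : ℝ) = ∏ j, (Fintype.card (I j) : ℝ) := by
    rw [Fintype.card_pi, Nat.cast_prod]
  choose T hT hTl hTb using fun l' => S.idealExp_weight_le l₀ lam hac hone l l' k hlam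
  simp only [avgWeight]
  have h1 : S.idealExp l₀ l (fun C y => ind (S.Good lam k (S.word l₀ C l) (y k)) *
      ((Fintype.card (∀ j, I j) : ℝ)⁻¹ *
        ∑ l', S.weight lam k (S.word l₀ C ((S.W k).piecewise l' l)) (y k))) =
      (Fintype.card (∀ j, I j) : ℝ)⁻¹ * ∑ l', S.idealExp l₀ l (fun C y =>
        ind (S.Good lam k (S.word l₀ C l) (y k)) *
          S.weight lam k (S.word l₀ C ((S.W k).piecewise l' l)) (y k)) := by
    rw [← idealExp_sum, ← idealExp_const_mul]
    congr 1
    funext C y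
    rw [← Finset.mul_sum]
    ring
  rw [h1, inv_mul_le_iff₀ (by rw [hL]; exact hcard _), Finset.mul_sum]
  calc ∑ l', S.idealExp l₀ l (fun C y => ind (S.Good lam k (S.word l₀ C l) (y k)) *
          S.weight lam k (S.word l₀ C ((S.W k).piecewise l' l)) (y k))
      ≤ ∑ l' : ∀ j, I j, ∑ T ∈ S.coverFamily k, if l' ∈ fiber Tᶜ l then lam k T else 0 := by
        refine Finset.sum_le_sum fun l' _ => (hTb l').trans ?_
        have hmem : l' ∈ fiber (T l')ᶜ l := mem_fiber.mpr fun i hi =>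
          hTl l' i (by simpa using hi)
        -- The set `T l'` depends on `l'`. Summing over all `T` on which `l'` agrees with `l`
        -- removes this dependence, so that the tuples can be counted for each `T` separately.
        refine le_of_eq_of_le (if_pos hmem).symm (Finset.single_le_sum
          (f := fun T => if l' ∈ fiber Tᶜ l then lam k T else 0) (fun T hT => ?_) (hT l'))
        split_ifs
        · exact hlam T hT
        · exact le_rfl
    _ = ∑ T ∈ S.coverFamily k, (Fintype.card (∀ j, I j) : ℝ) *
          (lam k T / ∏ j ∈ T, (Fintype.card (I j) : ℝ)) := by
        rw [Finset.sum_comm]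
        refine Finset.sum_congr rfl fun T _ => ?_
        rw [← Finset.sum_filter, Finset.filter_mem_eq_inter, Finset.univ_inter, Finset.sum_const,
          card_fiber, nsmul_eq_mul, hL, ← Finset.prod_mul_prod_compl T, Nat.cast_prod]
        have := (hcard T).ne'
        field_simp

end Covering

end Scheme

/-- With `x = -∑ log z` the product is `exp x ≥ 1 + x`, and `-log z ≥ 1 - z`. The product of
reciprocals is thereby bounded by an expression linear in the `z b`. -/
theorem one_add_sum_one_sub_le_prod_inv {β : Type*} (s : Finset β) (z : β → ℝ)
    (hz : ∀ b ∈ s, 0 < z b) : 1 + ∑ b ∈ s, (1 - z b) ≤ ∏ b ∈ s, (z b)⁻¹ := by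
  have h1 : ∏ b ∈ s, (z b)⁻¹ = Real.exp (∑ b ∈ s, -Real.log (z b)) := by
    rw [Real.exp_sum]
    exact Finset.prod_congr rfl fun b hb => by rw [Real.exp_neg, Real.exp_log (hz b hb)]
  rw [h1]
  refine le_trans ?_ (Real.add_one_le_exp _)
  rw [add_comm]
  refine add_le_add_left (Finset.sum_le_sum fun b hb => ?_) 1
  linarith [Real.log_le_sub_one_of_pos (hz b hb)]

/-! ### Likelihood encoders and one-shot achievability -/

namespace Scheme

variable {N : ℕ} {X Y : Fin N → Type*} {J : Type*} [Fintype J] [LinearOrder J]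
  {U : J → Type*} [∀ k, Fintype (Y k)] [∀ j, Fintype (U j)] (S : Scheme N X Y J U)
  {I : J → Type*} (l₀ : ∀ j, I j) [∀ j, DecidableEq (I j)] [∀ j, Fintype (I j)]
  (κ : ∀ k : Fin N, Finset J → (∀ j, U j) → Y k → ℝ) (θ : Fin N → Finset J → ℝ)
  (lam : Fin N → Finset J → ℝ)

open scoped Classical in
/-- The index tuple decoded by node `k`. -/
noncomputable def decoded (C : ∀ v : J × (∀ j, I j), U v.1) (k : Fin N) (b : Y k) : ∀ j, I j :=
  if h : ∃ l, S.Passes κ θ k (S.word l₀ C l) b then h.choose else l₀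

/-- The weight with which the encoder of node `k` selects the indices `l` when `d` was decoded. -/
noncomputable def choiceWeight (C : ∀ v : J × (∀ j, I j), U v.1) (k : Fin N) (b : Y k)
    (l : ∀ j, I j) : ℝ :=
  S.weight lam k (S.word l₀ C ((S.W k).piecewise l (S.decoded l₀ κ θ C k b))) b

/-- The distribution of the indices that the encoder of node `k` selects. -/
noncomputable def choiceProb (C : ∀ v : J × (∀ j, I j), U v.1) (k : Fin N) (b : Y k)
    (l : ∀ j, I j) : ℝ :=
  if ∑ m, S.choiceWeight l₀ κ θ lam C k b m = 0 then (if l = l₀ then 1 else 0)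
  else S.choiceWeight l₀ κ θ lam C k b l / ∑ m, S.choiceWeight l₀ κ θ lam C k b m

/-- The channel input of node `k` as a function of the selected indices. -/
noncomputable def input (C : ∀ v : J × (∀ j, I j), U v.1) (k : Fin N) (b : Y k)
    (l : ∀ j, I j) : X k :=
  S.map k (S.word l₀ C ((S.W k).piecewise l (S.decoded l₀ κ θ C k b))) b

/-- If all weights vanish, the point mass at `l₀` takes the place of the normalized weights. -/
theorem isPmf_choiceProb (C : ∀ v : J × (∀ j, I j), U v.1) (k : Fin N) (b : Y k) :
    IsPmf (S.choiceProb l₀ κ θ lam C k b) := by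
  have h0 : ∀ m, 0 ≤ S.choiceWeight l₀ κ θ lam C k b m := fun m => S.weight_nonneg _ _ _ _
  by_cases h : ∑ m, S.choiceWeight l₀ κ θ lam C k b m = 0
  · refine ⟨fun l => ?_, ?_⟩
    · rw [choiceProb, if_pos h]
      split_ifs <;> norm_num
    · simp only [choiceProb, if_pos h]
      simp
  · refine ⟨fun l => ?_, ?_⟩
    · rw [choiceProb, if_neg h]
      exact div_nonneg (h0 l) (Finset.sum_nonneg fun m _ => h0 m)
    · simp only [choiceProb, if_neg h]
      rw [← Finset.sum_div, div_self h]

/-- The node that selects the index of the codebook `j`. -/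
noncomputable def owner (j : J) : Fin N := (S.W_existsUnique j).choose

/-- The index tuple composed of the selections of all nodes. -/
noncomputable def combine (ls : Fin N → ∀ j, I j) : ∀ j, I j := fun j => ls (S.owner j) j

theorem combine_apply (ls : Fin N → ∀ j, I j) {k : Fin N} {j : J} (hj : j ∈ S.W k) :
    S.combine ls j = ls k j := by
  rw [combine, owner, (S.W_existsUnique j).unique (S.W_existsUnique j).choose_spec.1 hj]

theorem prod_prod_W (f : J → ℝ) : ∏ k, ∏ j ∈ S.W k, f j = ∏ j, f j := by
  rw [← Finset.prod_biUnion]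
  · refine Finset.prod_congr ?_ fun _ _ => rfl
    ext j
    obtain ⟨k, hk, -⟩ := S.W_existsUnique j
    simpa using ⟨k, hk⟩
  · intro k _ k' _ hkk'
    exact Finset.disjoint_left.mpr fun j hj hj' => hkk' ((S.W_existsUnique j).unique hj hj')

variable (ok : (∀ k, X k) → (∀ k, Y k) → Prop)

/-- All decoders identify the indices, all encoders use untruncated weights, and the resulting
tuple satisfies `ok`. -/
def Success (C : ∀ v : J × (∀ j, I j), U v.1) (l : ∀ j, I j) (y : ∀ k, Y k) : Prop :=
  ok (S.inputs (S.word l₀ C l) y) y ∧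
    (∀ k, S.Passes κ θ k (S.word l₀ C l) (y k)) ∧
    (∀ k, S.Good lam k (S.word l₀ C l) (y k)) ∧
    ∀ k, ¬∃ l', S.Passes κ θ k (S.word l₀ C l') (y k) ∧ ∃ j ∈ S.D k, l' j ≠ l j

/-- On success every decoder is right on `D k`, so each encoder sees the true codewords and its
normalizing sum is the number of index tuples times `avgWeight`. The product of weights and channels
is then `ratio`, up to these normalizers. -/
theorem success_le (C : ∀ v : J × (∀ j, I j), U v.1) (ls : Fin N → ∀ j, I j) (y : ∀ k, Y k) :
    ((Fintype.card (∀ j, I j) : ℝ)⁻¹) ^ N * (S.ratio (S.word l₀ C (S.combine ls)) y *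
      (ind (S.Success l₀ κ θ lam ok C (S.combine ls) y) *
        (1 + ∑ k, (1 - S.avgWeight l₀ lam k C (S.combine ls) (y k))))) ≤
    (∏ k, S.choiceProb l₀ κ θ lam C k (y k) (ls k)) *
      ((∏ k, S.chan k (fun k => S.input l₀ κ θ C k (y k) (ls k)) y) *
        ind (ok (fun k => S.input l₀ κ θ C k (y k) (ls k)) y)) := by
  set l := S.combine ls with hl
  have hRHS : 0 ≤ (∏ k, S.choiceProb l₀ κ θ lam C k (y k) (ls k)) *
      ((∏ k, S.chan k (fun k => S.input l₀ κ θ C k (y k) (ls k)) y) *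
        ind (ok (fun k => S.input l₀ κ θ C k (y k) (ls k)) y)) :=
    mul_nonneg (Finset.prod_nonneg fun k _ => (S.isPmf_choiceProb l₀ κ θ lam C k _).1 _)
      (mul_nonneg (Finset.prod_nonneg fun k _ => S.chan_nonneg _ _ _) (ind_nonneg _))
  by_cases hs : S.Success l₀ κ θ lam ok C l y
  swap
  · rw [ind_of_not hs]
    simpa using hRHS
  by_cases hr : S.ratio (S.word l₀ C l) y = 0
  · rw [hr]
    simpa using hRHS
  rw [ind_of hs, one_mul]
  obtain ⟨hok, hpass, hgood, huniq⟩ := hs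
  -- Indices outside `D k` may be decoded wrongly without harm: neither the encoder nor the symbol
  -- map of node `k` uses them.
  have hdec : ∀ k, ∀ j ∈ S.D k, S.decoded l₀ κ θ C k (y k) j = l j := by
    intro k j hj
    have hex : ∃ l, S.Passes κ θ k (S.word l₀ C l) (y k) := ⟨l, hpass k⟩
    rw [decoded, dif_pos hex]
    by_contra hne
    exact huniq k ⟨hex.choose, hex.choose_spec, j, hj, hne⟩
  have hagree : ∀ k (m : ∀ j, I j), ∀ j ∈ S.D k ∪ S.W k,
      (S.W k).piecewise m (S.decoded l₀ κ θ C k (y k)) j = (S.W k).piecewise m l j := by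
    intro k m j hj
    by_cases hjW : j ∈ S.W k
    · simp [hjW]
    · simp only [Finset.piecewise_eq_of_notMem _ _ _ hjW]
      exact hdec k j ((Finset.mem_union.mp hj).resolve_right hjW)
  have hagree' : ∀ k, ∀ j ∈ S.D k ∪ S.W k,
      (S.W k).piecewise (ls k) (S.decoded l₀ κ θ C k (y k)) j = l j := by
    intro k j hj
    rw [hagree k (ls k) j hj]
    by_cases hjW : j ∈ S.W k
    · simp [hjW, hl, S.combine_apply ls hjW]
    · simp [hjW]
  have hinput : (fun k => S.input l₀ κ θ C k (y k) (ls k)) = S.inputs (S.word l₀ C l) y := by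
    funext k
    exact S.map_congr k _ _ _ (S.word_congr_DW l₀ C (hagree' k))
  have hcw : ∀ k, S.choiceWeight l₀ κ θ lam C k (y k) (ls k) =
      S.weight lam k (S.word l₀ C l) (y k) := fun k =>
    S.weight_congr lam k _ (S.word_congr_DW l₀ C (hagree' k))
  have hcard : (0 : ℝ) < Fintype.card (∀ j, I j) :=
    Nat.cast_pos.mpr (Fintype.card_pos_iff.mpr ⟨l₀⟩)
  have htot : ∀ k, ∑ m, S.choiceWeight l₀ κ θ lam C k (y k) m =
      Fintype.card (∀ j, I j) * S.avgWeight l₀ lam k C l (y k) := by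
    intro k
    rw [avgWeight, mul_inv_cancel_left₀ hcard.ne']
    exact Finset.sum_congr rfl fun m _ =>
      S.weight_congr lam k _ (S.word_congr_DW l₀ C (hagree k m))
  have hjoint : S.joint (S.word l₀ C l) y ≠ 0 := fun h => hr (by rw [ratio, h, zero_div])
  have hq : ∏ j, S.q j (S.word l₀ C l) ≠ 0 := fun h => hr (by rw [ratio, h, div_zero])
  have hw : ∀ k, 0 < S.weight lam k (S.word l₀ C l) (y k) := by
    intro k
    rw [weight, ind_of (hgood k), one_mul]
    refine div_pos (lt_of_le_of_ne (S.c_nonneg _ _ _) ?_) (Finset.prod_pos fun j _ =>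
      lt_of_le_of_ne (S.q_nonneg _ _) (Finset.prod_ne_zero_iff.mp hq j (Finset.mem_univ j)).symm)
    exact (mul_ne_zero_iff.mp (Finset.prod_ne_zero_iff.mp hjoint k (Finset.mem_univ k))).2.symm
  have hz : ∀ k, 0 < S.avgWeight l₀ lam k C l (y k) := by
    intro k
    have : 0 < ∑ m, S.choiceWeight l₀ κ θ lam C k (y k) m :=
      Finset.sum_pos' (fun m _ => S.weight_nonneg _ _ _ _)
        ⟨ls k, Finset.mem_univ _, by rw [hcw]; exact hw k⟩
    rw [htot] at this
    exact (mul_pos_iff_of_pos_left hcard).mp this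
  have hprob : ∀ k, S.choiceProb l₀ κ θ lam C k (y k) (ls k) =
      S.weight lam k (S.word l₀ C l) (y k) * ((Fintype.card (∀ j, I j) : ℝ)⁻¹ *
        (S.avgWeight l₀ lam k C l (y k))⁻¹) := by
    intro k
    rw [choiceProb, if_neg (by rw [htot]; exact (mul_pos hcard (hz k)).ne'), htot, hcw,
      div_eq_mul_inv, mul_inv]
  have hratio : (∏ k, S.weight lam k (S.word l₀ C l) (y k)) *
      ∏ k, S.chan k (S.inputs (S.word l₀ C l) y) y = S.ratio (S.word l₀ C l) y := by
    rw [ratio, joint, Finset.prod_mul_distrib, ← S.prod_prod_W]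
    have : ∀ k, S.weight lam k (S.word l₀ C l) (y k) =
        S.c k (S.word l₀ C l) (y k) / ∏ j ∈ S.W k, S.q j (S.word l₀ C l) := fun k => by
      rw [weight, ind_of (hgood k), one_mul]
    rw [Finset.prod_congr rfl fun k _ => this k, Finset.prod_div_distrib]
    ring
  rw [hinput, ind_of hok, mul_one, Finset.prod_congr rfl fun k _ => hprob k,
    Finset.prod_mul_distrib, Finset.prod_mul_distrib, Finset.prod_const, Finset.card_univ,
    Fintype.card_fin]
  have hprod := one_add_sum_one_sub_le_prod_inv Finset.univ
    (fun k => S.avgWeight l₀ lam k C l (y k)) fun k _ => hz k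
  calc _ ≤ ((Fintype.card (∀ j, I j) : ℝ)⁻¹) ^ N * (S.ratio (S.word l₀ C l) y *
        ∏ k, (S.avgWeight l₀ lam k C l (y k))⁻¹) := by
        refine mul_le_mul_of_nonneg_left (mul_le_mul_of_nonneg_left hprod ?_) (by positivity)
        exact S.ratio_nonneg _ _
    _ = _ := by
        rw [← hratio]
        ring

variable (hac : ∀ u y j, S.joint u y ≠ 0 → S.q j u ≠ 0) (hone : ∑ y, ∑ u, S.joint u y = 1)
  (hκ_nonneg : ∀ k, ∀ T ∈ S.decodeFamily k, ∀ u b, 0 ≤ κ k T u b)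
  (hκ_congr : ∀ k T, T ∈ S.decodeFamily k → ∀ u v b, (∀ j ∈ S.V k, u j = v j) →
    κ k T u b = κ k T v b)
  (hκ_sum : ∀ k, ∀ T ∈ S.decodeFamily k, ∀ u b, ∑ u' ∈ fiber T u, κ k T u' b ≤ 1)
  (hθ : ∀ k, ∀ T ∈ S.decodeFamily k, 0 < θ k T)
  (hlam : ∀ k, ∀ T ∈ S.coverFamily k, 0 ≤ lam k T)

/-- The probability that the ideal coding experiment fails. -/
noncomputable def failBound (I : J → Type*) [∀ j, Fintype (I j)] : ℝ :=
  S.prob (fun u y => ¬ok (S.inputs u y) y) +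
    ∑ k, (S.prob (fun u y => ¬S.Passes κ θ k u (y k)) + S.prob (fun u y => ¬S.Good lam k u (y k)) +
      ∑ T ∈ S.decodeFamily k, (∏ j ∈ T, (Fintype.card (I j) : ℝ)) * (θ k T)⁻¹)

/-- The second moment of the encoder weights of node `k`. -/
noncomputable def coverBound (I : J → Type*) [∀ j, Fintype (I j)] (k : Fin N) : ℝ :=
  ∑ T ∈ S.coverFamily k, lam k T / ∏ j ∈ T, (Fintype.card (I j) : ℝ)

include hac hone hκ_nonneg hκ_congr hκ_sum hθ hlam

/-- The integrand is `(1 + N)` times the success indicator minus the average weights on success. The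
first part is bounded below by a union bound. In the second, success implies `Good`, so the
truncated mean of `idealExp_avgWeight_le` applies. -/
theorem idealExp_success_ge (l : ∀ j, I j) :
    (1 + N) * (1 - S.failBound κ θ lam ok I) - ∑ k, S.coverBound lam I k ≤
      S.idealExp l₀ l (fun C y => ind (S.Success l₀ κ θ lam ok C l y) *
        (1 + ∑ k, (1 - S.avgWeight l₀ lam k C l (y k)))) := by
  have h1 : S.idealExp l₀ l (fun _ _ => 1) = 1 := by
    rw [S.idealExp_word l₀ hac l fun _ _ => 1]
    simpa using hone
  have hpr : ∀ E : (∀ j, U j) → (∀ k, Y k) → Prop,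
      S.idealExp l₀ l (fun C y => ind (E (S.word l₀ C l) y)) = S.prob E := fun E =>
    S.idealExp_word l₀ hac l fun u y => ind (E u y)
  let bad : (∀ v : J × (∀ j, I j), U v.1) → (∀ k, Y k) → ℝ := fun C y =>
    ind (¬ok (S.inputs (S.word l₀ C l) y) y) +
      ∑ k, (ind (¬S.Passes κ θ k (S.word l₀ C l) (y k)) +
        ind (¬S.Good lam k (S.word l₀ C l) (y k)) +
        ind (∃ l', S.Passes κ θ k (S.word l₀ C l') (y k) ∧ ∃ j ∈ S.D k, l' j ≠ l j))
  have hbad : S.idealExp l₀ l bad ≤ S.failBound κ θ lam ok I := by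
    simp only [bad, idealExp_add, idealExp_sum, failBound]
    rw [hpr fun u y => ¬ok (S.inputs u y) y]
    refine add_le_add_right (Finset.sum_le_sum fun k _ => ?_) _
    rw [hpr fun u y => ¬S.Passes κ θ k u (y k), hpr fun u y => ¬S.Good lam k u (y k)]
    exact add_le_add_right (S.idealExp_wrong_le l₀ κ θ hac hone l k (hκ_nonneg k) hκ_congr
      (hκ_sum k) (hθ k)) _
  have hsucc : ∀ C y, 1 - bad C y ≤ ind (S.Success l₀ κ θ lam ok C l y) := by
    intro C y
    by_cases hs : S.Success l₀ κ θ lam ok C l y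
    · rw [ind_of hs]
      have : 0 ≤ bad C y := add_nonneg (ind_nonneg _) (Finset.sum_nonneg fun k _ =>
        add_nonneg (add_nonneg (ind_nonneg _) (ind_nonneg _)) (ind_nonneg _))
      linarith
    · rw [ind_of_not hs]
      have hterm : ∀ k, 0 ≤ ind (¬S.Passes κ θ k (S.word l₀ C l) (y k)) +
        ind (¬S.Good lam k (S.word l₀ C l) (y k)) +
        ind (∃ l', S.Passes κ θ k (S.word l₀ C l') (y k) ∧ ∃ j ∈ S.D k, l' j ≠ l j) := fun k =>
          add_nonneg (add_nonneg (ind_nonneg _) (ind_nonneg _)) (ind_nonneg _)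
      have hge : ∀ k, 1 ≤ ind (¬S.Passes κ θ k (S.word l₀ C l) (y k)) +
        ind (¬S.Good lam k (S.word l₀ C l) (y k)) +
        ind (∃ l', S.Passes κ θ k (S.word l₀ C l') (y k) ∧ ∃ j ∈ S.D k, l' j ≠ l j) →
          1 ≤ bad C y := fun k hk => by
        have := Finset.single_le_sum (fun k _ => hterm k) (Finset.mem_univ k)
        have h0 := ind_nonneg (¬ok (S.inputs (S.word l₀ C l) y) y)
        simp only [bad]
        linarith
      rw [sub_nonpos]
      by_contra hlt
      refine hs ⟨?_, fun k => ?_, fun k => ?_, fun k => ?_⟩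
      · by_contra h
        refine hlt ?_
        simp only [bad, ind_of h]
        linarith [Finset.sum_nonneg fun k (_ : k ∈ Finset.univ) => hterm k]
      · by_contra h
        refine hlt (hge k ?_)
        rw [ind_of h]
        linarith [ind_nonneg (¬S.Good lam k (S.word l₀ C l) (y k)), ind_nonneg (∃ l',
          S.Passes κ θ k (S.word l₀ C l') (y k) ∧ ∃ j ∈ S.D k, l' j ≠ l j)]
      · by_contra h
        refine hlt (hge k ?_)
        rw [ind_of h]
        linarith [ind_nonneg (¬S.Passes κ θ k (S.word l₀ C l) (y k)), ind_nonneg (∃ l',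
          S.Passes κ θ k (S.word l₀ C l') (y k) ∧ ∃ j ∈ S.D k, l' j ≠ l j)]
      · intro h
        refine hlt (hge k ?_)
        rw [ind_of h]
        linarith [ind_nonneg (¬S.Passes κ θ k (S.word l₀ C l) (y k)),
          ind_nonneg (¬S.Good lam k (S.word l₀ C l) (y k))]
  have hN : (0 : ℝ) ≤ 1 + N := by positivity
  calc (1 + N) * (1 - S.failBound κ θ lam ok I) - ∑ k, S.coverBound lam I k
      ≤ (1 + N) * (1 - S.idealExp l₀ l bad) - ∑ k, S.idealExp l₀ l (fun C y =>
          ind (S.Good lam k (S.word l₀ C l) (y k)) * S.avgWeight l₀ lam k C l (y k)) :=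
        sub_le_sub (mul_le_mul_of_nonneg_left (sub_le_sub_left hbad 1) hN)
          (Finset.sum_le_sum fun k _ => S.idealExp_avgWeight_le l₀ lam hac hone l k (hlam k))
    _ = S.idealExp l₀ l (fun C y => (1 + N) * (1 - bad C y) - ∑ k,
          ind (S.Good lam k (S.word l₀ C l) (y k)) * S.avgWeight l₀ lam k C l (y k)) := by
        rw [idealExp_sub, idealExp_const_mul, idealExp_sub, h1, idealExp_sum]
    _ ≤ _ := by
        refine S.idealExp_mono l₀ l fun C y => ?_
        simp only [Finset.sum_sub_distrib, Finset.sum_const, Finset.card_univ, Fintype.card_fin,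
          nsmul_eq_mul, mul_one]
        have hz : ∀ k, 0 ≤ S.avgWeight l₀ lam k C l (y k) := fun k =>
          mul_nonneg (by positivity) (Finset.sum_nonneg fun _ _ => S.weight_nonneg _ _ _ _)
        have h2 := mul_le_mul_of_nonneg_left (hsucc C y) hN
        have h3 : ind (S.Success l₀ κ θ lam ok C l y) * ∑ k, S.avgWeight l₀ lam k C l (y k) ≤
            ∑ k, ind (S.Good lam k (S.word l₀ C l) (y k)) * S.avgWeight l₀ lam k C l (y k) := by
          rw [Finset.mul_sum]
          exact Finset.sum_le_sum fun k _ => mul_le_mul_of_nonneg_right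
            (ind_mono fun h => h.2.2.1 k) (hz k)
        nlinarith

include l₀ in
/-- One-shot achievability: some deterministic node operations have an error probability bounded in
terms of the joint distribution. -/
theorem exists_nodes (hU : Nonempty (∀ j, U j)) (hY : Nonempty (∀ k, Y k)) :
    ∃ f : ∀ k, Y k → X k,
      ∑ y, (∏ k, S.chan k (fun k => f k (y k)) y) * ind (¬ok (fun k => f k (y k)) y) ≤
        (1 + N) * S.failBound κ θ lam ok I + (∑ k, S.coverBound lam I k - N) := by
  set β := (1 + N) * (1 - S.failBound κ θ lam ok I) - ∑ k, S.coverBound lam I k with hβ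
  let H : (∀ v : J × (∀ j, I j), U v.1) → (∀ k, Y k) → (Fin N → ∀ j, I j) → ℝ := fun C y ls =>
    (∏ k, S.chan k (fun k => S.input l₀ κ θ C k (y k) (ls k)) y) *
        ind (ok (fun k => S.input l₀ κ θ C k (y k) (ls k)) y)
  obtain ⟨C, hC⟩ := (S.isPmf_codeProb l₀ (I := I)).exists_sum_mul_le fun C =>
    ∑ y, ∑ ls, (∏ k, S.choiceProb l₀ κ θ lam C k (y k) (ls k)) * H C y ls
  have hcard : (0 : ℝ) < Fintype.card (∀ j, I j) :=
    Nat.cast_pos.mpr (Fintype.card_pos_iff.mpr ⟨l₀⟩)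
  have hβC : β ≤ ∑ y, ∑ ls, (∏ k, S.choiceProb l₀ κ θ lam C k (y k) (ls k)) * H C y ls := by
    refine le_trans ?_ hC
    -- Each node draws a full index tuple of which only the part in `W k` matters. There are `card ^
    -- N` families `ls`, matching the uniform factor in `success_le`.
    calc β = ∑ ls : Fin N → ∀ j, I j, ((Fintype.card (∀ j, I j) : ℝ)⁻¹) ^ N * β := by
          rw [Finset.sum_const, Finset.card_univ, Fintype.card_fun, Fintype.card_fin, nsmul_eq_mul,
            Nat.cast_pow, ← mul_assoc, ← mul_pow, mul_inv_cancel₀ hcard.ne', one_pow, one_mul]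
      _ ≤ ∑ ls : Fin N → ∀ j, I j, ((Fintype.card (∀ j, I j) : ℝ)⁻¹) ^ N *
            S.idealExp l₀ (S.combine ls) (fun C y =>
              ind (S.Success l₀ κ θ lam ok C (S.combine ls) y) *
              (1 + ∑ k, (1 - S.avgWeight l₀ lam k C (S.combine ls) (y k)))) :=
          Finset.sum_le_sum fun ls _ => mul_le_mul_of_nonneg_left
            (S.idealExp_success_ge l₀ κ θ lam ok hac hone hκ_nonneg hκ_congr hκ_sum hθ hlam _)
            (by positivity)
      _ = ∑ C, S.codeProb l₀ C * ∑ y, ∑ ls, ((Fintype.card (∀ j, I j) : ℝ)⁻¹) ^ N *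
            (S.ratio (S.word l₀ C (S.combine ls)) y *
              (ind (S.Success l₀ κ θ lam ok C (S.combine ls) y) *
              (1 + ∑ k, (1 - S.avgWeight l₀ lam k C (S.combine ls) (y k))))) := by
          simp only [idealExp, Finset.mul_sum (s := Finset.univ (α := ∀ k, Y k)),
            Finset.mul_sum (s := Finset.univ (α := ∀ v : J × (∀ j, I j), U v.1)),
            Finset.mul_sum (s := Finset.univ (α := Fin N → ∀ j, I j))]
          rw [Finset.sum_comm]
          conv_rhs => rw [Finset.sum_comm]
          refine Finset.sum_congr rfl fun y _ => ?_
          rw [Finset.sum_comm]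
          refine Finset.sum_congr rfl fun C _ => Finset.sum_congr rfl fun ls _ => ?_
          ring
      _ ≤ _ := Finset.sum_le_sum fun C _ => mul_le_mul_of_nonneg_left
          (Finset.sum_le_sum fun y _ => Finset.sum_le_sum fun ls _ =>
            S.success_le l₀ κ θ lam ok C ls y) (S.codeProb_nonneg l₀ C)
  obtain ⟨g, hg⟩ := exists_choice_functions (fun k b => S.choiceProb l₀ κ θ lam C k b)
    (fun k b => S.isPmf_choiceProb l₀ κ θ lam C k b) (H C)
  refine ⟨fun k b => S.input l₀ κ θ C k b (g k b), ?_⟩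
  -- Success probabilities turn into error probabilities because the outputs, a Bayesian network in
  -- the order of the nodes, have total mass one.
  have htotal : ∑ y : ∀ k, Y k,
      ∏ k, S.chan k (fun k => S.input l₀ κ θ C k (y k) (g k (y k))) y = 1 := by
    refine sum_prod_eq_one (ι := Fin N) (α := Y) id (fun k => Finset.univ.filter (· < k))
      (fun k y => S.chan k (fun k => S.input l₀ κ θ C k (y k) (g k (y k))) y) (by simp) ?_ ?_
      hY.some
    · intro k y y' h
      have h' : ∀ i ≤ k, y i = y' i := fun i hi => h i (by
        rcases hi.lt_or_eq with hlt | rfl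
        · exact Finset.mem_insert_of_mem (by simpa using hlt)
        · exact Finset.mem_insert_self _ _)
      refine S.chan_congr k _ _ _ _ (fun i hi => ?_) h'
      simp only [h' i hi.le]
    · intro k y
      rw [← S.chan_sum k (fun k => S.input l₀ κ θ C k (y k) (g k (y k))) y]
      refine Finset.sum_congr rfl fun b _ => S.chan_congr k _ _ _ _ (fun i hi => ?_) fun _ _ => rfl
      simp only [Function.update_of_ne hi.ne]
  have hnot : ∀ P : Prop, ind (¬P) = 1 - ind P := fun P => by
    by_cases h : P
    · rw [ind_of h, ind_of_not (not_not.mpr h)]; ring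
    · rw [ind_of h, ind_of_not h]; ring
  simp only [hnot, mul_sub, mul_one, Finset.sum_sub_distrib]
  rw [htotal]
  have := hβC.trans hg
  simp only [H] at this
  linarith

end Scheme

/-! ### Blocks of length `n` and single-letter rate conditions -/

namespace Scheme

variable {N : ℕ} {X Y : Fin N → Type*} {J : Type*} [Fintype J] [LinearOrder J]
  {U : J → Type*} [∀ k, Fintype (Y k)] [∀ j, Fintype (U j)] (S : Scheme N X Y J U)

/-- The `n`-letter extension of a scheme. -/
def pow (n : ℕ) : Scheme N (fun k => Fin n → X k) (fun k => Fin n → Y k) J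
    (fun j => Fin n → U j) where
  A := S.A
  A_lt := S.A_lt
  A_trans := S.A_trans
  D := S.D
  V := S.V
  W := S.W
  D_subset := S.D_subset
  A_V := S.A_V
  A_D := S.A_D
  A_W := S.A_W
  D_W := S.D_W
  W_existsUnique := S.W_existsUnique
  q j u := ∏ t, S.q j fun i => u i t
  q_nonneg j u := Finset.prod_nonneg fun t _ => S.q_nonneg _ _
  q_congr j u v h := Finset.prod_congr rfl fun t _ => S.q_congr _ _ _ fun i hi => by rw [h i hi]
  q_sum j u := by
    have h : ∀ (a : Fin n → U j) (t : Fin n), (fun i => Function.update u j a i t) =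
        Function.update (fun i => u i t) j (a t) := by
      intro a t
      funext i
      by_cases hij : i = j
      · subst hij
        simp
      · simp [Function.update_of_ne hij]
    simp only [h]
    rw [← Fintype.prod_sum fun t a => S.q j (Function.update (fun i => u i t) j a)]
    simp [S.q_sum]
  c k u b := ∏ t, S.c k (fun i => u i t) (b t)
  c_nonneg k u b := Finset.prod_nonneg fun t _ => S.c_nonneg _ _ _
  c_congr k u v b h := Finset.prod_congr rfl fun t _ => S.c_congr _ _ _ _ fun i hi => by rw [h i hi]
  map k u b t := S.map k (fun i => u i t) (b t)
  map_congr k u v b h := funext fun t => S.map_congr _ _ _ _ fun i hi => by rw [h i hi]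
  chan k x y := ∏ t, S.chan k (fun i => x i t) (fun i => y i t)
  chan_nonneg k x y := Finset.prod_nonneg fun t _ => S.chan_nonneg _ _ _
  chan_congr k x x' y y' hx hy := Finset.prod_congr rfl fun t _ =>
    S.chan_congr _ _ _ _ _ (fun i hi => by rw [hx i hi]) (fun i hi => by rw [hy i hi])
  chan_sum k x y := by
    have h : ∀ (b : Fin n → Y k) (t : Fin n), (fun i => Function.update y k b i t) =
        Function.update (fun i => y i t) k (b t) := by
      intro a t
      funext i
      by_cases hij : i = k
      · subst hij
        simp
      · simp [Function.update_of_ne hij]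
    simp only [h]
    rw [← Fintype.prod_sum fun t b =>
      S.chan k (fun i => x i t) (Function.update (fun i => y i t) k b)]
    simp [S.chan_sum]

theorem pow_joint (n : ℕ) (u : ∀ j, Fin n → U j) (y : ∀ k, Fin n → Y k) :
    (S.pow n).joint u y = ∏ t, S.joint (fun j => u j t) (fun k => y k t) := by
  simp only [joint]
  rw [Finset.prod_comm]
  refine Finset.prod_congr rfl fun k _ => ?_
  rw [Finset.prod_mul_distrib]
  rfl

theorem pow_coverMarginal (n : ℕ) (k : Fin N) (T : Finset J) (u : ∀ j, Fin n → U j)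
    (b : Fin n → Y k) :
    (S.pow n).coverMarginal k T u b = ∏ t, S.coverMarginal k T (fun j => u j t) (b t) :=
  sum_fiber_prod_time (S.W k \ T) u fun t v => S.c k v (b t)

theorem pow_prob (n : ℕ) (E : (∀ j, Fin n → U j) → (∀ k, Fin n → Y k) → Prop) :
    (S.pow n).prob E = ∑ z : Fin n → (∀ j, U j) × (∀ k, Y k),
      (∏ t, S.joint (z t).1 (z t).2) * ind (E (fun j t => (z t).1 j) (fun k t => (z t).2 k)) := by
  rw [prob, Finset.sum_comm, ← Fintype.sum_prod_type']
  refine Finset.sum_bij' (fun w _ t => (fun j => w.1 j t, fun k => w.2 k t))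
    (fun z _ => (fun j t => (z t).1 j, fun k t => (z t).2 k)) ?_ ?_ ?_ ?_ ?_
  · intros; exact Finset.mem_univ _
  · intros; exact Finset.mem_univ _
  · intros; rfl
  · intros; rfl
  · intro w _
    rw [pow_joint]

theorem pow_prod_q (n : ℕ) (T : Finset J) (u : ∀ j, Fin n → U j) :
    ∏ j ∈ T, (S.pow n).q j u = ∏ t, ∏ j ∈ T, S.q j (fun i => u i t) := by
  rw [Finset.prod_comm]
  rfl

/-- The single-letter joint distribution as a pmf on pairs. -/
def jointPair (w : (∀ j, U j) × (∀ k, Y k)) : ℝ := S.joint w.1 w.2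

theorem prob_mono {E F : (∀ j, U j) → (∀ k, Y k) → Prop} (h : ∀ u y, E u y → F u y) :
    S.prob E ≤ S.prob F :=
  Finset.sum_le_sum fun y _ => Finset.sum_le_sum fun u _ =>
    mul_le_mul_of_nonneg_left (ind_mono (h u y)) (S.joint_nonneg u y)

theorem prob_nonneg (E : (∀ j, U j) → (∀ k, Y k) → Prop) : 0 ≤ S.prob E :=
  Finset.sum_nonneg fun y _ => Finset.sum_nonneg fun u _ =>
    mul_nonneg (S.joint_nonneg u y) (ind_nonneg _)

theorem prob_exists_le {β : Type*} (s : Finset β) (E : β → (∀ j, U j) → (∀ k, Y k) → Prop) :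
    S.prob (fun u y => ∃ b ∈ s, E b u y) ≤ ∑ b ∈ s, S.prob (E b) := by
  simp only [prob]
  conv_rhs => rw [Finset.sum_comm]
  refine Finset.sum_le_sum fun y _ => ?_
  conv_rhs => rw [Finset.sum_comm]
  refine Finset.sum_le_sum fun u _ => ?_
  rw [← Finset.mul_sum]
  exact mul_le_mul_of_nonneg_left (ind_exists_le_sum _ _) (S.joint_nonneg u y)

theorem isPmf_jointPair (hone : ∑ y, ∑ u, S.joint u y = 1) : IsPmf S.jointPair := by
  refine ⟨fun w => S.joint_nonneg _ _, ?_⟩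
  rw [← hone, Finset.sum_comm, Fintype.sum_prod_type]
  rfl

/-- The expectation of a single-letter quantity. -/
noncomputable def mean (g : (∀ j, U j) → (∀ k, Y k) → ℝ) : ℝ :=
  ∑ w : (∀ j, U j) × (∀ k, Y k), S.jointPair w * g w.1 w.2

variable (hone : ∑ y, ∑ u, S.joint u y = 1)

-- Chebyshev's inequality for an event contained in a large deviation of a sum. The inclusion is
-- needed only on sequences of positive probability, where the logarithms used later are well
-- behaved.
include hone in
theorem pow_prob_le (n : ℕ) (hn : 0 < n) (E : (∀ j, Fin n → U j) → (∀ k, Fin n → Y k) → Prop)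
    (g : (∀ j, U j) → (∀ k, Y k) → ℝ) {η : ℝ} (hη : 0 < η)
    (hE : ∀ u y, (∀ t, S.joint (fun j => u j t) (fun k => y k t) ≠ 0) → E u y →
      η * n ≤ |∑ t, (g (fun j => u j t) (fun k => y k t) - S.mean g)|) :
    (S.pow n).prob E ≤
      S.mean (fun u y => (g u y - S.mean g) ^ 2) / (n * η ^ 2) := by
  refine le_trans ?_ (sum_prod_ite_le n hn (S.isPmf_jointPair hone) (fun w => g w.1 w.2) hη)
  rw [pow_prob]
  refine Finset.sum_le_sum fun z _ => ?_
  have h0 : 0 ≤ ∏ t, S.jointPair (z t) := Finset.prod_nonneg fun t _ => S.joint_nonneg _ _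
  by_cases hz : ∏ t, S.joint (z t).1 (z t).2 = 0
  · rw [hz, zero_mul]
    split_ifs
    · exact h0
    · exact le_rfl
  by_cases hEz : E (fun j t => (z t).1 j) (fun k t => (z t).2 k)
  · have : η * n ≤ |∑ t, (g (z t).1 (z t).2 - ∑ a, S.jointPair a * g a.1 a.2)| :=
      hE _ _ (fun t => Finset.prod_ne_zero_iff.mp hz t (Finset.mem_univ t)) hEz
    rw [if_pos this, ind_of hEz, mul_one]
    exact le_rfl
  · rw [ind_of_not hEz, mul_zero]
    split_ifs
    · exact h0
    · exact le_rfl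

include hone in
theorem tendsto_pow_prob (E : ∀ n, (∀ j, Fin n → U j) → (∀ k, Fin n → Y k) → Prop)
    (g : (∀ j, U j) → (∀ k, Y k) → ℝ) {η : ℝ} (hη : 0 < η)
    (hE : ∀ n u y, (∀ t, S.joint (fun j => u j t) (fun k => y k t) ≠ 0) → E n u y →
      η * n ≤ |∑ t, (g (fun j => u j t) (fun k => y k t) - S.mean g)|) :
    Tendsto (fun n => (S.pow n).prob (E n)) atTop (𝓝 0) := by
  have h : Tendsto (fun n : ℕ => S.mean (fun u y => (g u y - S.mean g) ^ 2) / (n * η ^ 2)) atTop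
      (𝓝 0) := by
    refine Tendsto.div_atTop tendsto_const_nhds ?_
    exact tendsto_natCast_atTop_atTop.atTop_mul_const (by positivity)
  refine tendsto_of_tendsto_of_tendsto_of_le_of_le' tendsto_const_nhds h
    (Eventually.of_forall fun n => (S.pow n).prob_nonneg _) ?_
  filter_upwards [eventually_gt_atTop 0] with n hn
  exact S.pow_prob_le hone n hn (E n) g hη (hE n)

variable (κ : ∀ k : Fin N, Finset J → (∀ j, U j) → Y k → ℝ) (r : J → ℝ)

/-- The single-letter mutual information of the decoding test. -/
noncomputable def decodeInfo (k : Fin N) (T : Finset J) : ℝ :=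
  S.mean fun u y => Real.logb 2 (κ k T u (y k) / ∏ j ∈ T, S.q j u)

/-- The single-letter mutual information of the compression. -/
noncomputable def coverInfo (k : Fin N) (T : Finset J) : ℝ :=
  S.mean fun u y => Real.logb 2 (S.coverMarginal k T u (y k) / ∏ j ∈ T, S.q j u)

/-- The `n`-letter likelihoods of the decoding test. -/
def powLikelihood (n : ℕ) (k : Fin N) (T : Finset J) (u : ∀ j, Fin n → U j) (b : Fin n → Y k) : ℝ :=
  ∏ t, κ k T (fun j => u j t) (b t)

/-- The thresholds of the decoding test. -/
noncomputable def decodeThreshold (n : ℕ) (k : Fin N) (T : Finset J) : ℝ :=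
  2 ^ ((n : ℝ) * ((∑ j ∈ T, r j + S.decodeInfo κ k T) / 2))

/-- The thresholds of the truncation of the compression weights. -/
noncomputable def coverThreshold (n : ℕ) (k : Fin N) (T : Finset J) : ℝ :=
  if T = ∅ then 1 else 2 ^ ((n : ℝ) * ((∑ j ∈ T, r j + S.coverInfo k T) / 2))

variable (hac : ∀ u y j, S.joint u y ≠ 0 → S.q j u ≠ 0)

theorem logb_prod_div {n : ℕ} (f g : Fin n → ℝ) (hf : ∀ t, f t ≠ 0) (hg : ∀ t, g t ≠ 0) :
    Real.logb 2 ((∏ t, f t) / ∏ t, g t) = ∑ t, Real.logb 2 (f t / g t) := by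
  rw [← Finset.prod_div_distrib, Real.logb_prod]
  exact fun t _ => div_ne_zero (hf t) (hg t)

-- The threshold exponent is midway between rate and information, so a failed test forces the
-- log-likelihood sum below its mean by at least `n` times half the gap.
include hone hac in
theorem tendsto_prob_not_passes
    (hκ_nonneg : ∀ k, ∀ T ∈ S.decodeFamily k, ∀ u b, 0 ≤ κ k T u b)
    (hκ_ne : ∀ k, ∀ T ∈ S.decodeFamily k, ∀ u y, S.joint u y ≠ 0 → κ k T u (y k) ≠ 0)
    (k : Fin N) (hr : ∀ T ∈ S.decodeFamily k, ∑ j ∈ T, r j < S.decodeInfo κ k T) :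
    Tendsto (fun n => (S.pow n).prob fun u y =>
      ¬(S.pow n).Passes (powLikelihood κ n) (S.decodeThreshold κ r n) k u (y k)) atTop (𝓝 0) := by
  have h1 : Tendsto (fun n => ∑ T ∈ S.decodeFamily k, (S.pow n).prob fun u y =>
      ¬S.decodeThreshold κ r n k T * ∏ j ∈ T, (S.pow n).q j u < powLikelihood κ n k T u (y k))
      atTop (𝓝 0) := by
    rw [← Finset.sum_const_zero (s := S.decodeFamily k) (ι := Finset J)]
    refine tendsto_finsetSum _ fun T hT => ?_
    refine S.tendsto_pow_prob hone _
      (fun u y => Real.logb 2 (κ k T u (y k) / ∏ j ∈ T, S.q j u))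
      (η := (S.decodeInfo κ k T - ∑ j ∈ T, r j) / 2) (by linarith [hr T hT]) ?_
    intro n u y hne hE
    rw [not_lt] at hE
    have hκp : ∀ t, 0 < κ k T (fun j => u j t) (y k t) := fun t =>
      lt_of_le_of_ne (hκ_nonneg k T hT _ _) (hκ_ne k T hT _ _ (hne t)).symm
    have hqp : ∀ t, 0 < ∏ j ∈ T, S.q j (fun i => u i t) := fun t => Finset.prod_pos fun j _ =>
      lt_of_le_of_ne (S.q_nonneg _ _) (hac _ _ j (hne t)).symm
    rw [pow_prod_q, powLikelihood, ← div_le_iff₀ (Finset.prod_pos fun t _ => hqp t)] at hE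
    have hlog := Real.logb_le_logb_of_le one_lt_two (div_pos (Finset.prod_pos fun t _ => hκp t)
      (Finset.prod_pos fun t _ => hqp t)) hE
    rw [logb_prod_div _ _ (fun t => (hκp t).ne') (fun t => (hqp t).ne'), decodeThreshold,
      Real.logb_rpow two_pos (by norm_num)] at hlog
    rw [Finset.sum_sub_distrib, Finset.sum_const, Finset.card_univ, Fintype.card_fin, nsmul_eq_mul]
    rw [le_abs]
    right
    change _ ≤ -(_ - n * S.decodeInfo κ k T)
    linarith
  refine tendsto_of_tendsto_of_tendsto_of_le_of_le tendsto_const_nhds h1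
    (fun n => (S.pow n).prob_nonneg _) fun n => ?_
  refine le_trans ((S.pow n).prob_mono fun u y h => ?_) ((S.pow n).prob_exists_le _ _)
  simp only [Passes, not_forall] at h
  obtain ⟨T, hT, h⟩ := h
  exact ⟨T, hT, h⟩

-- As for decoding, but the deviation is above the mean: the threshold now lies above the
-- information.
include hone hac in
theorem tendsto_prob_not_good
    (hc_sum : ∀ k u b, ∑ u' ∈ fiber (S.W k) u, S.c k u' b ≤ 1)
    (k : Fin N) (hr : ∀ T ∈ S.coverFamily k, T.Nonempty → S.coverInfo k T < ∑ j ∈ T, r j) :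
    Tendsto (fun n => (S.pow n).prob fun u y =>
      ¬(S.pow n).Good (S.coverThreshold r n) k u (y k)) atTop (𝓝 0) := by
  have h1 : Tendsto (fun n => ∑ T ∈ S.coverFamily k, (S.pow n).prob fun u y =>
      ¬(S.pow n).coverMarginal k T u (y k) ≤ S.coverThreshold r n k T * ∏ j ∈ T, (S.pow n).q j u)
      atTop (𝓝 0) := by
    rw [← Finset.sum_const_zero (s := S.coverFamily k) (ι := Finset J)]
    refine tendsto_finsetSum _ fun T hT => ?_
    have hcm0 : ∀ u b, 0 ≤ S.coverMarginal k T u b := fun u b =>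
      Finset.sum_nonneg fun _ _ => S.c_nonneg _ _ _
    -- For `T = ∅` there is no gap to exploit. The threshold is exactly `1`, and the condition
    -- always holds since the kernel sums to at most one.
    rcases T.eq_empty_or_nonempty with rfl | hTne
    · have : ∀ n (u : ∀ j, Fin n → U j) (y : ∀ k, Fin n → Y k),
          (S.pow n).coverMarginal k ∅ u (y k) ≤
            S.coverThreshold r n k ∅ * ∏ j ∈ ∅, (S.pow n).q j u := by
        intro n u y
        rw [pow_coverMarginal, coverThreshold, if_pos rfl, Finset.prod_empty, one_mul]
        refine Finset.prod_le_one (fun t _ => hcm0 _ _) fun t _ => ?_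
        rw [coverMarginal, Finset.sdiff_empty]
        exact hc_sum _ _ _
      have h0 : ∀ n, ((S.pow n).prob fun u y => ¬(S.pow n).coverMarginal k ∅ u (y k) ≤
          S.coverThreshold r n k ∅ * ∏ j ∈ ∅, (S.pow n).q j u) = 0 := by
        intro n
        refine Finset.sum_eq_zero fun y _ => Finset.sum_eq_zero fun u _ => ?_
        rw [ind_of_not (not_not.mpr (this n u y)), mul_zero]
      simp only [h0]
      exact tendsto_const_nhds
    refine S.tendsto_pow_prob hone _
      (fun u y => Real.logb 2 (S.coverMarginal k T u (y k) / ∏ j ∈ T, S.q j u))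
      (η := (∑ j ∈ T, r j - S.coverInfo k T) / 2) (by linarith [hr T hT hTne]) ?_
    intro n u y hne hE
    rw [not_le] at hE
    have hqp : ∀ t, 0 < ∏ j ∈ T, S.q j (fun i => u i t) := fun t => Finset.prod_pos fun j _ =>
      lt_of_le_of_ne (S.q_nonneg _ _) (hac _ _ j (hne t)).symm
    rw [pow_prod_q, pow_coverMarginal, ← lt_div_iff₀ (Finset.prod_pos fun t _ => hqp t),
      coverThreshold, if_neg hTne.ne_empty] at hE
    have hpos : (0 : ℝ) < 2 ^ ((n : ℝ) * ((∑ j ∈ T, r j + S.coverInfo k T) / 2)) :=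
      Real.rpow_pos_of_pos two_pos _
    have hcne : ∏ t, S.coverMarginal k T (fun j => u j t) (y k t) ≠ 0 := by
      intro h
      rw [h, zero_div] at hE
      exact lt_asymm hE hpos
    have hlog := Real.logb_le_logb_of_le one_lt_two hpos hE.le
    rw [logb_prod_div _ _ (fun t => Finset.prod_ne_zero_iff.mp hcne t (Finset.mem_univ t))
      (fun t => (hqp t).ne'), Real.logb_rpow two_pos (by norm_num)] at hlog
    rw [Finset.sum_sub_distrib, Finset.sum_const, Finset.card_univ, Fintype.card_fin, nsmul_eq_mul]
    rw [le_abs]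
    left
    change _ ≤ (_ - n * S.coverInfo k T)
    linarith
  refine tendsto_of_tendsto_of_tendsto_of_le_of_le tendsto_const_nhds h1
    (fun n => (S.pow n).prob_nonneg _) fun n => ?_
  refine le_trans ((S.pow n).prob_mono fun u y h => ?_) ((S.pow n).prob_exists_le _ _)
  simp only [Good, not_forall] at h
  obtain ⟨T, hT, h⟩ := h
  exact ⟨T, hT, h⟩

/-- The number of indices of rate `r`. -/
noncomputable def indexCount (n : ℕ) (j : J) : ℕ := ⌈(2 : ℝ) ^ ((n : ℝ) * r j)⌉₊

theorem le_indexCount (n : ℕ) (j : J) : (2 : ℝ) ^ ((n : ℝ) * r j) ≤ indexCount r n j :=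
  Nat.le_ceil _

theorem indexCount_le (hr : ∀ j, 0 ≤ r j) (n : ℕ) (j : J) :
    (indexCount r n j : ℝ) ≤ 2 * (2 : ℝ) ^ ((n : ℝ) * r j) := by
  have h1 : (1 : ℝ) ≤ 2 ^ ((n : ℝ) * r j) :=
    Real.one_le_rpow one_le_two (mul_nonneg (Nat.cast_nonneg n) (hr j))
  have h2 := Nat.ceil_lt_add_one (le_trans zero_le_one h1)
  rw [indexCount]
  linarith

theorem indexCount_pos (n : ℕ) (j : J) : 0 < indexCount r n j :=
  Nat.ceil_pos.mpr (Real.rpow_pos_of_pos two_pos _)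

theorem prod_two_rpow (n : ℕ) (T : Finset J) :
    ∏ j ∈ T, (2 : ℝ) ^ ((n : ℝ) * r j) = 2 ^ ((n : ℝ) * ∑ j ∈ T, r j) := by
  rw [Finset.mul_sum, Real.rpow_sum_of_pos two_pos]

theorem tendsto_two_rpow_nat_mul {a : ℝ} (ha : a < 0) :
    Tendsto (fun n : ℕ => (2 : ℝ) ^ ((n : ℝ) * a)) atTop (𝓝 0) := by
  have h : ∀ n : ℕ, (2 : ℝ) ^ ((n : ℝ) * a) = (2 ^ a) ^ n := fun n => by
    rw [mul_comm, Real.rpow_mul two_pos.le, Real.rpow_natCast]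
  simp only [h]
  exact tendsto_pow_atTop_nhds_zero_of_lt_one (Real.rpow_nonneg two_pos.le _)
    (Real.rpow_lt_one_of_one_lt_of_neg one_lt_two ha)

theorem tendsto_decode_count (hr0 : ∀ j, 0 ≤ r j) (k : Fin N) (T : Finset J)
    (hr : ∑ j ∈ T, r j < S.decodeInfo κ k T) :
    Tendsto (fun n => (∏ j ∈ T, (Fintype.card (Fin (indexCount r n j)) : ℝ)) *
      (S.decodeThreshold κ r n k T)⁻¹) atTop (𝓝 0) := by
  -- The factor `2 ^ T.card` pays for rounding the numbers of indices up; the exponent is the rate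
  -- minus the midpoint.
  have h1 := (tendsto_two_rpow_nat_mul (a := (∑ j ∈ T, r j - S.decodeInfo κ k T) / 2)
    (by linarith)).const_mul ((2 : ℝ) ^ T.card)
  rw [mul_zero] at h1
  refine tendsto_of_tendsto_of_tendsto_of_le_of_le tendsto_const_nhds h1 (fun n => ?_) fun n => ?_
  · exact mul_nonneg (Finset.prod_nonneg fun _ _ => Nat.cast_nonneg _)
      (inv_nonneg.mpr (Real.rpow_nonneg two_pos.le _))
  · simp only [Fintype.card_fin]
    have h2 : ∏ j ∈ T, (indexCount r n j : ℝ) ≤ 2 ^ T.card * 2 ^ ((n : ℝ) * ∑ j ∈ T, r j) := by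
      rw [← prod_two_rpow, ← Finset.prod_const, ← Finset.prod_mul_distrib]
      exact Finset.prod_le_prod (fun _ _ => Nat.cast_nonneg _) fun j _ => indexCount_le r hr0 n j
    have h3 : 0 ≤ (S.decodeThreshold κ r n k T)⁻¹ :=
      inv_nonneg.mpr (Real.rpow_nonneg two_pos.le _)
    refine (mul_le_mul_of_nonneg_right h2 h3).trans ?_
    rw [decodeThreshold, ← Real.rpow_neg two_pos.le, mul_assoc, ← Real.rpow_add two_pos]
    refine le_of_eq ?_
    congr 2
    ring

theorem tendsto_cover_count (k : Fin N) (T : Finset J)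
    (hr : T.Nonempty → S.coverInfo k T < ∑ j ∈ T, r j) :
    Tendsto (fun n => S.coverThreshold r n k T /
      ∏ j ∈ T, (Fintype.card (Fin (indexCount r n j)) : ℝ)) atTop (𝓝 (if T = ∅ then 1 else 0)) := by
  rcases T.eq_empty_or_nonempty with rfl | hT
  · simp [coverThreshold]
  simp only [coverThreshold, if_neg hT.ne_empty]
  have h1 := tendsto_two_rpow_nat_mul (a := (S.coverInfo k T - ∑ j ∈ T, r j) / 2)
    (by linarith [hr hT])
  refine tendsto_of_tendsto_of_tendsto_of_le_of_le tendsto_const_nhds h1 (fun n => ?_) fun n => ?_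
  · exact div_nonneg (Real.rpow_nonneg two_pos.le _)
      (Finset.prod_nonneg fun _ _ => Nat.cast_nonneg _)
  · simp only [Fintype.card_fin]
    rw [div_le_iff₀ (Finset.prod_pos fun j _ => Nat.cast_pos.mpr (indexCount_pos r n j))]
    have h2 : (2 : ℝ) ^ ((n : ℝ) * ∑ j ∈ T, r j) ≤ ∏ j ∈ T, (indexCount r n j : ℝ) := by
      rw [← prod_two_rpow]
      exact Finset.prod_le_prod (fun _ _ => Real.rpow_nonneg two_pos.le _)
        fun j _ => le_indexCount r n j
    refine le_trans (le_of_eq ?_) (mul_le_mul_of_nonneg_left h2 (Real.rpow_nonneg two_pos.le _))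
    rw [← Real.rpow_add two_pos]
    congr 1
    ring

include hone hac in
/-- Achievability for a scheme whose rates satisfy the single-letter conditions. -/
theorem exists_nodes_tendsto
    (hκ_nonneg : ∀ k, ∀ T ∈ S.decodeFamily k, ∀ u b, 0 ≤ κ k T u b)
    (hκ_congr : ∀ k T, T ∈ S.decodeFamily k → ∀ u v b, (∀ j ∈ S.V k, u j = v j) →
      κ k T u b = κ k T v b)
    (hκ_sum : ∀ k, ∀ T ∈ S.decodeFamily k, ∀ u b, ∑ u' ∈ fiber T u, κ k T u' b ≤ 1)
    (hκ_ne : ∀ k, ∀ T ∈ S.decodeFamily k, ∀ u y, S.joint u y ≠ 0 → κ k T u (y k) ≠ 0)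
    (hc_sum : ∀ k u b, ∑ u' ∈ fiber (S.W k) u, S.c k u' b ≤ 1)
    (hr0 : ∀ j, 0 ≤ r j)
    (hdec : ∀ k, ∀ T ∈ S.decodeFamily k, ∑ j ∈ T, r j < S.decodeInfo κ k T)
    (hcov : ∀ k, ∀ T ∈ S.coverFamily k, T.Nonempty → S.coverInfo k T < ∑ j ∈ T, r j)
    (ok : ∀ n, (∀ k, Fin n → X k) → (∀ k, Fin n → Y k) → Prop)
    (hok : Tendsto (fun n => (S.pow n).prob fun u y => ¬ok n ((S.pow n).inputs u y) y) atTop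
      (𝓝 0)) :
    ∃ f : ∀ n, ∀ k, (Fin n → Y k) → (Fin n → X k),
      Tendsto (fun n => ∑ y, (∏ k, (S.pow n).chan k (fun k => f n k (y k)) y) *
        ind (¬ok n (fun k => f n k (y k)) y)) atTop (𝓝 0) := by
  have hUY : Nonempty ((∀ j, U j) × (∀ k, Y k)) := by
    have h : ∃ w ∈ (Finset.univ : Finset ((∀ j, U j) × (∀ k, Y k))), S.jointPair w ≠ 0 :=
      Finset.exists_ne_zero_of_sum_ne_zero (ne_of_eq_of_ne (S.isPmf_jointPair hone).2 one_ne_zero)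
    exact ⟨h.choose⟩
  obtain ⟨u₀, y₀⟩ := hUY.some
  have honen : ∀ n, ∑ y, ∑ u, (S.pow n).joint u y = 1 := by
    intro n
    have h := S.pow_prob n fun _ _ => True
    simp only [prob, ind_of trivial, mul_one] at h
    rw [h]
    exact sum_prod_pow n (S.isPmf_jointPair hone)
  have hacn : ∀ n u y j, (S.pow n).joint u y ≠ 0 → (S.pow n).q j u ≠ 0 := by
    intro n u y j h
    rw [pow_joint, Finset.prod_ne_zero_iff] at h
    exact Finset.prod_ne_zero_iff.mpr fun t ht => hac _ _ j (h t ht)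
  have key := fun n => (S.pow n).exists_nodes (I := fun j => Fin (indexCount r n j))
    (fun j => ⟨0, indexCount_pos r n j⟩) (powLikelihood κ n) (S.decodeThreshold κ r n)
    (S.coverThreshold r n) (ok n) (hacn n) (honen n)
    (fun k T hT u b => Finset.prod_nonneg fun t _ => hκ_nonneg k T hT _ _)
    (fun k T hT u v b h => Finset.prod_congr rfl fun t _ =>
      hκ_congr k T hT _ _ _ fun j hj => by rw [h j hj])
    (fun k T hT u b => by
      have h := sum_fiber_prod_time T u fun t v => κ k T v (b t)
      simp only [powLikelihood]
      rw [h]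
      exact Finset.prod_le_one (fun t _ => Finset.sum_nonneg fun _ _ => hκ_nonneg k T hT _ _)
        fun t _ => hκ_sum k T hT _ _)
    (fun k T _ => Real.rpow_pos_of_pos two_pos _)
    (fun k T _ => by
      rw [coverThreshold]
      split_ifs
      · exact zero_le_one
      · exact Real.rpow_nonneg two_pos.le _)
    ⟨fun j _ => u₀ j⟩ ⟨fun k _ => y₀ k⟩
  choose f hf using key
  refine ⟨f, ?_⟩
  have hfail : Tendsto (fun n => (S.pow n).failBound (powLikelihood κ n) (S.decodeThreshold κ r n)
      (S.coverThreshold r n) (ok n) fun j => Fin (indexCount r n j)) atTop (𝓝 0) := by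
    have h : (0 : ℝ) = 0 + ∑ k : Fin N, (0 + 0 + ∑ T ∈ S.decodeFamily k, 0) := by simp
    rw [h]
    refine hok.add (tendsto_finsetSum _ fun k _ => ?_)
    refine ((S.tendsto_prob_not_passes hone κ r hac hκ_nonneg hκ_ne k (hdec k)).add
      (S.tendsto_prob_not_good hone r hac hc_sum k (hcov k))).add
      (tendsto_finsetSum _ fun T hT => S.tendsto_decode_count κ r hr0 k T (hdec k T hT))
  have hcover : Tendsto (fun n => ∑ k, (S.pow n).coverBound (S.coverThreshold r n)
      (fun j => Fin (indexCount r n j)) k) atTop (𝓝 N) := by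
    -- Each node contributes exactly `1`, from `T = ∅`; this cancels the `- N` in the one-shot
    -- bound.
    have h : (N : ℝ) = ∑ k : Fin N, ∑ T ∈ S.coverFamily k, if T = ∅ then 1 else 0 := by
      have : ∀ k, ∅ ∈ S.coverFamily k := fun k => by simp [coverFamily]
      simp [this]
    rw [h]
    exact tendsto_finsetSum _ fun k _ => tendsto_finsetSum _ fun T hT =>
      S.tendsto_cover_count r k T (hcov k T hT)
  have hbound := (hfail.const_mul (1 + (N : ℝ))).add (hcover.sub_const (N : ℝ))
  rw [mul_zero, sub_self, add_zero] at hbound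
  refine tendsto_of_tendsto_of_tendsto_of_le_of_le tendsto_const_nhds hbound (fun n => ?_) hf
  exact Finset.sum_nonneg fun y _ => mul_nonneg
    (Finset.prod_nonneg fun k _ => (S.pow n).chan_nonneg _ _ _) (ind_nonneg _)

end Scheme

/-! ### Marginals, Gibbs' inequality and mutual information -/

section Mass

variable {Ω : Type*} [Fintype Ω] {J : Type*} [Fintype J] [DecidableEq J] {U : J → Type*}
  [∀ j, Fintype (U j)] {β : Type*} (P : Ω → ℝ) (ξ : Ω → ∀ j, U j) (η : Ω → β)

/-- The probability that `ξ` agrees with `u` on `V` and `η = b`. -/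
noncomputable def mass (V : Finset J) (u : ∀ j, U j) (b : β) : ℝ :=
  ∑ w, P w * ind ((∀ j ∈ V, ξ w j = u j) ∧ η w = b)

variable {P}

omit [Fintype J] [DecidableEq J] [∀ j, Fintype (U j)] in
theorem mass_congr {V : Finset J} {u v : ∀ j, U j} (h : ∀ j ∈ V, u j = v j) (b : β) :
    mass P ξ η V u b = mass P ξ η V v b := by
  refine Finset.sum_congr rfl fun w _ => ?_
  congr 2
  rw [eq_iff_iff]
  refine and_congr_left fun _ => forall₂_congr fun j hj => ?_
  rw [h j hj]

omit [Fintype J] [DecidableEq J] [∀ j, Fintype (U j)] in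
theorem mass_nonneg (hP : ∀ w, 0 ≤ P w) (V : Finset J) (u : ∀ j, U j) (b : β) :
    0 ≤ mass P ξ η V u b :=
  Finset.sum_nonneg fun w _ => mul_nonneg (hP w) (ind_nonneg _)

omit [Fintype J] [DecidableEq J] [∀ j, Fintype (U j)] in
theorem le_mass (hP : ∀ w, 0 ≤ P w) (V : Finset J) (w : Ω) :
    P w ≤ mass P ξ η V (ξ w) (η w) := by
  refine le_of_eq_of_le ?_ (Finset.single_le_sum (f := fun w' => P w' *
    ind ((∀ j ∈ V, ξ w' j = ξ w j) ∧ η w' = η w))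
    (fun w' _ => mul_nonneg (hP w') (ind_nonneg _)) (Finset.mem_univ w))
  rw [ind_of ⟨fun _ _ => rfl, rfl⟩, mul_one]

omit [Fintype J] [DecidableEq J] [∀ j, Fintype (U j)] in
theorem mass_pos (hP : ∀ w, 0 ≤ P w) (V : Finset J) {w : Ω} (hw : P w ≠ 0) :
    0 < mass P ξ η V (ξ w) (η w) :=
  lt_of_lt_of_le (lt_of_le_of_ne (hP w) hw.symm) (le_mass ξ η hP V w)

theorem sum_fiber_mass {T V : Finset J} (hT : T ⊆ V) (u : ∀ j, U j) (b : β) :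
    ∑ u' ∈ fiber T u, mass P ξ η V u' b = mass P ξ η (V \ T) u b := by
  simp only [mass]
  rw [Finset.sum_comm]
  refine Finset.sum_congr rfl fun w _ => ?_
  rw [← Finset.mul_sum]
  congr 1
  rw [Finset.sum_eq_single (T.piecewise (ξ w) u)]
  · congr 1
    rw [eq_iff_iff]
    refine and_congr_left fun _ => ⟨fun h j hj => ?_, fun h j hj => ?_⟩
    · have := h j (Finset.mem_sdiff.mp hj).1
      rwa [Finset.piecewise_eq_of_notMem _ _ _ (Finset.mem_sdiff.mp hj).2] at this
    · by_cases hjT : j ∈ T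
      · simp [hjT]
      · rw [Finset.piecewise_eq_of_notMem _ _ _ hjT]
        exact h j (Finset.mem_sdiff.mpr ⟨hj, hjT⟩)
  · intro u' hu' hne
    refine ind_of_not fun h => hne (funext fun j => ?_)
    by_cases hjT : j ∈ T
    · simp [hjT, h.1 j (hT hjT)]
    · simp [hjT, mem_fiber.mp hu' j hjT]
  · intro h
    exact absurd (mem_fiber.mpr fun j hj => by simp [hj]) h

/-- The conditional pmf of the components `T` of `ξ`, given the other components in `V` and `η`. -/
noncomputable def condMass (P : Ω → ℝ) (ξ : Ω → ∀ j, U j) (η : Ω → β) (V T : Finset J)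
    (u : ∀ j, U j) (b : β) : ℝ :=
  mass P ξ η V u b / mass P ξ η (V \ T) u b

omit [Fintype J] [∀ j, Fintype (U j)] in
theorem condMass_nonneg (hP : ∀ w, 0 ≤ P w) (V T : Finset J) (u : ∀ j, U j) (b : β) :
    0 ≤ condMass P ξ η V T u b :=
  div_nonneg (mass_nonneg ξ η hP _ _ _) (mass_nonneg ξ η hP _ _ _)

omit [Fintype J] [∀ j, Fintype (U j)] in
theorem condMass_pos (hP : ∀ w, 0 ≤ P w) (V T : Finset J) {w : Ω} (hw : P w ≠ 0) :
    0 < condMass P ξ η V T (ξ w) (η w) :=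
  div_pos (mass_pos ξ η hP V hw) (mass_pos ξ η hP (V \ T) hw)

omit [Fintype J] [∀ j, Fintype (U j)] in
theorem condMass_congr {V : Finset J} (T : Finset J) {u v : ∀ j, U j} (h : ∀ j ∈ V, u j = v j)
    (b : β) : condMass P ξ η V T u b = condMass P ξ η V T v b := by
  rw [condMass, condMass, mass_congr ξ η h,
    mass_congr ξ η fun j hj => h j (Finset.sdiff_subset hj)]

theorem sum_fiber_condMass {T V : Finset J} (hT : T ⊆ V) (u : ∀ j, U j) (b : β) :
    ∑ u' ∈ fiber T u, condMass P ξ η V T u' b =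
      mass P ξ η (V \ T) u b / mass P ξ η (V \ T) u b := by
  rw [← sum_fiber_mass ξ η hT u b, Finset.sum_div]
  refine Finset.sum_congr rfl fun u' hu' => ?_
  rw [condMass, sum_fiber_mass ξ η hT u b]
  congr 1
  exact mass_congr ξ η (fun j hj => mem_fiber.mp hu' j (Finset.mem_sdiff.mp hj).2) b

theorem sum_fiber_condMass_le_one {T V : Finset J} (hT : T ⊆ V) (u : ∀ j, U j) (b : β) :
    ∑ u' ∈ fiber T u, condMass P ξ η V T u' b ≤ 1 := by
  rw [sum_fiber_condMass ξ η hT]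
  exact div_self_le_one _

/-- A version of the conditional pmf of the component `j` of `ξ` given the components `A`. -/
noncomputable def codePmf (P : Ω → ℝ) (ξ : Ω → ∀ j, U j) (A : Finset J) (j : J)
    (u : ∀ j, U j) : ℝ :=
  if mass P ξ (fun _ => ()) A u () = 0 then (Fintype.card (U j) : ℝ)⁻¹
  else mass P ξ (fun _ => ()) (insert j A) u () / mass P ξ (fun _ => ()) A u ()

omit [Fintype J] in
theorem codePmf_nonneg (hP : ∀ w, 0 ≤ P w) (A : Finset J) (j : J) (u : ∀ j, U j) :
    0 ≤ codePmf P ξ A j u := by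
  rw [codePmf]
  split_ifs
  · positivity
  · exact div_nonneg (mass_nonneg ξ _ hP _ _ _) (mass_nonneg ξ _ hP _ _ _)

omit [Fintype J] in
theorem codePmf_congr {A : Finset J} {j : J} {u v : ∀ j, U j} (h : ∀ i ∈ insert j A, u i = v i) :
    codePmf P ξ A j u = codePmf P ξ A j v := by
  rw [codePmf, codePmf, mass_congr ξ _ h,
    mass_congr ξ _ fun i hi => h i (Finset.mem_insert_of_mem hi)]

/-- The uniform law used where the conditioning event has probability zero makes this hold for every
`u`, as a random codebook requires. -/
theorem sum_codePmf {A : Finset J} {j : J} (hj : j ∉ A) (u : ∀ j, U j) :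
    ∑ a, codePmf P ξ A j (Function.update u j a) = 1 := by
  have hA : ∀ a, mass P ξ (fun _ => ()) A (Function.update u j a) () =
      mass P ξ (fun _ => ()) A u () := fun a => mass_congr ξ _ (fun i hi => by
    rw [Function.update_of_ne]
    rintro rfl
    exact hj hi) ()
  simp only [codePmf, hA]
  by_cases h0 : mass P ξ (fun _ => ()) A u () = 0
  · simp only [h0, if_true, Finset.sum_const, Finset.card_univ, nsmul_eq_mul]
    exact mul_inv_cancel₀ (Nat.cast_ne_zero.mpr (Fintype.card_pos_iff.mpr ⟨u j⟩).ne')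
  · simp only [h0, if_false]
    rw [← Finset.sum_div, div_eq_one_iff_eq h0]
    have := sum_fiber_mass (P := P) ξ (fun _ => ()) (T := {j}) (V := insert j A) (by simp) u ()
    rw [← insert_empty_eq, sum_fiber_insert _ (Finset.notMem_empty j), fiber_empty,
      Finset.sum_singleton] at this
    rw [this]
    congr 1
    ext i
    by_cases hi : i = j
    · subst hi
      simp [hj]
    · simp [hi]

omit [Fintype J] in
theorem codePmf_eq (hP : ∀ w, 0 ≤ P w) (A : Finset J) (j : J) {w : Ω} (hw : P w ≠ 0) :
    codePmf P ξ A j (ξ w) =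
      mass P ξ (fun _ => ()) (insert j A) (ξ w) () / mass P ξ (fun _ => ()) A (ξ w) () :=
  if_neg (mass_pos ξ (fun _ => ()) hP A hw).ne'

omit [Fintype J] in
theorem codePmf_pos (hP : ∀ w, 0 ≤ P w) (A : Finset J) (j : J) {w : Ω} (hw : P w ≠ 0) :
    0 < codePmf P ξ A j (ξ w) := by
  rw [codePmf_eq ξ hP A j hw]
  exact div_pos (mass_pos ξ (fun _ => ()) hP _ hw) (mass_pos ξ (fun _ => ()) hP _ hw)

/-- Writing the mass on `K` as a sum over a second sample `w'`, and grouping `w` by its components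
in `T`, cancels the mass on `K ∪ T`. What remains for each `w'` is a sum of `g` over a fiber. -/
theorem sum_mul_ratio_le_one (hP : IsPmf P) {K T : Finset J}
    (g : (∀ j, U j) → β → ℝ) (hg0 : ∀ u b, 0 ≤ g u b)
    (hg : ∀ u v b, (∀ j ∈ K ∪ T, u j = v j) → g u b = g v b)
    (hgs : ∀ u b, ∑ u' ∈ fiber T u, g u' b ≤ 1) :
    ∑ w, P w * (g (ξ w) (η w) * (mass P ξ η K (ξ w) (η w) / mass P ξ η (K ∪ T) (ξ w) (η w))) ≤
      1 := by
  have hm0 := fun u b => mass_nonneg ξ η hP.1 (K ∪ T) u b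
  calc _ = ∑ w', P w' * ∑ w, ind ((∀ j ∈ K, ξ w' j = ξ w j) ∧ η w' = η w) *
        (P w * (g (ξ w) (η w) / mass P ξ η (K ∪ T) (ξ w) (η w))) := by
        simp only [mass, Finset.mul_sum, Finset.sum_div]
        rw [Finset.sum_comm]
        refine Finset.sum_congr rfl fun w' _ => Finset.sum_congr rfl fun w _ => ?_
        ring
    _ ≤ ∑ w', P w' * 1 := by
        refine Finset.sum_le_sum fun w' _ => mul_le_mul_of_nonneg_left ?_ (hP.1 w')
        calc _ ≤ ∑ w, (∑ u' ∈ fiber T (ξ w'),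
              ind ((∀ j ∈ K ∪ T, ξ w j = u' j) ∧ η w = η w')) *
              (P w * (g (ξ w) (η w) / mass P ξ η (K ∪ T) (ξ w) (η w))) := by
              refine Finset.sum_le_sum fun w _ => mul_le_mul_of_nonneg_right ?_
                (mul_nonneg (hP.1 w) (div_nonneg (hg0 _ _) (hm0 _ _)))
              refine le_trans (ind_mono fun h => ?_) (ind_exists_le_sum _ _)
              refine ⟨T.piecewise (ξ w) (ξ w'), mem_fiber.mpr fun i hi => by simp [hi],
                fun j hj => ?_, h.2.symm⟩
              by_cases hjT : j ∈ T
              · simp [hjT]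
              · simp [hjT, h.1 j ((Finset.mem_union.mp hj).resolve_right hjT)]
          _ = ∑ u' ∈ fiber T (ξ w'), (g u' (η w') / mass P ξ η (K ∪ T) u' (η w')) *
              mass P ξ η (K ∪ T) u' (η w') := by
              simp only [Finset.sum_mul]
              rw [Finset.sum_comm]
              refine Finset.sum_congr rfl fun u' _ => ?_
              conv_rhs => enter [2]; rw [mass]
              rw [Finset.mul_sum]
              refine Finset.sum_congr rfl fun w _ => ?_
              by_cases h : (∀ j ∈ K ∪ T, ξ w j = u' j) ∧ η w = η w'
              · rw [ind_of h, hg _ _ _ h.1, mass_congr ξ η h.1, h.2]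
                ring
              · rw [ind_of_not h]
                ring
          _ ≤ ∑ u' ∈ fiber T (ξ w'), g u' (η w') := by
              refine Finset.sum_le_sum fun u' _ => ?_
              by_cases h : mass P ξ η (K ∪ T) u' (η w') = 0
              · rw [h, mul_zero]
                exact hg0 _ _
              · rw [div_mul_cancel₀ _ h]
          _ ≤ 1 := hgs _ _
    _ = 1 := by simp [hP.2]

/-- Gibbs' inequality: the conditional pmf maximizes the expected logarithm. -/
theorem sum_logb_le_sum_logb_condMass (hP : IsPmf P) {K T : Finset J} (hKT : Disjoint K T)
    (g : (∀ j, U j) → β → ℝ) (hg0 : ∀ u b, 0 ≤ g u b)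
    (hg : ∀ u v b, (∀ j ∈ K ∪ T, u j = v j) → g u b = g v b)
    (hgs : ∀ u b, ∑ u' ∈ fiber T u, g u' b ≤ 1)
    (hgP : ∀ w, P w ≠ 0 → g (ξ w) (η w) ≠ 0)
    (Q : (∀ j, U j) → ℝ) (hQ : ∀ w, P w ≠ 0 → Q (ξ w) ≠ 0) :
    ∑ w, P w * Real.logb 2 (g (ξ w) (η w) / Q (ξ w)) ≤
      ∑ w, P w * Real.logb 2 (condMass P ξ η (K ∪ T) T (ξ w) (η w) / Q (ξ w)) := by
  have hK : (K ∪ T) \ T = K := by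
    rw [Finset.union_sdiff_right, Finset.sdiff_eq_self_of_disjoint hKT]
  rw [← sub_nonpos, ← Finset.sum_sub_distrib]
  have hlog2 : 0 < Real.log 2 := Real.log_pos one_lt_two
  calc _ ≤ ∑ w, P w * ((g (ξ w) (η w) * (mass P ξ η K (ξ w) (η w) /
        mass P ξ η (K ∪ T) (ξ w) (η w)) - 1) / Real.log 2) := by
        refine Finset.sum_le_sum fun w _ => ?_
        by_cases hw : P w = 0
        · simp [hw]
        rw [← mul_sub]
        refine mul_le_mul_of_nonneg_left ?_ (hP.1 w)
        have h1 := mass_pos ξ η hP.1 (K ∪ T) hw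
        have h2 := mass_pos ξ η hP.1 K hw
        have h3 : 0 < g (ξ w) (η w) := lt_of_le_of_ne (hg0 _ _) (hgP w hw).symm
        rw [Real.logb_div h3.ne' (hQ w hw), Real.logb_div (condMass_pos ξ η hP.1 _ _ hw).ne'
          (hQ w hw), sub_sub_sub_cancel_right, condMass, hK,
          ← Real.logb_div h3.ne' (div_pos h1 h2).ne', Real.logb]
        refine div_le_div_of_nonneg_right ?_ hlog2.le
        refine le_trans (Real.log_le_sub_one_of_pos (div_pos h3 (div_pos h1 h2))) (le_of_eq ?_)
        rw [div_div_eq_mul_div, mul_div_assoc]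
    _ = ((∑ w, P w * (g (ξ w) (η w) * (mass P ξ η K (ξ w) (η w) /
        mass P ξ η (K ∪ T) (ξ w) (η w)))) - 1) / Real.log 2 := by
        rw [← hP.2, ← Finset.sum_sub_distrib, Finset.sum_div]
        refine Finset.sum_congr rfl fun w _ => ?_
        rw [hP.2]
        ring
    _ ≤ 0 := by
        refine div_nonpos_of_nonpos_of_nonneg (sub_nonpos.mpr ?_) hlog2.le
        exact sum_mul_ratio_le_one ξ η hP g hg0 hg hgs

end Mass

/-- A telescoping sum over the initial segments of a set `T`. -/
theorem sum_filter_lt_telescope {J : Type*} [LinearOrder J] (F : Finset J → ℝ) (K T : Finset J) :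
    ∑ j ∈ T, (F (insert j (T.filter (· < j) ∪ K)) - F (T.filter (· < j) ∪ K)) =
      F (T ∪ K) - F K := by
  induction T using Finset.induction_on_max with
  | empty => simp
  | insert a T hmax ih =>
    have ha : a ∉ T := fun h => lt_irrefl _ (hmax a h)
    rw [Finset.sum_insert ha]
    have h1 : (insert a T).filter (· < a) = T := by
      rw [Finset.filter_insert, if_neg (lt_irrefl a)]
      exact Finset.filter_true_of_mem hmax
    have h2 : ∀ j ∈ T, (insert a T).filter (· < j) = T.filter (· < j) := fun j hj => by
      rw [Finset.filter_insert, if_neg (not_lt.mpr (hmax j hj).le)]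
    rw [h1, Finset.sum_congr rfl fun j hj => by rw [h2 j hj], ih, Finset.insert_union]
    ring

/-- The chain rule before taking expectations: the masses on growing initial segments of `T`
telescope, and the remaining terms are the logarithms of the codeword pmfs. -/
theorem sum_logb_mass_eq {Ω : Type*} [Fintype Ω] {J : Type*} [LinearOrder J] {U : J → Type*}
    [∀ j, Fintype (U j)] {β : Type*} {P : Ω → ℝ} (ξ : Ω → ∀ j, U j) (η : Ω → β)
    (hP : ∀ w, 0 ≤ P w) (A : J → Finset J) {K T : Finset J} (hKT : Disjoint K T) {w : Ω}
    (hw : P w ≠ 0) :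
    ∑ j ∈ T, (Real.logb 2 (mass P ξ η (insert j (T.filter (· < j) ∪ K)) (ξ w) (η w)) -
      Real.logb 2 (mass P ξ η (T.filter (· < j) ∪ K) (ξ w) (η w)) -
      (Real.logb 2 (mass P ξ (fun _ => ()) (insert j (A j)) (ξ w) ()) -
        Real.logb 2 (mass P ξ (fun _ => ()) (A j) (ξ w) ()))) =
      Real.logb 2 (condMass P ξ η (K ∪ T) T (ξ w) (η w) /
        ∏ j ∈ T, codePmf P ξ (A j) j (ξ w)) := by
  have hq : ∀ j, 0 < codePmf P ξ (A j) j (ξ w) := fun j => codePmf_pos ξ hP _ _ hw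
  have hm := fun V => mass_pos ξ η hP V hw
  have hm' := fun V => mass_pos ξ (fun _ => ()) hP V hw
  rw [Finset.sum_sub_distrib,
    sum_filter_lt_telescope fun V => Real.logb 2 (mass P ξ η V (ξ w) (η w)),
    Real.logb_div (condMass_pos ξ η hP _ _ hw).ne' (Finset.prod_pos fun j _ => hq j).ne',
    Real.logb_prod _ _ fun j _ => (hq j).ne']
  congr 1
  · rw [condMass, Real.logb_div (hm _).ne' (hm _).ne', Finset.union_comm,
      Finset.union_sdiff_right, Finset.sdiff_eq_self_of_disjoint hKT]
  · refine Finset.sum_congr rfl fun j _ => ?_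
    rw [codePmf_eq ξ hP _ _ hw, Real.logb_div (hm' _).ne' (hm' _).ne']

/-! ### Entropy through the equality relation of a random variable -/

section Entropy

variable {Ω₀ Ω : Type*} [Fintype Ω₀] [Fintype Ω] {p : Ω₀ → ℝ} {P : Ω → ℝ} {π : Ω₀ → Ω}

/-- The entropy in terms of the equality relation of the random variable, after a push-forward. -/
theorem entropy_eq_neg_sum {α : Type*} [Fintype α]
    (hπ : ∀ F : Ω → ℝ, ∑ s, p s * F (π s) = ∑ w, P w * F w)
    (V : Ω₀ → α) (R : Ω → Ω → Prop) (hR : ∀ s s', V s = V s' ↔ R (π s) (π s')) :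
    entropy p V = -∑ w, P w * Real.logb 2 (∑ w', P w' * ind (R w' w)) := by
  classical
  have h1 : ∀ s, lawOf p V (V s) = ∑ w', P w' * ind (R w' (π s)) := by
    intro s
    rw [lawOf, ← hπ fun w' => ind (R w' (π s))]
    refine Finset.sum_congr rfl fun s' _ => ?_
    by_cases h : V s' = V s
    · rw [if_pos h, ind_of ((hR _ _).mp h), mul_one]
    · rw [if_neg h, ind_of_not fun h' => h ((hR _ _).mpr h'), mul_zero]
  rw [entropy, ← hπ fun w => Real.logb 2 (∑ w', P w' * ind (R w' w))]
  congr 1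
  have h2 : ∀ a, lawOf p V a * Real.logb 2 (lawOf p V a) =
      ∑ s, if V s = a then p s * Real.logb 2 (lawOf p V a) else 0 := by
    intro a
    conv_lhs => rw [lawOf, Finset.sum_mul]
    refine Finset.sum_congr rfl fun s _ => ?_
    split_ifs with h
    · rfl
    · rw [zero_mul]
  rw [Finset.sum_congr rfl fun a _ => h2 a, Finset.sum_comm]
  refine Finset.sum_congr rfl fun s _ => ?_
  rw [Finset.sum_ite_eq, if_pos (Finset.mem_univ _), h1]

end Entropy

/-! ### The scheme given by the coding parameters -/

namespace CodingParameters

variable {N : ℕ} {X Y : Fin N → Type*} [∀ k, Fintype (X k)] [∀ k, Fintype (Y k)] {μ : ℕ}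
  (ω : CodingParameters N X Y μ μ) (net : ADMN N X Y)

/-- The used codebooks in `S`. -/
def usedPart (S : Finset (Fin μ)) : Finset ω.used := Finset.univ.filter fun j => j.1 ∈ S

theorem mem_usedPart {S : Finset (Fin μ)} {j : ω.used} : j ∈ ω.usedPart S ↔ j.1 ∈ S := by
  simp [usedPart]

/-- The components `u_{D_k}`. -/
def restrictD (k : Fin N) (u : (j : ω.used) → ω.U j) : (j : ω.D k) → ω.U j :=
  fun j => u ⟨j, ω.D_subset_used k j.2⟩

/-- The components `u_{W_k}`. -/
def restrictW (k : Fin N) (u : (j : ω.used) → ω.U j) : (j : ω.W k) → ω.U j :=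
  fun j => u ⟨j, ω.W_subset_used k j.2⟩

theorem restrictD_congr (k : Fin N) {u v : (j : ω.used) → ω.U j}
    (h : ∀ i ∈ ω.usedPart (ω.D k), u i = v i) : ω.restrictD k u = ω.restrictD k v :=
  funext fun j => h _ (ω.mem_usedPart.mpr j.2)

theorem restrictW_congr (k : Fin N) {u v : (j : ω.used) → ω.U j}
    (h : ∀ i ∈ ω.usedPart (ω.W k), u i = v i) : ω.restrictW k u = ω.restrictW k v :=
  funext fun j => h _ (ω.mem_usedPart.mpr j.2)

/-- The compression kernel as a function of all codewords. -/
def kernel (k : Fin N) (u : (j : ω.used) → ω.U j) (b : Y k) : ℝ :=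
  ω.compress k (ω.restrictD k u) b (ω.restrictW k u)

/-- The symbol map as a function of all codewords. -/
def symbol (k : Fin N) (u : (j : ω.used) → ω.U j) (b : Y k) : X k :=
  ω.symbolMap k (ω.restrictD k u) (ω.restrictW k u) b

/-- The joint pmf of `(u, y)`. -/
def pairPmf (w : ((j : ω.used) → ω.U j) × (∀ k, Y k)) : ℝ :=
  ∏ k, net.chan k (fun i => ω.symbol i w.1 (w.2 i)) (fun i => w.2 i) (w.2 k) *
    ω.kernel k w.1 (w.2 k)

theorem pairPmf_nonneg (w : ((j : ω.used) → ω.U j) × (∀ k, Y k)) : 0 ≤ ω.pairPmf net w :=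
  Finset.prod_nonneg fun _ _ => mul_nonneg ((net.chan_isPmf _ _ _).1 _)
    ((ω.compress_isPmf _ _ _).1 _)

/-- The inputs `x` are functions of `(u, y)`, so they can be summed out. -/
theorem sum_jointPmf_mul (F : ((j : ω.used) → ω.U j) × (∀ k, X k) × (∀ k, Y k) → ℝ) :
    ∑ s, ω.jointPmf net s * F s =
      ∑ w, ω.pairPmf net w * F (w.1, fun k => ω.symbol k w.1 (w.2 k), w.2) := by
  classical
  have h1 : ∀ u x y, ω.jointPmf net (u, x, y) =
      if x = fun k => ω.symbol k u (y k) then ω.pairPmf net (u, y) else 0 := by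
    intro u x y
    split_ifs with h
    · subst h
      refine Finset.prod_congr rfl fun k _ => ?_
      rw [if_pos, mul_one]
      · rfl
      · rfl
    · obtain ⟨k, hk⟩ := Function.ne_iff.mp h
      refine Finset.prod_eq_zero (Finset.mem_univ k) ?_
      rw [if_neg, mul_zero]
      exact hk
  rw [Fintype.sum_prod_type, Fintype.sum_prod_type]
  refine Finset.sum_congr rfl fun u _ => ?_
  rw [Fintype.sum_prod_type, Finset.sum_comm]
  refine Finset.sum_congr rfl fun y _ => ?_
  simp only [h1, ite_mul, zero_mul]
  rw [Finset.sum_ite_eq', if_pos (Finset.mem_univ _)]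

/-- The inclusion of index sets gives this up to the element `j` itself, which the ordering of
superposed codebooks excludes. -/
theorem A_subset (hΓ : ∀ j, ω.Γ j = {j} ∪ ω.A j) {i j : Fin μ} (hi : i ∈ ω.A j) :
    ω.A i ⊆ ω.A j := by
  intro m hm
  have h1 : m ∈ ω.Γ j := ω.index_superposition j (Finset.mem_biUnion.mpr ⟨i, hi, by
    rw [hΓ]; exact Finset.mem_union_right _ hm⟩)
  rw [hΓ] at h1
  rcases Finset.mem_union.mp h1 with h | h
  · rw [Finset.mem_singleton] at h
    subst h
    exact absurd (ω.superposition_lt _ _ hi) (ω.superposition_lt _ _ hm).asymm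
  · exact h

theorem A_subset_used (j : ω.used) : ω.A j ⊆ ω.used := by
  obtain ⟨k, -, hk⟩ := Finset.mem_biUnion.mp j.2
  have h : ω.A j ⊆ ω.W k ∪ ω.D k :=
    (Finset.subset_biUnion_of_mem ω.A hk).trans (ω.superposition_W k)
  exact h.trans (Finset.union_subset (ω.W_subset_used k) (ω.D_subset_used k))

theorem B_subset_used (k : Fin N) : ω.B k ⊆ ω.used :=
  (ω.B_subset k).trans (Finset.sdiff_subset.trans
    (Finset.biUnion_subset_biUnion_of_subset_left _ (Finset.subset_univ _)))

/-- The single-letter coding scheme described by the coding parameters. -/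
noncomputable def toScheme (hΓ : ∀ j, ω.Γ j = {j} ∪ ω.A j) :
    Scheme N X Y ω.used (fun j => ω.U j) where
  A j := ω.usedPart (ω.A j)
  A_lt j i hi := ω.superposition_lt j i (ω.mem_usedPart.mp hi)
  A_trans j i hi m hm := ω.mem_usedPart.mpr
    (ω.A_subset hΓ (ω.mem_usedPart.mp hi) (ω.mem_usedPart.mp hm))
  D k := ω.usedPart (ω.D k)
  V k := ω.usedPart (ω.D k ∪ ω.B k)
  W k := ω.usedPart (ω.W k)
  D_subset k j hj := ω.mem_usedPart.mpr (Finset.mem_union_left _ (ω.mem_usedPart.mp hj))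
  A_V k j hj i hi := by
    rw [mem_usedPart] at hi hj ⊢
    rcases Finset.mem_union.mp hj with h | h
    · exact Finset.mem_union_left _ (ω.superposition_D k (Finset.mem_biUnion.mpr ⟨j, h, hi⟩))
    · exact ω.superposition_B k (Finset.mem_biUnion.mpr ⟨j, h, hi⟩)
  A_D k j hj i hi := by
    rw [mem_usedPart] at hi hj ⊢
    exact ω.superposition_D k (Finset.mem_biUnion.mpr ⟨j, hj, hi⟩)
  A_W k j hj i hi := by
    rw [mem_usedPart] at hi hj
    have := ω.superposition_W k (Finset.mem_biUnion.mpr ⟨j.1, hj, hi⟩)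
    rw [Finset.mem_union, mem_usedPart, mem_usedPart]
    exact (Finset.mem_union.mp this).symm
  D_W k := by
    rw [Finset.disjoint_left]
    intro j hj hj'
    rw [mem_usedPart] at hj hj'
    exact (Finset.mem_sdiff.mp (ω.W_subset k hj')).2 (ω.D_subset k hj)
  W_existsUnique j := by
    obtain ⟨k, -, hk⟩ := Finset.mem_biUnion.mp j.2
    refine ⟨k, ω.mem_usedPart.mpr hk, fun k' hk' => ?_⟩
    replace hk' := ω.mem_usedPart.mp hk'
    by_contra hne
    rcases lt_or_gt_of_ne hne with h | h
    · exact (Finset.mem_sdiff.mp (ω.W_subset k hk)).2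
        (Finset.mem_biUnion.mpr ⟨k', Finset.mem_Iio.mpr h, hk'⟩)
    · exact (Finset.mem_sdiff.mp (ω.W_subset k' hk')).2
        (Finset.mem_biUnion.mpr ⟨k, Finset.mem_Iio.mpr h, hk⟩)
  q j u := codePmf (ω.pairPmf net) Prod.fst (ω.usedPart (ω.A j)) j u
  q_nonneg j u := codePmf_nonneg _ (ω.pairPmf_nonneg net) _ _ _
  q_congr j u v h := codePmf_congr _ h
  q_sum j u := by
    refine sum_codePmf _ (fun h => ?_) u
    exact lt_irrefl _ (ω.superposition_lt j j (ω.mem_usedPart.mp h))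
  c := ω.kernel
  c_nonneg k u b := (ω.compress_isPmf _ _ _).1 _
  c_congr k u v b h := by
    rw [kernel, kernel, ω.restrictD_congr k fun i hi => h i (Finset.mem_union_left _ hi),
      ω.restrictW_congr k fun i hi => h i (Finset.mem_union_right _ hi)]
  map := ω.symbol
  map_congr k u v b h := by
    rw [symbol, symbol, ω.restrictD_congr k fun i hi => h i (Finset.mem_union_left _ hi),
      ω.restrictW_congr k fun i hi => h i (Finset.mem_union_right _ hi)]
  chan k x y := net.chan k (fun i => x i) (fun i => y i) (y k)
  chan_nonneg k x y := (net.chan_isPmf _ _ _).1 _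
  chan_congr k x x' y y' hx hy := by
    rw [hy k le_rfl]
    congr 1
    · funext i
      exact hx i i.2
    · funext i
      exact hy i i.2.le
  chan_sum k x y := by
    rw [← (net.chan_isPmf k (fun i => x i) (fun i => y i)).2]
    refine Finset.sum_congr rfl fun b _ => ?_
    rw [Function.update_self]
    congr 1
    funext i
    exact Function.update_of_ne i.2.ne _ _

theorem sum_fiber_kernel (k : Fin N) (u : (j : ω.used) → ω.U j) (b : Y k) :
    ∑ u' ∈ fiber (ω.usedPart (ω.W k)) u, ω.kernel k u' b = 1 := by
  rw [← (ω.compress_isPmf k (ω.restrictD k u) b).2]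
  refine Finset.sum_bij' (fun u' _ => ω.restrictW k u')
    (fun v _ j => if h : j.1 ∈ ω.W k then v ⟨j.1, h⟩ else u j) ?_ ?_ ?_ ?_ ?_
  · intros
    exact Finset.mem_univ _
  · intro v _
    refine mem_fiber.mpr fun i hi => ?_
    rw [dif_neg fun h => hi (ω.mem_usedPart.mpr h)]
  · intro u' hu'
    funext j
    by_cases h : j.1 ∈ ω.W k
    · simp only [dif_pos h]
      rfl
    · simp only [dif_neg h]
      exact (mem_fiber.mp hu' j fun h' => h (ω.mem_usedPart.mp h')).symm
  · intro v _
    funext j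
    exact dif_pos j.2
  · intro u' hu'
    rw [kernel, ω.restrictD_congr k]
    intro i hi
    refine mem_fiber.mp hu' i fun hiW => ?_
    rw [mem_usedPart] at hi hiW
    exact (Finset.mem_sdiff.mp (ω.W_subset k hiW)).2 (ω.D_subset k hi)

/-! ### Mutual informations as expected log-likelihood ratios -/

/-- The probability of the components `u_V`. -/
noncomputable def uMass (V : Finset ω.used) (w : ((j : ω.used) → ω.U j) × (∀ k, Y k)) : ℝ :=
  mass (ω.pairPmf net) Prod.fst (fun _ => ()) V w.1 ()

/-- The probability of the components `u_V` and `y_k`. -/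
noncomputable def uyMass (k : Fin N) (V : Finset ω.used)
    (w : ((j : ω.used) → ω.U j) × (∀ k, Y k)) : ℝ :=
  mass (ω.pairPmf net) Prod.fst (fun w => w.2 k) V w.1 (w.2 k)

theorem entropy_eq_uMass {α : Type*} [Fintype α] (Z : ω.Sample → α) (V : Finset ω.used)
    (h : ∀ s s', Z s = Z s' ↔ ∀ i ∈ V, s.1 i = s'.1 i) :
    entropy (ω.jointPmf net) Z = -∑ w, ω.pairPmf net w * Real.logb 2 (ω.uMass net V w) :=
  entropy_eq_neg_sum (π := fun s => (s.1, s.2.2))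
    (fun F => ω.sum_jointPmf_mul net fun s => F (s.1, s.2.2)) Z
    (fun w w' => (∀ i ∈ V, w.1 i = w'.1 i) ∧ () = ()) fun s s' => by simpa using h s s'

theorem entropy_eq_uyMass {α : Type*} [Fintype α] (Z : ω.Sample → α) (k : Fin N)
    (V : Finset ω.used)
    (h : ∀ s s', Z s = Z s' ↔ (∀ i ∈ V, s.1 i = s'.1 i) ∧ s.2.2 k = s'.2.2 k) :
    entropy (ω.jointPmf net) Z = -∑ w, ω.pairPmf net w * Real.logb 2 (ω.uyMass net k V w) :=
  entropy_eq_neg_sum (π := fun s => (s.1, s.2.2))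
    (fun F => ω.sum_jointPmf_mul net fun s => F (s.1, s.2.2)) Z
    (fun w w' => (∀ i ∈ V, w.1 i = w'.1 i) ∧ w.2 k = w'.2 k) h

theorem uVar_eq_iff (S : Finset (Fin μ)) (s s' : ω.Sample) :
    ω.uVar S s = ω.uVar S s' ↔ ∀ i ∈ ω.usedPart S, s.1 i = s'.1 i := by
  constructor
  · intro h i hi
    exact congrFun h ⟨i.1, Finset.mem_inter.mpr ⟨ω.mem_usedPart.mp hi, i.2⟩⟩
  · intro h
    funext j
    exact h _ (ω.mem_usedPart.mpr (Finset.mem_inter.mp j.2).1)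

theorem mutualInfo_eq (j : ω.used) (S A : Finset (Fin μ)) (k : Fin N) :
    ω.mutualInfo net j S k A = ∑ w, ω.pairPmf net w *
      (Real.logb 2 (ω.uyMass net k (insert j (ω.usedPart S ∪ ω.usedPart A)) w) -
        Real.logb 2 (ω.uyMass net k (ω.usedPart S ∪ ω.usedPart A) w) -
        (Real.logb 2 (ω.uMass net (insert j (ω.usedPart A)) w) -
          Real.logb 2 (ω.uMass net (ω.usedPart A) w))) := by
  have hj : ∀ s s' : ω.Sample, ω.uVar {j.1} s = ω.uVar {j.1} s' ↔ s.1 j = s'.1 j := by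
    intro s s'
    rw [uVar_eq_iff]
    constructor
    · intro h
      exact h j (by simp [mem_usedPart])
    · intro h i hi
      rw [mem_usedPart, Finset.mem_singleton] at hi
      rw [Subtype.ext hi]
      exact h
  rw [mutualInfo, condMutualInfo, condEntropy, condEntropy,
    ω.entropy_eq_uMass net (fun w => (ω.uVar {j.1} w, ω.uVar A w)) (insert j (ω.usedPart A)),
    ω.entropy_eq_uMass net (ω.uVar A) (ω.usedPart A) (ω.uVar_eq_iff A),
    ω.entropy_eq_uyMass net (fun w => (ω.uVar {j.1} w, (ω.uVar S w, ω.yVar k w), ω.uVar A w)) k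
      (insert j (ω.usedPart S ∪ ω.usedPart A)),
    ω.entropy_eq_uyMass net (fun w => ((ω.uVar S w, ω.yVar k w), ω.uVar A w)) k
      (ω.usedPart S ∪ ω.usedPart A)]
  · simp only [mul_sub, Finset.sum_sub_distrib]
    ring
  · intro s s'
    simp only [Prod.mk.injEq, uVar_eq_iff, yVar, Finset.mem_union]
    constructor
    · rintro ⟨⟨h1, h2⟩, h3⟩
      exact ⟨fun i hi => hi.elim (h1 i) (h3 i), h2⟩
    · rintro ⟨h1, h2⟩
      exact ⟨⟨fun i hi => h1 i (Or.inl hi), h2⟩, fun i hi => h1 i (Or.inr hi)⟩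
  · intro s s'
    simp only [Prod.mk.injEq, hj, uVar_eq_iff, yVar, Finset.forall_mem_insert, Finset.mem_union]
    constructor
    · rintro ⟨h0, ⟨h1, h2⟩, h3⟩
      exact ⟨⟨h0, fun i hi => hi.elim (h1 i) (h3 i)⟩, h2⟩
    · rintro ⟨⟨h0, h1⟩, h2⟩
      exact ⟨h0, ⟨fun i hi => h1 i (Or.inl hi), h2⟩, fun i hi => h1 i (Or.inr hi)⟩
  · intro s s'
    simp only [Prod.mk.injEq, hj, uVar_eq_iff, Finset.forall_mem_insert]

/-- The sums of mutual informations in the decoding and compression conditions. -/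
theorem sum_mutualInfo_eq (k : Fin N) (T : Finset ω.used) (K : Finset (Fin μ))
    (hTK : Disjoint T (ω.usedPart K))
    (hA : ∀ j ∈ T, ω.usedPart (ω.A j) ⊆ T ∪ ω.usedPart K) :
    ∑ j ∈ T.map (Function.Embedding.subtype _), ω.mutualInfo net j
      ((T.map (Function.Embedding.subtype _)).filter (· < j) ∪ K) k (ω.A j) =
      ∑ w, ω.pairPmf net w * Real.logb 2
        (condMass (ω.pairPmf net) Prod.fst (fun w => w.2 k) (ω.usedPart K ∪ T) T w.1 (w.2 k) /
          ∏ j ∈ T, codePmf (ω.pairPmf net) Prod.fst (ω.usedPart (ω.A j)) j w.1) := by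
  -- Conditioning on `A j` adds nothing: its elements lie below `j`, so those in `T` belong to the
  -- initial segment, and the others belong to `K`.
  have hset : ∀ j ∈ T, ω.usedPart ((T.map (Function.Embedding.subtype _)).filter (· < j.1) ∪ K) ∪
      ω.usedPart (ω.A j) = T.filter (· < j) ∪ ω.usedPart K := by
    intro j hj
    have h1 : ω.usedPart ((T.map (Function.Embedding.subtype _)).filter (· < j.1) ∪ K) =
        T.filter (· < j) ∪ ω.usedPart K := by
      ext i
      simp only [mem_usedPart, Finset.mem_union, Finset.mem_filter, Finset.mem_map,
        Function.Embedding.coe_subtype, Subtype.exists, exists_and_right, exists_eq_right,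
        Subtype.coe_eta, Finset.coe_mem, exists_true_left]
      rfl
    rw [h1, Finset.union_eq_left]
    intro i hi
    rcases Finset.mem_union.mp (hA j hj hi) with h | h
    · exact Finset.mem_union_left _ (Finset.mem_filter.mpr
        ⟨h, ω.superposition_lt _ _ (ω.mem_usedPart.mp hi)⟩)
    · exact Finset.mem_union_right _ h
  rw [Finset.sum_map]
  have hinfo : ∀ j ∈ T, ω.mutualInfo net j
      ((T.map (Function.Embedding.subtype _)).filter (· < j.1) ∪ K) k (ω.A j) =
      ∑ w, ω.pairPmf net w *
        (Real.logb 2 (ω.uyMass net k (insert j (T.filter (· < j) ∪ ω.usedPart K)) w) -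
          Real.logb 2 (ω.uyMass net k (T.filter (· < j) ∪ ω.usedPart K) w) -
          (Real.logb 2 (ω.uMass net (insert j (ω.usedPart (ω.A j))) w) -
            Real.logb 2 (ω.uMass net (ω.usedPart (ω.A j)) w))) := fun j hj => by
    rw [← hset j hj]
    exact ω.mutualInfo_eq net j _ _ k
  refine (Finset.sum_congr rfl hinfo).trans ?_
  rw [Finset.sum_comm]
  refine Finset.sum_congr rfl fun w _ => ?_
  rw [← Finset.mul_sum]
  by_cases hw : ω.pairPmf net w = 0
  · rw [hw, zero_mul, zero_mul]
  congr 1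
  simp only [uyMass, uMass]
  convert sum_logb_mass_eq Prod.fst (fun w : ((j : ω.used) → ω.U j) × (∀ k, Y k) => w.2 k)
    (ω.pairPmf_nonneg net) (fun j => ω.usedPart (ω.A j)) hTK.symm hw

end CodingParameters

/-! ### Typicality of the ideal outputs -/

/-- A typicality parameter that vanishes slowly. -/
noncomputable def slack (n : ℕ) : ℝ := (n : ℝ) ^ (-(1 / 4) : ℝ)

theorem tendsto_slack : Tendsto slack atTop (𝓝 0) :=
  (tendsto_rpow_neg_atTop (by norm_num)).comp tendsto_natCast_atTop_atTop

theorem slack_pos {n : ℕ} (hn : 0 < n) : 0 < slack n :=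
  Real.rpow_pos_of_pos (Nat.cast_pos.mpr hn) _

/-- The exponent `-1/4` makes this `n ^ (1/2)`: Chebyshev's bound with a deviation of order `slack
n` still vanishes. -/
theorem tendsto_mul_slack_sq : Tendsto (fun n : ℕ => (n : ℝ) * slack n ^ 2) atTop atTop := by
  have h : Tendsto (fun n : ℕ => (n : ℝ) ^ (1 / 2 : ℝ)) atTop atTop :=
    (tendsto_rpow_atTop (by norm_num)).comp tendsto_natCast_atTop_atTop
  refine h.congr' ?_
  filter_upwards [eventually_gt_atTop 0] with n hn
  have hn' : (0 : ℝ) < n := Nat.cast_pos.mpr hn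
  rw [slack, ← Real.rpow_natCast, ← Real.rpow_mul hn'.le]
  nth_rewrite 2 [← Real.rpow_one (n : ℝ)]
  rw [← Real.rpow_add hn']
  norm_num

namespace Scheme

variable {N : ℕ} {X Y : Fin N → Type*} {J : Type*} [Fintype J] [LinearOrder J]
  {U : J → Type*} [∀ k, Fintype (Y k)] [∀ j, Fintype (U j)] (S : Scheme N X Y J U)

theorem tendsto_prob_not_isTypical (hone : ∑ y, ∑ u, S.joint u y = 1) {A : Type*} [Fintype A]
    (out : (∀ j, U j) → (∀ k, Y k) → A) :
    Tendsto (fun n => (S.pow n).prob fun u y =>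
      ¬IsTypical (fun a => S.mean fun u y => ind (out u y = a)) (slack n)
        fun t => out (fun j => u j t) (fun k => y k t)) atTop (𝓝 0) := by
  classical
  let p : A → ℝ := fun a => S.mean fun u y => ind (out u y = a)
  have hp0 : ∀ a, 0 ≤ p a := fun a => Finset.sum_nonneg fun w _ =>
    mul_nonneg (S.joint_nonneg _ _) (ind_nonneg _)
  have hcard : ∀ n (u : ∀ j, Fin n → U j) (y : ∀ k, Fin n → Y k) a,
      ((Finset.univ.filter fun t => out (fun j => u j t) (fun k => y k t) = a).card : ℝ) =
        ∑ t, ind (out (fun j => u j t) (fun k => y k t) = a) := by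
    intro n u y a
    rw [Finset.natCast_card_filter]
    refine Finset.sum_congr rfl fun t _ => ?_
    split_ifs with h
    · rw [ind_of h]
    · rw [ind_of_not h]
  let E : A → ∀ n, (∀ j, Fin n → U j) → (∀ k, Fin n → Y k) → Prop := fun a n u y =>
    slack n * p a < |(∑ t, ind (out (fun j => u j t) (fun k => y k t) = a)) / n - p a|
  have h1 : Tendsto (fun n => ∑ a, (S.pow n).prob (E a n)) atTop (𝓝 0) := by
    rw [← Finset.sum_const_zero (s := (Finset.univ : Finset A))]
    refine tendsto_finsetSum _ fun a _ => ?_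
    -- Symbols of probability zero almost surely never occur, as robust typicality demands. The
    -- others follow from Chebyshev's inequality with deviation `slack n * p a`.
    rcases (hp0 a).eq_or_lt with ha | ha
    · have hz : ∀ n, (S.pow n).prob (E a n) = 0 := by
        intro n
        refine Finset.sum_eq_zero fun y _ => Finset.sum_eq_zero fun u _ => ?_
        by_cases hj : (S.pow n).joint u y = 0
        · rw [hj, zero_mul]
        rw [ind_of_not, mul_zero]
        have h0 : ∀ t, ind (out (fun j => u j t) (fun k => y k t) = a) = 0 := by
          intro t
          have hsum := (Finset.sum_eq_zero_iff_of_nonneg fun w _ =>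
            mul_nonneg (S.joint_nonneg _ _) (ind_nonneg _)).mp ha.symm
            (fun j => u j t, fun k => y k t) (Finset.mem_univ _)
          rw [pow_joint] at hj
          exact (mul_eq_zero.mp hsum).resolve_left
            (Finset.prod_ne_zero_iff.mp hj t (Finset.mem_univ t))
        simp [E, h0, ← ha]
      simp only [hz]
      exact tendsto_const_nhds
    · have hb : Tendsto (fun n : ℕ => S.mean (fun u y => (ind (out u y = a) - p a) ^ 2) /
          (n * (slack n * p a) ^ 2)) atTop (𝓝 0) := by
        refine Tendsto.div_atTop tendsto_const_nhds ?_
        have := tendsto_mul_slack_sq.atTop_mul_const (show 0 < p a ^ 2 by positivity)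
        refine this.congr fun n => ?_
        ring
      refine tendsto_of_tendsto_of_tendsto_of_le_of_le' tendsto_const_nhds hb
        (Eventually.of_forall fun n => (S.pow n).prob_nonneg _) ?_
      filter_upwards [eventually_gt_atTop 0] with n hn
      refine S.pow_prob_le hone n hn (E a n) (fun u y => ind (out u y = a))
        (mul_pos (slack_pos hn) ha) fun u y _ hE => ?_
      have hn' : (0 : ℝ) < n := Nat.cast_pos.mpr hn
      rw [Finset.sum_sub_distrib, Finset.sum_const, Finset.card_univ, Fintype.card_fin,
        nsmul_eq_mul]
      have h2 : (∑ t, ind (out (fun j => u j t) (fun k => y k t) = a)) - n * p a =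
          ((∑ t, ind (out (fun j => u j t) (fun k => y k t) = a)) / n - p a) * n := by
        field_simp
      change _ ≤ |_ - n * p a|
      rw [h2, abs_mul, abs_of_pos hn']
      exact mul_le_mul_of_nonneg_right hE.le hn'.le
  refine tendsto_of_tendsto_of_tendsto_of_le_of_le tendsto_const_nhds h1
    (fun n => (S.pow n).prob_nonneg _) fun n => ?_
  refine le_trans ((S.pow n).prob_mono fun u y h => ?_) ((S.pow n).prob_exists_le _ _)
  simp only [IsTypical, not_forall, not_le] at h
  obtain ⟨a, ha⟩ := h
  refine ⟨a, Finset.mem_univ a, ?_⟩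
  simp only [E]
  rw [← hcard]
  convert ha

end Scheme

/-! ### The rate conditions in terms of likelihood ratios -/

namespace CodingParameters

variable {N : ℕ} {X Y : Fin N → Type*} [∀ k, Fintype (X k)] [∀ k, Fintype (Y k)] {μ : ℕ}
  (ω : CodingParameters N X Y μ μ) (net : ADMN N X Y)

theorem isPmf_pairPmf {pstar : (∀ k, X k) × (∀ k, Y k) → ℝ} (hpstar : IsPmf pstar)
    (hω : ω ∈ Omega net pstar μ μ) : IsPmf (ω.pairPmf net) := by
  classical
  refine ⟨ω.pairPmf_nonneg net, ?_⟩
  have h1 := ω.sum_jointPmf_mul net fun _ => 1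
  simp only [mul_one] at h1
  have h2 : ∑ xy, pstar xy = ∑ xy, ∑ s : ω.Sample, if s.2 = xy then ω.jointPmf net s else 0 :=
    Finset.sum_congr rfl fun xy _ => by
      rw [← hω xy, lawOf]
      exact Finset.sum_congr rfl fun s _ => by congr
  rw [← h1, ← hpstar.2, h2, Finset.sum_comm]
  simp

theorem mean_eq_pstar {pstar : (∀ k, X k) × (∀ k, Y k) → ℝ} (hω : ω ∈ Omega net pstar μ μ)
    (hΓ : ∀ j, ω.Γ j = {j} ∪ ω.A j) :
    (fun a => (ω.toScheme net hΓ).mean fun u y =>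
      ind (((ω.toScheme net hΓ).inputs u y, y) = a)) = pstar := by
  funext a
  rw [← hω a, lawOf]
  have h := ω.sum_jointPmf_mul net fun s => ind (s.2 = a)
  refine h.symm.trans (Finset.sum_congr rfl fun s _ => ?_)
  split_ifs with hs
  · rw [ind_of hs, mul_one]
  · rw [ind_of_not hs, mul_zero]

/-- The likelihoods of the decoding tests. -/
noncomputable def likelihood (k : Fin N) (T : Finset ω.used) (u : (j : ω.used) → ω.U j)
    (b : Y k) : ℝ :=
  condMass (ω.pairPmf net) Prod.fst (fun w => w.2 k) (ω.usedPart (ω.D k ∪ ω.B k)) T u b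

theorem mem_map_subtype {T : Finset ω.used} {j : ω.used} :
    j.1 ∈ T.map (Function.Embedding.subtype _) ↔ j ∈ T := by
  simp

/-- The likelihood is the true conditional pmf of `u_T` given the remaining decoded codewords and
`y_k`, so the chain rule gives equality with the sum of mutual informations. -/
theorem rate_lt_decodeInfo (hΓ : ∀ j, ω.Γ j = {j} ∪ ω.A j) {k : Fin N}
    (h : ω.DecodingCondition net k) {T : Finset ω.used}
    (hT : T ∈ (ω.toScheme net hΓ).decodeFamily k) :
    ∑ j ∈ T, ω.r j < (ω.toScheme net hΓ).decodeInfo (ω.likelihood net) k T := by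
  obtain ⟨hTV, hTD, hTA⟩ := Finset.mem_filter.mp hT
  rw [Finset.mem_powerset] at hTV
  set T₀ := T.map (Function.Embedding.subtype _) with hT₀
  have hV : ω.D k ∪ ω.B k ⊆ ω.used := Finset.union_subset (ω.D_subset_used k) (ω.B_subset_used k)
  have hsub : T₀ ⊆ ω.D k ∪ ω.B k := by
    intro j hj
    obtain ⟨i, hi, rfl⟩ := Finset.mem_map.mp hj
    exact ω.mem_usedPart.mp (hTV hi)
  have key := h T₀ hsub (by
    obtain ⟨j, hj⟩ := hTD
    obtain ⟨hjT, hjD⟩ := Finset.mem_inter.mp hj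
    exact ⟨j, Finset.mem_inter.mpr ⟨ω.mem_map_subtype.mpr hjT, ω.mem_usedPart.mp hjD⟩⟩) (by
    intro j hj i hi
    obtain ⟨hjV, hjT⟩ := Finset.mem_sdiff.mp hj
    let j' : ω.used := ⟨j, hV hjV⟩
    let i' : ω.used := ⟨i, ω.A_subset_used j' hi⟩
    have hi' := hTA j' (Finset.mem_sdiff.mpr ⟨ω.mem_usedPart.mpr hjV,
      fun h => hjT (ω.mem_map_subtype.mpr h)⟩) (show i' ∈ _ from ω.mem_usedPart.mpr hi)
    obtain ⟨h1, h2⟩ := Finset.mem_sdiff.mp hi'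
    exact Finset.mem_sdiff.mpr ⟨ω.mem_usedPart.mp h1, fun h =>
      h2 (ω.mem_map_subtype (j := i').mp h)⟩)
  have hK : ∀ j : ω.used, j ∈ ω.usedPart ((ω.D k ∪ ω.B k) \ T₀) ↔
      j ∈ ω.usedPart (ω.D k ∪ ω.B k) ∧ j ∉ T := by
    intro j
    rw [mem_usedPart, Finset.mem_sdiff, mem_usedPart, hT₀, ω.mem_map_subtype]
  rw [hT₀, Finset.sum_map, ω.sum_mutualInfo_eq net k T] at key
  · have hU : ω.usedPart ((ω.D k ∪ ω.B k) \ T₀) ∪ T = ω.usedPart (ω.D k ∪ ω.B k) := by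
      ext j
      rw [Finset.mem_union, hK]
      constructor
      · rintro (h | h)
        · exact h.1
        · exact hTV h
      · intro h
        by_cases hj : j ∈ T
        · exact Or.inr hj
        · exact Or.inl ⟨h, hj⟩
    rw [← hT₀, hU] at key
    exact key
  · exact Finset.disjoint_right.mpr fun j hj => ((hK j).mp hj).2
  · intro j hj i hi
    by_cases hiT : i ∈ T
    · exact Finset.mem_union_left _ hiT
    · exact Finset.mem_union_right _ ((hK i).mpr
        ⟨(ω.toScheme net hΓ).A_V k j (hTV hj) hi, hiT⟩)

theorem coverInfo_lt_rate (hΓ : ∀ j, ω.Γ j = {j} ∪ ω.A j) (hP : IsPmf (ω.pairPmf net)) {k : Fin N}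
    (h : ω.CompressionCondition net k) {T : Finset ω.used}
    (hT : T ∈ (ω.toScheme net hΓ).coverFamily k) (hne : T.Nonempty) :
    (ω.toScheme net hΓ).coverInfo k T < ∑ j ∈ T, ω.r j := by
  set S := ω.toScheme net hΓ with hS
  obtain ⟨hTW, hTA⟩ := Finset.mem_filter.mp hT
  rw [Finset.mem_powerset] at hTW
  set T₀ := T.map (Function.Embedding.subtype _) with hT₀
  have hdisj : Disjoint (ω.usedPart (ω.D k)) T := (S.D_W k).mono_right hTW
  have key := h T₀ (by
    intro j hj
    obtain ⟨i, hi, rfl⟩ := Finset.mem_map.mp hj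
    exact ω.mem_usedPart.mp (hTW hi)) (by
    obtain ⟨j, hj⟩ := hne
    exact ⟨j, ω.mem_map_subtype.mpr hj⟩) (by
    intro j hj i hi
    obtain ⟨j', hj', rfl⟩ := Finset.mem_map.mp hj
    obtain ⟨hiA, hiW⟩ := Finset.mem_inter.mp hi
    let i' : ω.used := ⟨i, ω.A_subset_used j' hiA⟩
    exact ω.mem_map_subtype (j := i').mpr (hTA j' hj' (Finset.mem_inter.mpr
      ⟨ω.mem_usedPart.mpr hiA, ω.mem_usedPart.mpr hiW⟩)))
  rw [hT₀, ω.sum_mutualInfo_eq net k T _ hdisj.symm, Finset.sum_map] at key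
  · refine lt_of_le_of_lt ?_ key
    -- The marginal of the compression kernel need not be identified with the conditional pmf of
    -- `u_T` given `u_{D_k}` and `y_k` under the joint law. Gibbs' inequality suffices, since only
    -- an upper bound on `coverInfo` is required.
    have hGibbs := sum_logb_le_sum_logb_condMass (P := ω.pairPmf net) Prod.fst
      (fun w : ((j : ω.used) → ω.U j) × (∀ k, Y k) => w.2 k) hP hdisj
      (fun u b => S.coverMarginal k T u b)
      (fun u b => Finset.sum_nonneg fun _ _ => S.c_nonneg _ _ _)
      (fun u v b huv => by
        refine sum_fiber_congr _ (S.D k ∪ S.W k) (fun i hi hiE => huv i ?_) _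
          fun s t hst => S.c_congr k s t b hst
        rcases Finset.mem_union.mp hi with hi | hi
        · exact Finset.mem_union_left _ hi
        · refine Finset.mem_union_right _ ?_
          by_contra hiT
          exact hiE (Finset.mem_sdiff.mpr ⟨hi, hiT⟩))
      (fun u b => by
        simp only [Scheme.coverMarginal]
        have h1 := sum_fiber_fiber (E := T) (E' := S.W k \ T) Finset.disjoint_sdiff u
          fun u' => S.c k u' b
        rw [Finset.union_sdiff_of_subset hTW] at h1
        refine le_of_eq (Eq.trans ?_ (ω.sum_fiber_kernel k u b))
        convert h1 <;> rfl)
      (fun w hw => by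
        have hc : S.c k w.1 (w.2 k) ≠ 0 :=
          (mul_ne_zero_iff.mp (Finset.prod_ne_zero_iff.mp hw k (Finset.mem_univ k))).2
        refine (lt_of_lt_of_le (lt_of_le_of_ne (S.c_nonneg k _ _) hc.symm)
          (Finset.single_le_sum (f := fun u' => S.c k u' (w.2 k)) (fun _ _ => S.c_nonneg _ _ _)
            (mem_fiber.mpr fun _ _ => rfl))).ne')
      (fun u => ∏ j ∈ T, S.q j u)
      (fun w hw => Finset.prod_ne_zero_iff.mpr fun j _ =>
        (codePmf_pos Prod.fst hP.1 _ _ hw).ne')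
    convert hGibbs <;> rfl
  · intro j hj i hi
    rcases Finset.mem_union.mp (S.A_W k j (hTW hj) hi) with h | h
    · exact Finset.mem_union_right _ h
    · exact Finset.mem_union_left _ (hTA j hj (Finset.mem_inter.mpr ⟨hi, h⟩))

end CodingParameters

theorem IsTypical.mono {α : Type*} {p : α → ℝ} (hp : ∀ a, 0 ≤ p a) {ε ε' : ℝ} (h : ε ≤ ε') {n : ℕ}
    {z : Fin n → α} (hz : IsTypical p ε z) : IsTypical p ε' z := fun a =>
  (hz a).trans (mul_le_mul_of_nonneg_right h (hp a))

theorem corollary1 {N : ℕ} {X Y : Fin N → Type*} [∀ k, Fintype (X k)] [∀ k, Fintype (Y k)]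
    (net : ADMN N X Y) (pstar : (∀ k, X k) × (∀ k, Y k) → ℝ) (hpstar : IsPmf pstar)
    (h : ∃ (μ : ℕ) (ω : CodingParameters N X Y μ μ), ω ∈ OmegaPrime net pstar μ ∧
      ∀ k : Fin N, ω.DecodingCondition net k ∧ ω.CompressionCondition net k) :
    Achievable net pstar := by
  classical
  obtain ⟨μ, ω, ⟨hω, hΓ⟩, hcond⟩ := h
  set S := ω.toScheme net hΓ with hS
  have hP := ω.isPmf_pairPmf net hpstar hω
  have hone : ∑ y, ∑ u, S.joint u y = 1 := by
    rw [← hP.2, Fintype.sum_prod_type, Finset.sum_comm]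
    rfl
  have htyp := S.tendsto_prob_not_isTypical hone fun u y => (S.inputs u y, y)
  rw [ω.mean_eq_pstar net hω hΓ] at htyp
  obtain ⟨f, hf⟩ := S.exists_nodes_tendsto hone (ω.likelihood net) (fun j => ω.r j)
    (fun u y j hj => (codePmf_pos (P := ω.pairPmf net) Prod.fst hP.1 _ _ (w := (u, y)) hj).ne')
    (fun k T _ u b => condMass_nonneg _ _ hP.1 _ _ _ _)
    (fun k T _ u v b huv => condMass_congr _ _ _ huv _)
    (fun k T hT u b => by
      have h1 := sum_fiber_condMass_le_one (P := ω.pairPmf net) Prod.fst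
        (fun w : ((j : ω.used) → ω.U j) × (∀ k, Y k) => w.2 k)
        (Finset.mem_powerset.mp (Finset.mem_filter.mp hT).1) u b
      simp only [CodingParameters.likelihood]
      convert h1
      rfl)
    (fun k T _ u y hj => (condMass_pos (P := ω.pairPmf net) Prod.fst
      (fun w : ((j : ω.used) → ω.U j) × (∀ k, Y k) => w.2 k) hP.1 _ _ (w := (u, y)) hj).ne')
    (fun k u b => by
      refine le_of_eq (Eq.trans ?_ (ω.sum_fiber_kernel k u b))
      congr)
    (fun j => ω.r_nonneg j)
    (fun k T hT => ω.rate_lt_decodeInfo net hΓ (hcond k).1 hT)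
    (fun k T hT hne => ω.coverInfo_lt_rate net hΓ hP (hcond k).2 hT hne)
    -- The success criterion does not involve `ε`, so the resulting codes do not depend on it; for
    -- large `n`, `slack n ≤ ε` gives typicality with parameter `ε`.
    (fun n x y => IsTypical pstar (slack n) fun t => ((fun k => x k t), fun k => y k t)) htyp
  refine ⟨f, fun ε hε => ?_⟩
  have hchan : ∀ n y, receiveProb net (f n) y =
      ∏ k, (S.pow n).chan k (fun k => f n k (y k)) y := fun _ _ => rfl
  have hnonneg : ∀ n y, 0 ≤ receiveProb net (f n) y := fun n y =>
    Finset.prod_nonneg fun k _ => Finset.prod_nonneg fun t _ => (net.chan_isPmf _ _ _).1 _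
  refine tendsto_of_tendsto_of_tendsto_of_le_of_le' tendsto_const_nhds hf
    (Eventually.of_forall fun n => Finset.sum_nonneg fun y _ => ?_) ?_
  · split_ifs
    · exact le_rfl
    · exact hnonneg n y
  · filter_upwards [tendsto_slack.eventually_le_const hε] with n hn
    refine Finset.sum_le_sum fun y _ => ?_
    rw [← hchan]
    split_ifs with ht
    · exact mul_nonneg (hnonneg n y) (ind_nonneg _)
    · rw [ind_of, mul_one]
      exact fun h => ht (h.mono hpstar.1 hn)
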